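/- **Setting.** There are $n$ nodes, of which a set $\mathcal C$ of $|\mathcal C| = n-f$ nodes is correct; the other $f$ nodes may behave arbitrarily. Node $i$ has a data distribution $\mathcal D_i$ and local loss $Q^{(i)}(\theta)=\mathbb E_{x\sim\mathcal D_i}[q(\theta,x)]$, $\theta\in\mathbb R^d$, where $q(\cdot,x)$ is differentiable; $Q^{(\mathcal C)}=\frac1{|\mathcal C|}\sum_{i\in\mathcal C}Q^{(i)}$ is bounded below and $Q^*=\inf_\theta Q^{(\mathcal C)}(\theta)$. Assume that for all $i\in\mathcal C$ and $\theta,\theta'\in\mathbb R^d$ - $Q^{(i)}$ is differentiable and $\|\nabla Q^{(i)}(\theta)-\nabla Q^{(i)}(\theta')\|\le L\|\theta-\theta'\|$, with $L>0$; - $\mathbb E_{x\sim\mathcal D_i}\|\nabla q(\theta,x)-\nabla Q^{(i)}(\theta)\|^2\le\sigma^2$; - $\frac1{|\mathcal C|}\sum_{i\in\mathcal C}\|\nabla Q^{(i)}(\theta)-\nabla Q^{(\mathcal C)}(\theta)\|^2\le\zeta^2$. **Algorithm (MoNNA).** Every correct node $i$ starts from the same model $\theta_0^{(i)}=\theta_0$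 and $m^{(i)}_{-1}=0$. In iteration $t=0,\dots,T-1$ it draws a fresh $x\sim\mathcal D_i$ (independent of the past and of the draws of the other correct nodes), sets $m_t^{(i)}=\beta m_{t-1}^{(i)}+(1-\beta)\nabla q(\theta_t^{(i)},x)$ and $x_0^{(i)}=\theta_t^{(i)}-\gamma m_t^{(i)}$, and performs $K$ coordination rounds. In round $k=1,\dots,K$ each correct node $i$ broadcasts $x_{k-1}^{(i)}$; a faulty node broadcasts an arbitrary vector (the same to all correct nodes, possibly depending on the whole history) or does not send. Node $i$ receives the vectors of an arbitrary set of $n-f-1$ other nodes, and $x_k^{(i)}$ is the average of $x_{k-1}^{(i)}$ and of the $n-2f-1$ received vectors that are nearest to it (ties broken arbitrarily). Then $\theta_{t+1}^{(i)}=x_K^{(i)}$. The output $\hat\theta^{(i)}$ is uniform on $\{\theta_0^{(i)},\dots,\theta_{T-1}^{(i)}\}$, the index being independent of the execution. **Corollary.** Let $\delta>0$ and $n\ge(5+\delta)f$. Put $\alpha=\frac{2f}{n-f}$, $\lambda=\left(\frac{3+\delta}{\delta}\right)^2\frac{(8f)^2}{n-f}$, $c_0=12\,(Q^{(\mathcal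 C)}(\theta_0)-Q^*)$, $c_1=\frac{18\alpha(1+\alpha)}{(1-\alpha)^2}$, $$c_2=72\left(\frac3{n-f}+3c_1+\frac{9\lambda}2(2c_1+3)\right),\qquad c_3=7\left(6c_1+\frac{9\lambda}2(4c_1+9)\right).$$ Run MoNNA with $$K=\left\lceil\frac{\log(8(n-f))}{2\log\frac{3+\delta}3}\right\rceil+1,\qquad \gamma=\min\left\{\frac1{12L},\ \frac1L\sqrt{\frac2{3c_1}},\ \sqrt{\frac{c_0}{c_2LT\sigma^2}}\right\},\qquad \beta=\sqrt{1-12\gamma L},$$ where the second term in the minimum is $+\infty$ if $c_1=0$ and the third is $+\infty$ if $\sigma=0$. For fixed $\delta$, $K=\mathcal O(\log n)$. For all $T\ge1$ and $i\in\mathcal C$, $$\mathbb E\left\|\nabla Q^{(\mathcal C)}(\hat\theta^{(i)})\right\|^2\le 2\sqrt{\frac{c_0c_2L\sigma^2}T}+\frac{12Lc_0}T+\frac{Lc_0}T\sqrt{\frac{3c_1}2}+\frac{36}T\cdot\frac{\sigma^2}{n-f}+c_3\zeta^2 .$$ Moreover, there is a constant $B$, depending only on $\delta$, such that the right-hand side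 is at most $$B\left(\sqrt{\frac{Lc_0\sigma^2(1+f)^2}{nT}}+\frac{f^2}n\zeta^2+\frac{Lc_0+\sigma^2/n}T\right).$$ -/

import Mathlib

open MeasureTheory ProbabilityTheory

noncomputable section

namespace MoNNA

/-- The parameter space `ℝ^d` with its Euclidean norm. -/
abbrev Param (d : ℕ) : Type := EuclideanSpace ℝ (Fin d)

section Losses

variable {n d : ℕ} {X : Type*} [MeasurableSpace X]

/-- Local loss `Q⁽ⁱ⁾(θ) = E_{x ∼ D i} [q(θ, x)]`. -/
def localLoss (q : Param d → X → ℝ) (D : Fin n → Measure X) (i : Fin n) (θ : Param d) : ℝ :=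
  ∫ x, q θ x ∂(D i)

/-- Average loss `Q⁽ᶜ⁾` of the nodes in `C`. -/
def avgLoss (q : Param d → X → ℝ) (D : Fin n → Measure X) (C : Finset (Fin n))
    (θ : Param d) : ℝ :=
  (C.card : ℝ)⁻¹ * ∑ i ∈ C, localLoss q D i θ

/-- Optimal value `Q^*` of the average loss. -/
def optValue (q : Param d → X → ℝ) (D : Fin n → Measure X) (C : Finset (Fin n)) : ℝ :=
  ⨅ θ : Param d, avgLoss q D C θ

/-- What the definitions of the local losses of the nodes in `C` presuppose: the pointwise loss is
differentiable in the parameter, measurable in the data point, and has an expectation under every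
data distribution. -/
def IsWellPosed (q : Param d → X → ℝ) (D : Fin n → Measure X) (C : Finset (Fin n)) : Prop :=
  (∀ x, Differentiable ℝ fun θ => q θ x) ∧
  (∀ θ, Measurable (q θ)) ∧
  ∀ i ∈ C, ∀ θ, Integrable (q θ) (D i)

/-- Lipschitz smoothness: the gradients of the local losses are `L`-Lipschitz. -/
def IsLipschitzSmooth (q : Param d → X → ℝ) (D : Fin n → Measure X) (C : Finset (Fin n))
    (L : ℝ) : Prop :=
  ∀ i ∈ C, Differentiable ℝ (localLoss q D i) ∧
    ∀ θ₁ θ₂, ‖gradient (localLoss q D i) θ₁ - gradient (localLoss q D i) θ₂‖ ≤ L * ‖θ₁ - θ₂‖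

/-- Bounded variance of the local stochastic gradients. -/
def HasBoundedVariance (q : Param d → X → ℝ) (D : Fin n → Measure X) (C : Finset (Fin n))
    (σ : ℝ) : Prop :=
  ∀ i ∈ C, ∀ θ,
    Integrable (fun x => ‖gradient (fun θ' => q θ' x) θ - gradient (localLoss q D i) θ‖ ^ 2)
      (D i) ∧
    ∫ x, ‖gradient (fun θ' => q θ' x) θ - gradient (localLoss q D i) θ‖ ^ 2 ∂(D i) ≤ σ ^ 2

/-- `ζ`-heterogeneity: bounded diversity of the gradients of the local losses. -/
def IsHeterogeneous (q : Param d → X → ℝ) (D : Fin n → Measure X) (C : Finset (Fin n))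
    (ζ : ℝ) : Prop :=
  ∀ θ, (C.card : ℝ)⁻¹ *
    ∑ i ∈ C, ‖gradient (localLoss q D i) θ - gradient (avgLoss q D C) θ‖ ^ 2 ≤ ζ ^ 2

end Losses

section Algorithm

variable {n d : ℕ}

/-- `y` is an output of nearest neighbor averaging at node `i`, which holds `v i` and has received
the vectors `v j`, `j ∈ R`, where `R` consists of `n - f - 1` other nodes. The enumeration `ψ`
sorts `R` by distance to `v i` (ties are broken arbitrarily), and `y` is the average of `v i` and
of the first `n - 2f - 1` vectors in this order. -/
def IsNNA (f : ℕ) (v : Fin n → Param d) (i : Fin n) (R : Finset (Fin n)) (y : Param d) : Prop :=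
  ∃ ψ : Fin (n - f - 1) ↪ Fin n,
    Finset.univ.map ψ = R ∧
    Monotone (fun j => ‖v i - v (ψ j)‖) ∧
    y = ((n : ℝ) - 2 * f)⁻¹ •
      (v i + ∑ j ∈ Finset.univ.filter (fun j : Fin (n - f - 1) => j.1 < n - 2 * f - 1), v (ψ j))

/-- A possible run of the coordination phase with `K` rounds, in which the correct nodes `i ∈ C`
start from `z i` and end with `y i`. Here `v k j` is the vector that node `j` broadcasts in the
`(k+1)`-st round: for a correct node its current vector, for a faulty node an arbitrary vector, the
same for all receivers because of the signed echo broadcast. By asynchrony, each correct node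
averages over an arbitrary set `R` of `n - f - 1` other nodes, and so a faulty node may also remain
silent. -/
def IsCoordination (C : Finset (Fin n)) (f K : ℕ) (z y : Fin n → Param d) : Prop :=
  ∃ v : ℕ → Fin n → Param d,
    (∀ i ∈ C, v 0 i = z i) ∧
    (∀ k < K, ∀ i ∈ C, ∃ R : Finset (Fin n),
      R.card = n - f - 1 ∧ i ∉ R ∧ IsNNA f (v k) i R (v (k + 1) i)) ∧
    ∀ i ∈ C, y i = v K i

/-- An execution of `T` iterations (numbered `0, …, T - 1`) of MoNNA on a probability space, with
set of correct nodes `C`, initial model `θ₀`, learning rate `γ`, momentum coefficient `β` and `K`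
coordination rounds per iteration. Nothing is required of the nodes outside `C`: their messages may
depend on everything that has happened, including the data points just drawn by the correct
nodes, but not on data points drawn later. -/
structure Execution {Ω X : Type*} [mΩ : MeasurableSpace Ω] [MeasurableSpace X] (μ : Measure Ω)
    (q : Param d → X → ℝ) (D : Fin n → Measure X) (C : Finset (Fin n)) (f : ℕ)
    (θ₀ : Param d) (γ β : ℝ) (K T : ℕ) where
  /-- `hist t` is the history before iteration `t`. -/
  hist : Filtration ℕ mΩ
  /-- `sample t i` is the data point drawn by node `i` in iteration `t`. -/
  sample : ℕ → Fin n → Ω → X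
  /-- `model t i` is the local model of node `i` at the beginning of iteration `t`. -/
  model : ℕ → Fin n → Ω → Param d
  /-- `momentum t i` is the local momentum of node `i` computed in iteration `t`. -/
  momentum : ℕ → Fin n → Ω → Param d
  /-- `idx i` is the random iteration whose model is returned by node `i`. -/
  idx : Fin n → Ω → Fin T
  -- Data points are fresh and independent across the correct nodes, and have the right laws.
  sample_measurable : ∀ t < T, ∀ i ∈ C, Measurable[hist (t + 1)] (sample t i)
  sample_law : ∀ t < T, ∀ i ∈ C, μ.map (sample t i) = D i
  sample_indep : ∀ t < T, iIndepFun (fun (i : C) => sample t i) μ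
  sample_fresh : ∀ t < T,
    Indep (MeasurableSpace.comap (fun ω (i : C) => sample t i ω) inferInstance) (hist t) μ
  -- Models are determined by the history.
  model_measurable : ∀ t ≤ T, ∀ i ∈ C, Measurable[hist t] (model t i)
  -- All correct nodes start from the same model.
  model_zero : ∀ i ∈ C, ∀ ω, model 0 i ω = θ₀
  -- Local phase: the momentum before the first iteration is zero by convention.
  momentum_eq : ∀ t < T, ∀ i ∈ C, ∀ ω,
    momentum t i ω = β • (if t = 0 then 0 else momentum (t - 1) i ω) +
      (1 - β) • gradient (fun θ => q θ (sample t i ω)) (model t i ω)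
  -- Coordination phase, started from the partially updated models.
  coordination : ∀ t < T, ∀ ω,
    IsCoordination C f K (fun i => model t i ω - γ • momentum t i ω) (fun i => model (t + 1) i ω)
  -- The returned iteration is uniform and independent of the execution.
  idx_measurable : ∀ i ∈ C, Measurable (idx i)
  idx_uniform : ∀ i ∈ C, ∀ s : Fin T, μ.real {ω | idx i ω = s} = 1 / T
  idx_indep : ∀ i ∈ C, Indep (MeasurableSpace.comap (idx i) inferInstance) (hist T) μ

/-- The model returned by node `i`, uniform on `{θ_0⁽ⁱ⁾, …, θ_{T-1}⁽ⁱ⁾}`. -/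
def Execution.output {Ω X : Type*} [MeasurableSpace Ω] [MeasurableSpace X] {μ : Measure Ω}
    {q : Param d → X → ℝ} {D : Fin n → Measure X} {C : Finset (Fin n)} {f : ℕ}
    {θ₀ : Param d} {γ β : ℝ} {K T : ℕ} (e : Execution μ q D C f θ₀ γ β K T)
    (i : Fin n) (ω : Ω) : Param d :=
  e.model (e.idx i ω) i ω

end Algorithm

section Constants

/-- `α = 2f / (n - f)`. -/
def alpha (n f : ℕ) : ℝ := 2 * f / ((n : ℝ) - f)

/-- `λ = ((3 + δ) / δ)² (8f)² / (n - f)`. -/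
def lam (δ : ℝ) (n f : ℕ) : ℝ := ((3 + δ) / δ) ^ 2 * ((8 * f) ^ 2 / ((n : ℝ) - f))

def c1 (n f : ℕ) : ℝ := 18 * alpha n f * (1 + alpha n f) / (1 - alpha n f) ^ 2

def c2 (δ : ℝ) (n f : ℕ) : ℝ :=
  72 * (3 / ((n : ℝ) - f) + 3 * c1 n f + 9 * lam δ n f / 2 * (2 * c1 n f + 3))

def c3 (δ : ℝ) (n f : ℕ) : ℝ :=
  7 * (6 * c1 n f + 9 * lam δ n f / 2 * (4 * c1 n f + 9))

/-- Number of coordination rounds per iteration. -/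
def rounds (δ : ℝ) (n f : ℕ) : ℕ :=
  ⌈Real.log (8 * ((n : ℝ) - f)) / (2 * Real.log ((3 + δ) / 3))⌉₊ + 1

/-- Learning rate
`γ = min {1 / (12 L), (1 / L) √(2 / (3 c₁)), √(c₀ / (c₂ L T σ²))}`,
where the second term is `+∞` if `c₁ = 0`, and the third one is `+∞` if `σ = 0`. -/
def learningRate (δ : ℝ) (n f : ℕ) (L σ c0 : ℝ) (T : ℕ) : ℝ :=
  min (1 / (12 * L))
    (min (if c1 n f = 0 then 1 / (12 * L) else 1 / L * √(2 / (3 * c1 n f)))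
      (if σ = 0 then 1 / (12 * L) else √(c0 / (c2 δ n f * L * T * σ ^ 2))))

/-- Momentum coefficient `β = √(1 - 12 γ L)`. -/
def momentumCoeff (γ L : ℝ) : ℝ := √(1 - 12 * γ * L)

/-- The bound on the expected squared gradient norm at the returned models. -/
def errorBound (δ : ℝ) (n f : ℕ) (L σ ζ c0 : ℝ) (T : ℕ) : ℝ :=
  2 * √(c0 * c2 δ n f * L * σ ^ 2 / T) + 12 * L * c0 / T + L * c0 / T * √(3 * c1 n f / 2)
    + 36 / T * (σ ^ 2 / ((n : ℝ) - f)) + c3 δ n f * ζ ^ 2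

end Constants

end MoNNA

end

/-! The proof combines a deterministic contraction property of the coordination phase with a
stochastic descent argument for the average model.

Coordination. A nearest neighbor average is a mean of `n - 2f` vectors, none farther from the node's
own vector than the diameter `D` of the correct vectors. Two such selections differ in at most `2f`
vectors on each side, at most `f` of the differing vectors are faulty, and pairing them off shows
that the two means differ by at most `3f / (n - 2f) * D` (`norm_sum_sub_sum_le`). For `n ≥ (5 + δ)
f` this factor is at most `3 / (3 + δ) < 1`. Meanwhile the average of the correct vectors moves by
at most `4f / (n - 2f) * D` per round (`norm_sum_sub_avg_le`), hence by a geometric series in total.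
Passing between diameter and mean squared distance loses a factor of order `n - f`, which
logarithmically many rounds compensate. The outcome is `IsCoordination.reduction`: the spread
shrinks by `α²` and the average drifts by at most `λ` times the spread.

Noise. Unbiasedness of the stochastic gradients is not a hypothesis. It follows by differentiating
the expectation along lines, where the variance and smoothness bounds control second moments
(`integral_deriv_eq`, `integral_gradient_sub`). By freshness and independence the noise is then
orthogonal to the past, and averaging over the correct nodes divides its variance by `n - f`.

Descent. The spreads of models and momenta satisfy a coupled recursion with an invariant bound of
order `γ² ((1 - β) σ² + ζ²)` (`spreadBound_step`, `integral_spread_step`). The deviation of the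
average momentum from the true gradient contracts by `β`, up to noise, spread and the squared step
of the average model divided by `1 - β`. The descent inequality `avgLoss_step` has a spare multiple
of the squared step on its left side; since `β² = 1 - 12 γ L`, it absorbs that last term
(`combine_bounds`). Summing over the iterations, returning from the average model to a local one and
inserting the learning rate gives the bound. If `σ ≠ 0` and the start is already optimal, the
learning rate vanishes and nothing moves, so this case is treated separately. -/

namespace MoNNA

/-! ### Averages and mean squared deviations of finite families of vectors -/

section Averages

variable {ι E : Type*} [NormedAddCommGroup E] [InnerProductSpace ℝ E] {C : Finset ι}

/-- Average of a family of vectors over `C`. -/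
noncomputable def avg (C : Finset ι) (v : ι → E) : E := (C.card : ℝ)⁻¹ • ∑ i ∈ C, v i

/-- Mean squared distance of a family of vectors to its average over `C`. -/
noncomputable def spread (C : Finset ι) (v : ι → E) : ℝ :=
  (C.card : ℝ)⁻¹ * ∑ i ∈ C, ‖v i - avg C v‖ ^ 2

lemma spread_nonneg (C : Finset ι) (v : ι → E) : 0 ≤ spread C v := by
  unfold spread; positivity

lemma avg_add (v w : ι → E) : avg C (fun i => v i + w i) = avg C v + avg C w := by
  simp [avg, Finset.sum_add_distrib]

lemma avg_sub (v w : ι → E) : avg C (fun i => v i - w i) = avg C v - avg C w := by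
  simp [avg, Finset.sum_sub_distrib, smul_sub]

lemma avg_smul (a : ℝ) (v : ι → E) : avg C (fun i => a • v i) = a • avg C v := by
  simp [avg, ← Finset.smul_sum, smul_comm a]

lemma avg_congr {v w : ι → E} (h : ∀ i ∈ C, v i = w i) : avg C v = avg C w := by
  rw [avg, avg, Finset.sum_congr rfl h]

lemma spread_congr {v w : ι → E} (h : ∀ i ∈ C, v i = w i) : spread C v = spread C w := by
  rw [spread, spread, avg_congr h]
  congr 1
  exact Finset.sum_congr rfl fun i hi => by rw [h i hi]

lemma avg_const (hC : C.Nonempty) (c : E) : avg C (fun _ => c) = c := by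
  have : (C.card : ℝ) ≠ 0 := by exact_mod_cast hC.card_pos.ne'
  simp [avg, ← Nat.cast_smul_eq_nsmul ℝ, smul_smul, this]

lemma card_smul_avg (v : ι → E) : (C.card : ℝ) • avg C v = ∑ i ∈ C, v i := by
  rcases C.eq_empty_or_nonempty with rfl | hC
  · simp
  · have : (C.card : ℝ) ≠ 0 := by exact_mod_cast hC.card_pos.ne'
    rw [avg, smul_smul, mul_inv_cancel₀ this, one_smul]

lemma sum_sub_avg (v : ι → E) : ∑ i ∈ C, (v i - avg C v) = 0 := by
  rw [Finset.sum_sub_distrib, Finset.sum_const, ← Nat.cast_smul_eq_nsmul ℝ, card_smul_avg, sub_self]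

lemma card_mul_spread (v : ι → E) :
    (C.card : ℝ) * spread C v = ∑ i ∈ C, ‖v i - avg C v‖ ^ 2 := by
  rcases C.eq_empty_or_nonempty with rfl | hC
  · simp
  · have : (C.card : ℝ) ≠ 0 := by exact_mod_cast hC.card_pos.ne'
    rw [spread, ← mul_assoc, mul_inv_cancel₀ this, one_mul]

lemma norm_add_sq_le_two (x y : E) : ‖x + y‖ ^ 2 ≤ 2 * ‖x‖ ^ 2 + 2 * ‖y‖ ^ 2 := by
  nlinarith [parallelogram_law_with_norm ℝ x y, sq_nonneg ‖x - y‖]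

lemma norm_sub_sq_le_two (x y : E) : ‖x - y‖ ^ 2 ≤ 2 * ‖x‖ ^ 2 + 2 * ‖y‖ ^ 2 := by
  nlinarith [parallelogram_law_with_norm ℝ x y, sq_nonneg ‖x + y‖]

/-- Convexity of the squared norm. -/
lemma norm_convex_sq_le {β : ℝ} (h0 : 0 ≤ β) (h1 : β ≤ 1) (x y : E) :
    ‖β • x + (1 - β) • y‖ ^ 2 ≤ β * ‖x‖ ^ 2 + (1 - β) * ‖y‖ ^ 2 := by
  have h : ‖β • x + (1 - β) • y‖ ≤ β * ‖x‖ + (1 - β) * ‖y‖ := by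
    refine (norm_add_le _ _).trans_eq ?_
    rw [norm_smul, norm_smul, Real.norm_of_nonneg h0, Real.norm_of_nonneg (by linarith)]
  have h2 : ‖β • x + (1 - β) • y‖ ^ 2 ≤ (β * ‖x‖ + (1 - β) * ‖y‖) ^ 2 := by gcongr
  nlinarith [mul_nonneg (mul_nonneg h0 (sub_nonneg.2 h1)) (sq_nonneg (‖x‖ - ‖y‖))]

/-- The average minimizes the mean squared distance. -/
lemma spread_le (v : ι → E) (c : E) :
    spread C v ≤ (C.card : ℝ)⁻¹ * ∑ i ∈ C, ‖v i - c‖ ^ 2 := by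
  rw [spread]
  gcongr ?_ * ?_
  have h : ∀ i ∈ C, ‖v i - c‖ ^ 2 = ‖v i - avg C v‖ ^ 2
      + 2 * inner ℝ (v i - avg C v) (avg C v - c) + ‖avg C v - c‖ ^ 2 := fun i _ => by
    rw [← norm_add_sq_real]; congr 2; abel
  rw [Finset.sum_congr rfl h, Finset.sum_add_distrib, Finset.sum_add_distrib, ← Finset.mul_sum,
    ← sum_inner, sum_sub_avg, inner_zero_left]
  have : 0 ≤ ∑ _i ∈ C, ‖avg C v - c‖ ^ 2 := by positivity
  linarith

lemma norm_avg_sq_le (v : ι → E) : ‖avg C v‖ ^ 2 ≤ (C.card : ℝ)⁻¹ * ∑ i ∈ C, ‖v i‖ ^ 2 := by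
  rcases C.eq_empty_or_nonempty with rfl | hC
  · simp [avg]
  have hc : (C.card : ℝ) ≠ 0 := by exact_mod_cast hC.card_pos.ne'
  have h1 : ‖∑ i ∈ C, v i‖ ^ 2 ≤ C.card * ∑ i ∈ C, ‖v i‖ ^ 2 := by
    refine le_trans ?_ (sq_sum_le_card_mul_sum_sq)
    gcongr
    exact norm_sum_le _ _
  rw [avg, norm_smul, mul_pow, norm_inv, Real.norm_natCast]
  calc _ ≤ ((C.card : ℝ)⁻¹) ^ 2 * (C.card * ∑ i ∈ C, ‖v i‖ ^ 2) := by gcongr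
    _ = _ := by field_simp

lemma spread_convex_le {β : ℝ} (h0 : 0 ≤ β) (h1 : β ≤ 1) (v w : ι → E) :
    spread C (fun i => β • v i + (1 - β) • w i) ≤ β * spread C v + (1 - β) * spread C w := by
  have h : ∀ i ∈ C, ‖β • v i + (1 - β) • w i - avg C (fun i => β • v i + (1 - β) • w i)‖ ^ 2 ≤
      β * ‖v i - avg C v‖ ^ 2 + (1 - β) * ‖w i - avg C w‖ ^ 2 := fun i _ => by
    refine le_trans (le_of_eq ?_) (norm_convex_sq_le h0 h1 _ _)
    rw [avg_add, avg_smul, avg_smul]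
    congr 2
    simp only [smul_sub]; abel
  calc _ ≤ (C.card : ℝ)⁻¹ * ∑ i ∈ C,
        (β * ‖v i - avg C v‖ ^ 2 + (1 - β) * ‖w i - avg C w‖ ^ 2) := by
        rw [spread]; gcongr with i hi; exact h i hi
    _ = _ := by
        rw [Finset.sum_add_distrib, ← Finset.mul_sum, ← Finset.mul_sum, spread, spread]; ring

lemma spread_sub_smul_le (γ : ℝ) (v w : ι → E) :
    spread C (fun i => v i - γ • w i) ≤ 2 * spread C v + 2 * γ ^ 2 * spread C w := by
  have h : ∀ i ∈ C, ‖v i - γ • w i - avg C (fun i => v i - γ • w i)‖ ^ 2 ≤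
      2 * ‖v i - avg C v‖ ^ 2 + 2 * γ ^ 2 * ‖w i - avg C w‖ ^ 2 := fun i _ => by
    have := norm_sub_sq_le_two (v i - avg C v) (γ • (w i - avg C w))
    rw [norm_smul, mul_pow, Real.norm_eq_abs, sq_abs] at this
    refine le_trans (le_of_eq ?_) (this.trans_eq (by ring))
    rw [avg_sub, avg_smul]
    congr 2
    simp only [smul_sub]; abel
  calc _ ≤ (C.card : ℝ)⁻¹ * ∑ i ∈ C,
        (2 * ‖v i - avg C v‖ ^ 2 + 2 * γ ^ 2 * ‖w i - avg C w‖ ^ 2) := by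
        rw [spread]; gcongr with i hi; exact h i hi
    _ = _ := by
        rw [Finset.sum_add_distrib, ← Finset.mul_sum, ← Finset.mul_sum, spread, spread]; ring

/-- Effect of a perturbation on the spread. -/
lemma spread_add_le (u ξ : ι → E) :
    spread C (fun i => u i + ξ i) ≤ spread C u
      + 2 * ((C.card : ℝ)⁻¹ * ∑ i ∈ C, inner ℝ (u i - avg C u) (ξ i))
      + (C.card : ℝ)⁻¹ * ∑ i ∈ C, ‖ξ i‖ ^ 2 := by
  refine (spread_le _ (avg C u)).trans_eq ?_
  have h : ∀ i ∈ C, ‖u i + ξ i - avg C u‖ ^ 2 = ‖u i - avg C u‖ ^ 2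
      + 2 * inner ℝ (u i - avg C u) (ξ i) + ‖ξ i‖ ^ 2 := fun i _ => by
    rw [← norm_add_sq_real]; congr 2; abel
  rw [Finset.sum_congr rfl h, Finset.sum_add_distrib, Finset.sum_add_distrib, ← Finset.mul_sum,
    spread]
  ring

/-- Two distinct deviations from the average already appear in the sum that defines the spread. This
passage from spread to diameter costs the factor `C.card`, which the number of coordination rounds
has to make up for. -/
lemma norm_sub_sq_le_card_mul_spread (v : ι → E) {i j : ι} (hi : i ∈ C) (hj : j ∈ C) :
    ‖v i - v j‖ ^ 2 ≤ 2 * (C.card * spread C v) := by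
  classical
  rw [card_mul_spread]
  by_cases hij : i = j
  · subst hij
    rw [sub_self, norm_zero, zero_pow two_ne_zero]
    positivity
  have h1 : ‖v i - avg C v‖ ^ 2 + ‖v j - avg C v‖ ^ 2 ≤ ∑ k ∈ C, ‖v k - avg C v‖ ^ 2 := by
    rw [← Finset.sum_pair (f := fun k => ‖v k - avg C v‖ ^ 2) hij]
    refine Finset.sum_le_sum_of_subset_of_nonneg ?_ fun _ _ _ => by positivity
    intro k hk
    rcases Finset.mem_insert.1 hk with rfl | hk
    · exact hi
    · rwa [Finset.mem_singleton.1 hk]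
  have h2 := norm_sub_sq_le_two (v i - avg C v) (v j - avg C v)
  rw [sub_sub_sub_cancel_right] at h2
  linarith

lemma norm_sub_avg_le {v : ι → E} {c : E} {r : ℝ} (hC : C.Nonempty) (h : ∀ i ∈ C, ‖c - v i‖ ≤ r) :
    ‖c - avg C v‖ ≤ r := by
  have hc : (C.card : ℝ) ≠ 0 := by exact_mod_cast hC.card_pos.ne'
  have : c - avg C v = avg C (fun i => c - v i) := by
    rw [avg_sub (fun _ => c) v, avg_const hC]
  rw [this, avg, norm_smul, norm_inv, Real.norm_natCast, inv_mul_le_iff₀ (by positivity)]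
  calc _ ≤ ∑ i ∈ C, r := (norm_sum_le _ _).trans (Finset.sum_le_sum h)
    _ = _ := by simp

lemma spread_le_of_norm_sub_le {v : ι → E} {r : ℝ} (hC : C.Nonempty)
    (h : ∀ i ∈ C, ∀ j ∈ C, ‖v i - v j‖ ^ 2 ≤ r) : spread C v ≤ r := by
  have hc : (0 : ℝ) < C.card := by exact_mod_cast hC.card_pos
  obtain ⟨j, hj⟩ := hC
  refine (spread_le v (v j)).trans ?_
  rw [inv_mul_le_iff₀ hc]
  calc _ ≤ ∑ i ∈ C, r := Finset.sum_le_sum fun i hi => h i hi j hj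
    _ = _ := by simp

end Averages

/-! ### Contraction and drift under nearest neighbor averaging -/

section NearestNeighborAveraging

variable {n d f : ℕ} {C : Finset (Fin n)} {v : Fin n → Param d}

/-- A nearest neighbor average is an average of `n - 2f` vectors, including the one of the node
itself, at most as far away from it as the diameter of the vectors of the correct nodes. -/
lemma IsNNA.exists_selection {D : ℝ} (hn : 2 * f < n) (hcard : C.card = n - f)
    (hD : ∀ a ∈ C, ∀ b ∈ C, ‖v a - v b‖ ≤ D) {i : Fin n} (hi : i ∈ C) {R : Finset (Fin n)}
    (hiR : i ∉ R) {y : Param d} (h : IsNNA f v i R y) :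
    ∃ S : Finset (Fin n), S.card = n - 2 * f ∧ (∀ j ∈ S, ‖v i - v j‖ ≤ D) ∧
      y = ((n : ℝ) - 2 * f)⁻¹ • ∑ j ∈ S, v j := by
  classical
  obtain ⟨ψ, hψ, hmono, rfl⟩ := h
  set F := Finset.univ.filter (fun j : Fin (n - f - 1) => j.1 < n - 2 * f - 1) with hF
  have hFcard : F.card = n - 2 * f - 1 := by
    have : F = (Finset.univ : Finset (Fin (n - 2 * f - 1))).map
        (Fin.castLEEmb (show n - 2 * f - 1 ≤ n - f - 1 by omega)) := by
      ext j
      simp only [hF, Finset.mem_filter, Finset.mem_univ, true_and, Finset.mem_map]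
      exact ⟨fun hj => ⟨⟨j, hj⟩, rfl⟩, fun ⟨a, ha⟩ => by rw [← ha]; exact a.2⟩
    rw [this, Finset.card_map, Finset.card_univ, Fintype.card_fin]
  have hiF : i ∉ F.map ψ := fun h => hiR (by
    rw [← hψ]; exact Finset.map_subset_map.2 (Finset.subset_univ _) h)
  refine ⟨insert i (F.map ψ), ?_, ?_, ?_⟩
  · rw [Finset.card_insert_of_notMem hiF, Finset.card_map, hFcard]; omega
  · intro j hj
    rcases Finset.mem_insert.1 hj with rfl | hj
    · exact hD _ hi _ hi
    by_cases hjC : j ∈ C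
    · exact hD _ hi _ hjC
    obtain ⟨a, ha, rfl⟩ := Finset.mem_map.1 hj
    have ha' : a.1 < n - 2 * f - 1 := (Finset.mem_filter.1 ha).2
    -- A selected faulty vector is no farther away than any unselected one, so an unselected correct
    -- vector bounds its distance. One exists: otherwise the `f` unselected nodes and the node of
    -- `a` would be `f + 1` faulty nodes.
    obtain ⟨b, hb, hbC⟩ : ∃ b, b ∉ F ∧ ψ b ∈ C := by
      by_contra! hcon
      have hsub : (insert a Fᶜ).map ψ ⊆ Cᶜ := by
        intro k hk
        obtain ⟨b, hb, rfl⟩ := Finset.mem_map.1 hk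
        rw [Finset.mem_compl]
        rcases Finset.mem_insert.1 hb with rfl | hb
        · exact hjC
        · exact hcon b (Finset.mem_compl.1 hb)
      have := Finset.card_le_card hsub
      rw [Finset.card_map, Finset.card_insert_of_notMem (by simpa using ha), Finset.card_compl,
        Finset.card_compl, hFcard, Fintype.card_fin, Fintype.card_fin, hcard] at this
      omega
    have hab : a ≤ b := by
      have : ¬ b.1 < n - 2 * f - 1 := fun hlt => hb (Finset.mem_filter.2 ⟨Finset.mem_univ _, hlt⟩)
      exact Fin.le_def.2 (by omega)
    exact (hmono hab).trans (hD _ hi _ hbC)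
  · rw [Finset.sum_insert hiF, Finset.sum_map]

variable {D : ℝ}

/-- The common part of the two selections cancels, leaving sets `A` and `B` of equal size at most
`2f`. Averaging over all pairs in `A × B`, a pair costs `D` plus another `D` for each faulty member.
Since `A` and `B` together contain at most `f` faulty nodes, the total is at most `(2f + f) D`. -/
lemma norm_sum_sub_sum_le (hD : ∀ a ∈ C, ∀ b ∈ C, ‖v a - v b‖ ≤ D) (hD0 : 0 ≤ D)
    (hn : 2 * f < n) (hcard : C.card = n - f)
    {i j : Fin n} (hi : i ∈ C) (hj : j ∈ C) {S S' : Finset (Fin n)}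
    (hS : S.card = n - 2 * f) (hS' : S'.card = n - 2 * f)
    (hSD : ∀ a ∈ S, ‖v i - v a‖ ≤ D) (hSD' : ∀ a ∈ S', ‖v j - v a‖ ≤ D) :
    ‖∑ a ∈ S, v a - ∑ a ∈ S', v a‖ ≤ 3 * f * D := by
  classical
  have hsplit : ∑ a ∈ S, v a - ∑ a ∈ S', v a = ∑ a ∈ S \ S', v a - ∑ a ∈ S' \ S, v a := by
    rw [← Finset.sum_inter_add_sum_sdiff S S', ← Finset.sum_inter_add_sum_sdiff S' S,
      Finset.inter_comm S' S]
    abel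
  have hAB : (S \ S').card = (S' \ S).card := by
    have h1 := Finset.card_sdiff_add_card_inter S S'
    have h2 := Finset.card_sdiff_add_card_inter S' S
    rw [Finset.inter_comm] at h2
    omega
  have hA2 : (S \ S').card ≤ 2 * f := by
    have h1 := Finset.card_le_card (Finset.subset_univ (S ∪ S'))
    have h2 := Finset.card_sdiff_add_card S S'
    rw [Finset.card_univ, Fintype.card_fin] at h1
    omega
  set A := S \ S' with hA
  set B := S' \ S with hB
  have hfaulty : (A \ C).card + (B \ C).card ≤ f := by
    rw [← Finset.card_union_of_disjoint]
    · calc _ ≤ (Cᶜ).card := Finset.card_le_card fun a ha => by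
            simp only [Finset.mem_union, Finset.mem_sdiff] at ha
            rw [Finset.mem_compl]; tauto
        _ = f := by rw [Finset.card_compl, hcard, Fintype.card_fin]; omega
    · rw [Finset.disjoint_left]
      intro a ha hb
      simp only [hA, hB, Finset.mem_sdiff] at ha hb
      tauto
  rw [hsplit]
  by_cases hp : A.card = 0
  · have hB0 : B.card = 0 := hAB ▸ hp
    rw [Finset.card_eq_zero.1 hp, Finset.card_eq_zero.1 hB0]
    simp only [Finset.sum_empty, sub_self, norm_zero]
    positivity
  have hp' : (0 : ℝ) < A.card := by exact_mod_cast Nat.pos_of_ne_zero hp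
  -- Because the two sets have the same size, the difference of the sums is a multiple of the sum
  -- over all pairs; no particular bijection has to be chosen.
  have hdouble : (A.card : ℝ) • (∑ a ∈ A, v a - ∑ b ∈ B, v b) = ∑ a ∈ A, ∑ b ∈ B, (v a - v b) := by
    simp only [Finset.sum_sub_distrib, Finset.sum_const, ← Finset.smul_sum,
      ← Nat.cast_smul_eq_nsmul ℝ]
    rw [smul_sub, hAB]
  -- A faulty vector is only known to be close to the node that selected it, so the path from `v a`
  -- to `v b` makes a detour through `v i` or `v j` for each faulty end.
  have hpair : ∀ a ∈ A, ∀ b ∈ B, ‖v a - v b‖ ≤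
      D + (if a ∈ C then 0 else D) + (if b ∈ C then 0 else D) := by
    intro a ha b hb
    have ha' := hSD a (Finset.mem_sdiff.1 ha).1
    have hb' := hSD' b (Finset.mem_sdiff.1 hb).1
    have t1 := norm_sub_le_norm_sub_add_norm_sub (v a) (v i) (v b)
    have t2 := norm_sub_le_norm_sub_add_norm_sub (v i) (v j) (v b)
    have t3 := norm_sub_le_norm_sub_add_norm_sub (v a) (v j) (v b)
    rw [norm_sub_rev] at ha'
    split_ifs with h1 h2 h2
    · linarith [hD a h1 b h2]
    · linarith [hD a h1 j hj]
    · linarith [hD i hi b h2]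
    · linarith [hD i hi j hj]
  have hcount : ∀ A : Finset (Fin n), ∑ a ∈ A, (if a ∈ C then 0 else D) = (A \ C).card * D := by
    intro A
    rw [Finset.sum_ite, Finset.sum_const_zero, zero_add, Finset.sum_const, nsmul_eq_mul,
      Finset.filter_notMem_eq_sdiff]
  have hbound : (A.card : ℝ) * ‖∑ a ∈ A, v a - ∑ b ∈ B, v b‖ ≤ A.card * (3 * f * D) := by
    calc (A.card : ℝ) * ‖∑ a ∈ A, v a - ∑ b ∈ B, v b‖
        = ‖∑ a ∈ A, ∑ b ∈ B, (v a - v b)‖ := by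
          rw [← hdouble, norm_smul, Real.norm_natCast]
      _ ≤ ∑ a ∈ A, ∑ b ∈ B, ‖v a - v b‖ :=
          (norm_sum_le _ _).trans (Finset.sum_le_sum fun a _ => norm_sum_le _ _)
      _ ≤ ∑ a ∈ A, ∑ b ∈ B, (D + (if a ∈ C then 0 else D) + (if b ∈ C then 0 else D)) :=
          Finset.sum_le_sum fun a ha => Finset.sum_le_sum fun b hb => hpair a ha b hb
      _ = A.card * (A.card * D + (A \ C).card * D + (B \ C).card * D) := by
          simp only [Finset.sum_add_distrib, Finset.sum_const, hcount, nsmul_eq_mul,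
            ← Finset.mul_sum, ← hAB]
          ring
      _ = A.card * ((A.card + ((A \ C).card + (B \ C).card)) * D) := by ring
      _ ≤ A.card * ((2 * f + f) * D) := by
          gcongr
          · exact_mod_cast hA2
          · exact_mod_cast hfaulty
      _ = _ := by ring
  exact le_of_mul_le_mul_left hbound hp'

/-- Deviations from the average over `C` sum to zero over `C`, so those over `S ∩ C` can be traded
for the opposite of those over `C \ S`. What remains are at most `f` faulty vectors, each within
`2D` of the average, and at most `2f` omitted correct ones, each within `D`. -/
lemma norm_sum_sub_avg_le (hD : ∀ a ∈ C, ∀ b ∈ C, ‖v a - v b‖ ≤ D) (hD0 : 0 ≤ D)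
    (hn : 2 * f < n) (hcard : C.card = n - f)
    {i : Fin n} (hi : i ∈ C) {S : Finset (Fin n)} (hS : S.card = n - 2 * f)
    (hSD : ∀ a ∈ S, ‖v i - v a‖ ≤ D) :
    ‖∑ a ∈ S, (v a - avg C v)‖ ≤ 4 * f * D := by
  classical
  have havg : ∀ a ∈ C, ‖v a - avg C v‖ ≤ D := fun a ha => norm_sub_avg_le ⟨i, hi⟩ (hD a ha)
  have hsplit : ∑ a ∈ S, (v a - avg C v)
      = ∑ a ∈ S \ C, (v a - avg C v) - ∑ a ∈ C \ S, (v a - avg C v) := by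
    have h0 := sum_sub_avg (C := C) v
    rw [← Finset.sum_inter_add_sum_sdiff C S, Finset.inter_comm] at h0
    rw [← Finset.sum_inter_add_sum_sdiff S C, eq_neg_of_add_eq_zero_left h0]
    abel
  have h1 : (S \ C).card ≤ f := by
    calc _ ≤ (Cᶜ).card := Finset.card_le_card fun a ha => by
            simp only [Finset.mem_sdiff] at ha
            rw [Finset.mem_compl]; tauto
      _ = f := by rw [Finset.card_compl, hcard, Fintype.card_fin]; omega
  have h2 : (C \ S).card ≤ 2 * f := by
    calc _ ≤ (Sᶜ).card := Finset.card_le_card fun a ha => by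
            simp only [Finset.mem_sdiff] at ha
            rw [Finset.mem_compl]; tauto
      _ = 2 * f := by rw [Finset.card_compl, hS, Fintype.card_fin]; omega
  rw [hsplit]
  calc _ ≤ ∑ a ∈ S \ C, ‖v a - avg C v‖ + ∑ a ∈ C \ S, ‖v a - avg C v‖ :=
        (norm_sub_le _ _).trans (add_le_add (norm_sum_le _ _) (norm_sum_le _ _))
    _ ≤ ∑ a ∈ S \ C, (2 * D) + ∑ a ∈ C \ S, D := by
        refine add_le_add (Finset.sum_le_sum fun a ha => ?_)
          (Finset.sum_le_sum fun a ha => havg a (Finset.mem_sdiff.1 ha).1)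
        have t := norm_sub_le_norm_sub_add_norm_sub (v a) (v i) (avg C v)
        have t2 := hSD a (Finset.mem_sdiff.1 ha).1
        rw [norm_sub_rev] at t2
        linarith [havg i hi]
    _ = (S \ C).card * (2 * D) + (C \ S).card * D := by simp
    _ ≤ f * (2 * D) + (2 * f : ℕ) * D := by gcongr
    _ = _ := by push_cast; ring

/-- One round of nearest neighbor averaging contracts the diameter and moves the average little. -/
lemma nna_round (hn : 2 * f < n) (hcard : C.card = n - f) {w : Fin n → Param d}
    (hw : ∀ i ∈ C, ∃ R : Finset (Fin n), R.card = n - f - 1 ∧ i ∉ R ∧ IsNNA f v i R (w i))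
    (hD : ∀ a ∈ C, ∀ b ∈ C, ‖v a - v b‖ ≤ D) (hD0 : 0 ≤ D) :
    (∀ a ∈ C, ∀ b ∈ C, ‖w a - w b‖ ≤ 3 * f / ((n : ℝ) - 2 * f) * D) ∧
      ‖avg C v - avg C w‖ ≤ 4 * f / ((n : ℝ) - 2 * f) * D := by
  have hs : (0 : ℝ) < (n : ℝ) - 2 * f := by
    have : ((2 * f : ℕ) : ℝ) < n := by exact_mod_cast hn
    push_cast at this; linarith
  have hscast : ((n - 2 * f : ℕ) : ℝ) = (n : ℝ) - 2 * f := by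
    rw [Nat.cast_sub hn.le]; push_cast; ring
  have hC : C.Nonempty := by rw [← Finset.card_pos, hcard]; omega
  have key : ∀ i ∈ C, ∃ S : Finset (Fin n), S.card = n - 2 * f ∧ (∀ j ∈ S, ‖v i - v j‖ ≤ D) ∧
      w i = ((n : ℝ) - 2 * f)⁻¹ • ∑ j ∈ S, v j := fun i hi => by
    obtain ⟨R, -, hiR, h⟩ := hw i hi
    exact h.exists_selection hn hcard hD hi hiR
  constructor
  · intro a ha b hb
    obtain ⟨S, hS, hSD, hSw⟩ := key a ha
    obtain ⟨S', hS', hSD', hSw'⟩ := key b hb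
    rw [hSw, hSw', ← smul_sub, norm_smul, norm_inv, Real.norm_of_nonneg hs.le, div_mul_eq_mul_div,
      div_eq_inv_mul]
    gcongr
    exact norm_sum_sub_sum_le hD hD0 hn hcard ha hb hS hS' hSD hSD'
  · refine norm_sub_avg_le hC fun i hi => ?_
    obtain ⟨S, hS, hSD, hSw⟩ := key i hi
    have h := norm_sum_sub_avg_le hD hD0 hn hcard hi hS hSD
    rw [Finset.sum_sub_distrib, Finset.sum_const, ← Nat.cast_smul_eq_nsmul ℝ, hS, hscast] at h
    have : w i - avg C v = ((n : ℝ) - 2 * f)⁻¹ • (∑ j ∈ S, v j - ((n : ℝ) - 2 * f) • avg C v) := by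
      rw [smul_sub, smul_smul, inv_mul_cancel₀ hs.ne', one_smul, hSw]
    rw [norm_sub_rev, this, norm_smul, norm_inv, Real.norm_of_nonneg hs.le, div_mul_eq_mul_div,
      div_eq_inv_mul]
    gcongr

/-- `K` rounds of nearest neighbor averaging contract the diameter geometrically and move the
average by at most a geometric series. -/
lemma nna_rounds (hn : 2 * f < n) (hcard : C.card = n - f) {K : ℕ} {w : ℕ → Fin n → Param d}
    (hw : ∀ k < K, ∀ i ∈ C, ∃ R : Finset (Fin n),
      R.card = n - f - 1 ∧ i ∉ R ∧ IsNNA f (w k) i R (w (k + 1) i))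
    (hD : ∀ a ∈ C, ∀ b ∈ C, ‖w 0 a - w 0 b‖ ≤ D) (hD0 : 0 ≤ D) :
    ∀ k ≤ K, (∀ a ∈ C, ∀ b ∈ C, ‖w k a - w k b‖ ≤ (3 * f / ((n : ℝ) - 2 * f)) ^ k * D) ∧
      ‖avg C (w 0) - avg C (w k)‖ ≤
        4 * f / ((n : ℝ) - 2 * f) * D * ∑ l ∈ Finset.range k, (3 * f / ((n : ℝ) - 2 * f)) ^ l := by
  have hs : (0 : ℝ) < (n : ℝ) - 2 * f := by
    have : ((2 * f : ℕ) : ℝ) < n := by exact_mod_cast hn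
    push_cast at this; linarith
  intro k
  induction k with
  | zero => intro _; simpa using hD
  | succ k ih =>
    intro hk
    obtain ⟨h1, h2⟩ := ih (by omega)
    obtain ⟨h3, h4⟩ := nna_round hn hcard (hw k (by omega)) h1 (by positivity)
    constructor
    · intro a ha b hb
      refine (h3 a ha b hb).trans_eq (by ring)
    · rw [Finset.sum_range_succ, mul_add]
      refine (norm_sub_le_norm_sub_add_norm_sub _ (avg C (w k)) _).trans (add_le_add h2 ?_)
      exact h4.trans_eq (by ring)

end NearestNeighborAveraging

/-! ### The coordination phase as a whole -/

section Coordination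

/-- This explains the logarithms in `rounds`. The additional round, removed here by the `- 1`, is
reserved for producing the factor `α` in `IsCoordination.reduction`. -/
lemma geom_rounds_le {δ : ℝ} (hδ : 0 < δ) {n f : ℕ} (hf : f < n) :
    (((3 : ℝ) / (3 + δ)) ^ (rounds δ n f - 1)) ^ 2 ≤ 1 / (8 * ((n : ℝ) - f)) := by
  have hh : (0 : ℝ) < (n : ℝ) - f := by
    have : (f : ℝ) < n := by exact_mod_cast hf
    linarith
  have hlog : 0 < Real.log ((3 + δ) / 3) := Real.log_pos (by rw [lt_div_iff₀] <;> linarith)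
  have hk : Real.log (8 * ((n : ℝ) - f)) / (2 * Real.log ((3 + δ) / 3))
      ≤ ((rounds δ n f - 1 : ℕ) : ℝ) := by
    rw [rounds, Nat.add_sub_cancel]; exact Nat.le_ceil _
  set k := rounds δ n f - 1
  rw [div_le_iff₀ (by positivity)] at hk
  have hinv : (3 : ℝ) / (3 + δ) = ((3 + δ) / 3)⁻¹ := by rw [inv_div]
  rw [← pow_mul, hinv, inv_pow, one_div]
  apply inv_anti₀ (by positivity)
  rw [← Real.log_le_log_iff (by positivity) (by positivity), Real.log_pow]
  push_cast
  linarith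

variable {n d f : ℕ} {C : Finset (Fin n)} {z y : Fin n → Param d} {δ : ℝ}

lemma two_mul_lt_of_le (hδ : 0 < δ) (hn : (5 + δ) * f ≤ n) (h1 : 1 ≤ n) : 2 * f < n := by
  have : (5 * f : ℝ) ≤ n := by nlinarith [mul_nonneg hδ.le (Nat.cast_nonneg (α := ℝ) f)]
  have : 5 * f ≤ n := by exact_mod_cast this
  omega

/-- The coordination phase reduces the spread of the local models by a factor `α²` and moves their
average by at most `λ` times the spread. -/
lemma IsCoordination.reduction (hδ : 0 < δ) (hn : (5 + δ) * f ≤ n) (h1 : 1 ≤ n)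
    (hcard : C.card = n - f) (h : IsCoordination C f (rounds δ n f) z y) :
    (∀ i ∈ C, ∀ j ∈ C, ‖y i - y j‖ ^ 2 ≤ alpha n f ^ 2 * spread C z) ∧
      ‖avg C y - avg C z‖ ^ 2 ≤ lam δ n f * spread C z := by
  have hn2 := two_mul_lt_of_le hδ hn h1
  have hf0 : (0 : ℝ) ≤ f := Nat.cast_nonneg f
  have hδf : 0 ≤ δ * f := by positivity
  have hs : (0 : ℝ) < (n : ℝ) - 2 * f := by
    have : ((2 * f : ℕ) : ℝ) < n := by exact_mod_cast hn2
    push_cast at this; linarith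
  have hh : (0 : ℝ) < (n : ℝ) - f := by linarith
  have hcc : (C.card : ℝ) = (n : ℝ) - f := by rw [hcard, Nat.cast_sub (by omega)]
  have hsh : 3 / 4 * ((n : ℝ) - f) ≤ (n : ℝ) - 2 * f := by linarith
  have hV := spread_nonneg C z
  obtain ⟨v, hv0, hv, hvy⟩ := h
  have hz : spread C (v 0) = spread C z := spread_congr hv0
  set D := √(2 * (((n : ℝ) - f) * spread C z)) with hDdef
  have hDsq : D ^ 2 = 2 * (((n : ℝ) - f) * spread C z) := Real.sq_sqrt (by positivity)
  have hD0 : 0 ≤ D := Real.sqrt_nonneg _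
  have hD : ∀ a ∈ C, ∀ b ∈ C, ‖v 0 a - v 0 b‖ ≤ D := fun a ha b hb => by
    refine Real.le_sqrt_of_sq_le ?_
    rw [← hz, ← hcc]
    exact norm_sub_sq_le_card_mul_spread _ ha hb
  obtain ⟨hdiam, hdrift⟩ := nna_rounds hn2 hcard hv hD hD0 _ le_rfl
  set r : ℝ := 3 * f / ((n : ℝ) - 2 * f) with hr
  set ρ : ℝ := 3 / (3 + δ) with hρ
  have hr0 : 0 ≤ r := by positivity
  have hrρ : r ≤ ρ := by
    -- After cross-multiplication this is exactly `(5 + δ) f ≤ n`.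
    rw [hr, hρ, div_le_div_iff₀ hs (by positivity)]; linarith
  have hρ1 : ρ < 1 := by rw [hρ, div_lt_one (by positivity)]; linarith
  constructor
  · intro i hi j hj
    have h2 := hdiam i hi j hj
    rw [← hvy i hi, ← hvy j hj] at h2
    -- One round is split off and keeps its factor `r`. The others gain `1 / (8 (n - f))`, which
    -- turns `D² = 2 (n - f) * spread` into a quarter of the spread. Finally `r / 2 ≤ α`, because `n
    -- - 2f ≥ 3/4 (n - f)`.
    have hgeom : (r ^ rounds δ n f) ^ 2 ≤ r ^ 2 * (1 / (8 * ((n : ℝ) - f))) := by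
      have : r ^ rounds δ n f = r * r ^ (rounds δ n f - 1) := by
        rw [← pow_succ', rounds, Nat.add_sub_cancel]
      rw [this, mul_pow]
      gcongr
      refine le_trans ?_ (geom_rounds_le hδ (show f < n by omega))
      gcongr
    calc ‖y i - y j‖ ^ 2 ≤ (r ^ rounds δ n f * D) ^ 2 := by gcongr
      _ = (r ^ rounds δ n f) ^ 2 * (2 * (((n : ℝ) - f) * spread C z)) := by rw [mul_pow, hDsq]
      _ ≤ r ^ 2 * (1 / (8 * ((n : ℝ) - f))) * (2 * (((n : ℝ) - f) * spread C z)) := by gcongr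
      _ = (3 * f / (2 * ((n : ℝ) - 2 * f))) ^ 2 * spread C z := by rw [hr]; field_simp; ring
      _ ≤ alpha n f ^ 2 * spread C z := by
          gcongr
          rw [alpha, div_le_div_iff₀ (by positivity) hh]
          nlinarith
  · have hgs : ∑ l ∈ Finset.range (rounds δ n f), r ^ l ≤ (3 + δ) / δ := by
      have hρ' : (1 - ρ)⁻¹ = (3 + δ) / δ := by
        have : 1 - ρ = δ / (3 + δ) := by rw [hρ]; field_simp; ring
        rw [this, inv_div]
      rw [← hρ']
      calc _ ≤ ∑ l ∈ Finset.range (rounds δ n f), ρ ^ l := by gcongr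
        _ ≤ _ := ((summable_geometric_of_lt_one (by positivity) hρ1).sum_le_tsum _
            fun _ _ => by positivity).trans_eq (tsum_geometric_of_lt_one (by positivity) hρ1)
    have hy : avg C y = avg C (v (rounds δ n f)) := avg_congr hvy
    have h0 : avg C z = avg C (v 0) := (avg_congr hv0).symm
    rw [hy, h0, norm_sub_rev]
    calc _ ≤ (4 * f / ((n : ℝ) - 2 * f) * D * ((3 + δ) / δ)) ^ 2 := by
          gcongr
          exact hdrift.trans (by gcongr)
      _ = (4 * f / ((n : ℝ) - 2 * f)) ^ 2 * ((3 + δ) / δ) ^ 2 *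
            (2 * (((n : ℝ) - f) * spread C z)) := by rw [mul_pow, mul_pow, hDsq]; ring
      _ ≤ (4 * f / (3 / 4 * ((n : ℝ) - f))) ^ 2 * ((3 + δ) / δ) ^ 2 *
            (2 * (((n : ℝ) - f) * spread C z)) := by gcongr
      -- The constant is `2 * (4 * 4/3)² = 512/9`, which is below the `8² = 64` in `lam`.
      _ = ((3 + δ) / δ) ^ 2 * ((512 / 9) * f ^ 2 / ((n : ℝ) - f)) * spread C z := by
          field_simp; ring
      _ ≤ lam δ n f * spread C z := by
          rw [lam]
          gcongr
          nlinarith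

end Coordination

/-! ### Functions with Lipschitz gradient -/

section Smooth

variable {E : Type*} [NormedAddCommGroup E] [InnerProductSpace ℝ E] [CompleteSpace E]
  {g : E → ℝ} {L : ℝ}

lemma hasDerivAt_line (hg : Differentiable ℝ g) (x p : E) (s : ℝ) :
    HasDerivAt (fun s : ℝ => g (x + s • p)) (inner ℝ (gradient g (x + s • p)) p) s := by
  have h1 : HasDerivAt (fun s : ℝ => x + s • p) p s := by
    simpa using ((hasDerivAt_id s).smul_const p).const_add x
  have h2 := (hg (x + s • p)).hasFDerivAt.comp_hasDerivAt s h1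
  rwa [← inner_gradient_left] at h2

/-- The descent lemma for functions with a Lipschitz gradient. -/
lemma descent (hg : Differentiable ℝ g) (hL : ∀ x y, ‖gradient g x - gradient g y‖ ≤ L * ‖x - y‖)
    (x p : E) : g (x + p) ≤ g x + inner ℝ (gradient g x) p + L / 2 * ‖p‖ ^ 2 := by
  -- Along the segment, `g` minus its claimed quadratic upper model is antitone, since the Lipschitz
  -- bound makes its derivative nonpositive. Comparing the endpoints gives the inequality.
  set φ : ℝ → ℝ := fun s =>
    g (x + s • p) - (s * inner ℝ (gradient g x) p + s ^ 2 * (L / 2 * ‖p‖ ^ 2)) with hφ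
  have hderiv : ∀ s, HasDerivAt φ (inner ℝ (gradient g (x + s • p)) p
      - (inner ℝ (gradient g x) p + 2 * s * (L / 2 * ‖p‖ ^ 2))) s := by
    intro s
    refine (hasDerivAt_line hg x p s).sub (HasDerivAt.add ?_ ?_)
    · simpa using (hasDerivAt_id s).mul_const (inner ℝ (gradient g x) p)
    · simpa using (hasDerivAt_pow 2 s).mul_const (L / 2 * ‖p‖ ^ 2)
  have hanti : AntitoneOn φ (Set.Icc 0 1) := by
    refine antitoneOn_of_deriv_nonpos (convex_Icc 0 1)
      (fun s _ => (hderiv s).continuousAt.continuousWithinAt)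
      (fun s _ => (hderiv s).differentiableAt.differentiableWithinAt) fun s hs => ?_
    rw [interior_Icc] at hs
    rw [(hderiv s).deriv]
    have h1 : inner ℝ (gradient g (x + s • p) - gradient g x) p ≤ L * (s * ‖p‖) * ‖p‖ := by
      refine (real_inner_le_norm _ _).trans ?_
      gcongr
      refine (hL _ _).trans_eq ?_
      rw [add_sub_cancel_left, norm_smul, Real.norm_of_nonneg hs.1.le]
    rw [inner_sub_left] at h1
    nlinarith
  have h := hanti (Set.left_mem_Icc.2 zero_le_one) (Set.right_mem_Icc.2 zero_le_one) zero_le_one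
  simp only [hφ, one_smul, zero_smul, add_zero] at h
  linarith

/-- A smooth function bounded below has a small gradient where it is close to its infimum. -/
lemma norm_gradient_sq_le (hg : Differentiable ℝ g) (hL0 : 0 < L)
    (hL : ∀ x y, ‖gradient g x - gradient g y‖ ≤ L * ‖x - y‖) {m : ℝ} (hm : ∀ x, m ≤ g x) (x : E) :
    ‖gradient g x‖ ^ 2 ≤ 2 * L * (g x - m) := by
  -- A gradient step of length `1 / L` cannot lead below the lower bound `m`.
  have h := (hm _).trans (descent hg hL x (-(L⁻¹ • gradient g x)))
  rw [inner_neg_right, inner_smul_right, real_inner_self_eq_norm_sq, norm_neg, norm_smul, mul_pow,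
    norm_inv, Real.norm_of_nonneg hL0.le] at h
  have h2 : L * (L⁻¹) = 1 := mul_inv_cancel₀ hL0.ne'
  have h3 : L / 2 * (L⁻¹ ^ 2 * ‖gradient g x‖ ^ 2) = L⁻¹ * ‖gradient g x‖ ^ 2 / 2 := by
    field_simp
  rw [h3] at h
  have h4 : L⁻¹ * ‖gradient g x‖ ^ 2 ≤ 2 * (g x - m) := by linarith
  calc _ = L * (L⁻¹ * ‖gradient g x‖ ^ 2) := by rw [← mul_assoc, h2, one_mul]
    _ ≤ L * (2 * (g x - m)) := by gcongr
    _ = _ := by ring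

end Smooth

/-! ### The average loss and the diversity of the local gradients -/

section AverageLoss

variable {n d : ℕ} {X : Type*} [MeasurableSpace X] {q : Param d → X → ℝ} {D : Fin n → Measure X}
  {C : Finset (Fin n)} {L : ℝ}

lemma hasGradientAt_avgLoss (h : ∀ i ∈ C, Differentiable ℝ (localLoss q D i)) (θ : Param d) :
    HasGradientAt (avgLoss q D C) (avg C fun i => gradient (localLoss q D i) θ) θ := by
  rw [hasGradientAt_iff_hasFDerivAt, avg, map_smul, map_sum]
  have h1 : HasFDerivAt (fun θ => ∑ i ∈ C, localLoss q D i θ)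
      (∑ i ∈ C, (InnerProductSpace.toDual ℝ (Param d)) (gradient (localLoss q D i) θ)) θ :=
    HasFDerivAt.fun_sum fun i hi => (h i hi θ).hasGradientAt.hasFDerivAt
  exact h1.const_mul _

lemma gradient_avgLoss (h : IsLipschitzSmooth q D C L) (θ : Param d) :
    gradient (avgLoss q D C) θ = avg C fun i => gradient (localLoss q D i) θ :=
  (hasGradientAt_avgLoss (fun i hi => (h i hi).1) θ).gradient

lemma differentiable_avgLoss (h : IsLipschitzSmooth q D C L) : Differentiable ℝ (avgLoss q D C) :=
  fun θ => (hasGradientAt_avgLoss (fun i hi => (h i hi).1) θ).differentiableAt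

lemma lipschitz_gradient_avgLoss (hC : C.Nonempty) (h : IsLipschitzSmooth q D C L)
    (θ₁ θ₂ : Param d) :
    ‖gradient (avgLoss q D C) θ₁ - gradient (avgLoss q D C) θ₂‖ ≤ L * ‖θ₁ - θ₂‖ := by
  rw [gradient_avgLoss h, gradient_avgLoss h, ← avg_sub, avg, norm_smul, norm_inv,
    Real.norm_natCast, inv_mul_le_iff₀ (by exact_mod_cast hC.card_pos)]
  calc _ ≤ ∑ i ∈ C, L * ‖θ₁ - θ₂‖ := (norm_sum_le _ _).trans
        (Finset.sum_le_sum fun i hi => (h i hi).2 θ₁ θ₂)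
    _ = _ := by simp

/-- Diversity of the gradients of the local losses at different models. -/
lemma spread_gradient_le (h : IsLipschitzSmooth q D C L) {ζ : ℝ}
    (hζ : IsHeterogeneous q D C ζ) (θ : Fin n → Param d) :
    spread C (fun i => gradient (localLoss q D i) (θ i)) ≤
      2 * L ^ 2 * spread C θ + 2 * ζ ^ 2 := by
  refine (spread_le _ (gradient (avgLoss q D C) (avg C θ))).trans ?_
  have hi : ∀ i ∈ C, ‖gradient (localLoss q D i) (θ i) - gradient (avgLoss q D C) (avg C θ)‖ ^ 2 ≤
      2 * (L ^ 2 * ‖θ i - avg C θ‖ ^ 2) + 2 * ‖gradient (localLoss q D i) (avg C θ)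
        - gradient (avgLoss q D C) (avg C θ)‖ ^ 2 := fun i hi => by
    rw [← sub_add_sub_cancel _ (gradient (localLoss q D i) (avg C θ))]
    refine (norm_add_sq_le_two _ _).trans ?_
    gcongr
    rw [← mul_pow]
    gcongr
    exact (h i hi).2 _ _
  calc _ ≤ (C.card : ℝ)⁻¹ * ∑ i ∈ C, (2 * (L ^ 2 * ‖θ i - avg C θ‖ ^ 2)
        + 2 * ‖gradient (localLoss q D i) (avg C θ)
        - gradient (avgLoss q D C) (avg C θ)‖ ^ 2) := by gcongr with i h'; exact hi i h'
    _ = 2 * L ^ 2 * spread C θ + 2 * ((C.card : ℝ)⁻¹ * ∑ i ∈ C,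
        ‖gradient (localLoss q D i) (avg C θ) - gradient (avgLoss q D C) (avg C θ)‖ ^ 2) := by
        rw [Finset.sum_add_distrib, ← Finset.mul_sum, ← Finset.mul_sum, ← Finset.mul_sum, spread]
        ring
    _ ≤ _ := by gcongr; exact hζ _

/-- Average of the gradients of the local losses at different models. -/
lemma norm_avg_gradient_sub_sq_le (h : IsLipschitzSmooth q D C L)
    (θ : Fin n → Param d) :
    ‖avg C (fun i => gradient (localLoss q D i) (θ i)) - gradient (avgLoss q D C) (avg C θ)‖ ^ 2 ≤
      L ^ 2 * spread C θ := by
  rw [gradient_avgLoss h, ← avg_sub]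
  refine (norm_avg_sq_le _).trans ?_
  calc _ ≤ (C.card : ℝ)⁻¹ * ∑ i ∈ C, (L * ‖θ i - avg C θ‖) ^ 2 := by
        gcongr with i hi; exact (h i hi).2 _ _
    _ = _ := by simp only [mul_pow, ← Finset.mul_sum, spread]; ring

end AverageLoss

/-! ### Differentiation of expectations under second moment bounds -/

section Unbiased

open Filter Topology

variable {X : Type*} [MeasurableSpace X] {ν : Measure X}

/-- Pointwise convergence with bounded second moments implies convergence of the expectations. -/
lemma tendsto_integral_of_integral_sq_le [IsProbabilityMeasure ν] {F : ℕ → X → ℝ} {g : X → ℝ}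
    {M : ℝ} (hF : ∀ n, MemLp (F n) 2 ν) (hg : MemLp g 2 ν) (hM : ∀ n, ∫ x, F n x ^ 2 ∂ν ≤ M)
    (hlim : ∀ x, Tendsto (fun n => F n x) atTop (𝓝 (g x))) :
    Tendsto (fun n => ∫ x, F n x ∂ν) atTop (𝓝 (∫ x, g x ∂ν)) := by
  set M' : ℝ := 2 * M + 2 * ∫ x, g x ^ 2 ∂ν with hM'
  have hdiff : ∀ n, MemLp (fun x => F n x - g x) 2 ν := fun n => (hF n).sub hg
  have hdiffM : ∀ n, ∫ x, (F n x - g x) ^ 2 ∂ν ≤ M' := fun n => by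
    calc _ ≤ ∫ x, (2 * F n x ^ 2 + 2 * g x ^ 2) ∂ν := by
          refine integral_mono (hdiff n).integrable_sq
            (((hF n).integrable_sq.const_mul 2).add (hg.integrable_sq.const_mul 2)) fun x => ?_
          nlinarith [sq_nonneg (F n x + g x)]
      _ = 2 * ∫ x, F n x ^ 2 ∂ν + 2 * ∫ x, g x ^ 2 ∂ν := by
          rw [integral_add ((hF n).integrable_sq.const_mul 2) (hg.integrable_sq.const_mul 2),
            integral_const_mul, integral_const_mul]
      _ ≤ _ := by rw [hM']; linarith [hM n]
  have hM0 : 0 ≤ M' := (integral_nonneg fun _ => sq_nonneg _).trans (hdiffM 0)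
  rw [Metric.tendsto_atTop]
  intro ε hε
  -- Truncation level: the part of `|F n - g|` below `R` is handled by dominated convergence, and
  -- the excess is at most `(F n - g)² / R`, with integral at most `M' / R ≤ ε / 2`.
  set R : ℝ := 2 * (M' + 1) / ε with hR
  have hR0 : 0 < R := by positivity
  have hmeas : ∀ n, AEStronglyMeasurable (fun x => min |F n x - g x| R) ν := fun n =>
    ((hdiff n).1.norm.aemeasurable.min aemeasurable_const).aestronglyMeasurable
  have hbound : ∀ n, ∀ᵐ x ∂ν, ‖min |F n x - g x| R‖ ≤ R := fun n => ae_of_all _ fun x => by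
    rw [Real.norm_of_nonneg (le_min (abs_nonneg _) hR0.le)]
    exact min_le_right _ _
  have htrunc : Tendsto (fun n => ∫ x, min |F n x - g x| R ∂ν) atTop (𝓝 0) := by
    have := tendsto_integral_of_dominated_convergence (μ := ν) (F := fun n x => min |F n x - g x| R)
      (f := fun _ => 0) (fun _ => R) hmeas (integrable_const R) hbound
      (ae_of_all _ fun x => by
        have h1 : Tendsto (fun n => min |F n x - g x| R) atTop (𝓝 (min |g x - g x| R)) :=
          (((hlim x).sub_const (g x)).abs).min tendsto_const_nhds
        simpa [hR0.le] using h1)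
    simpa using this
  obtain ⟨N, hN⟩ := (Metric.tendsto_atTop.1 htrunc) (ε / 2) (by positivity)
  refine ⟨N, fun n hn => ?_⟩
  have h1 := hN n hn
  rw [Real.dist_eq, sub_zero] at h1
  have hint1 : Integrable (fun x => min |F n x - g x| R) ν :=
    Integrable.of_bound (hmeas n) R (hbound n)
  have hint2 : Integrable (fun x => (F n x - g x) ^ 2 / R) ν := (hdiff n).integrable_sq.div_const R
  have hint3 : Integrable (fun x => F n x - g x) ν := (hdiff n).integrable one_le_two
  rw [Real.dist_eq, ← integral_sub ((hF n).integrable one_le_two) (hg.integrable one_le_two)]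
  calc _ ≤ ∫ x, |F n x - g x| ∂ν := abs_integral_le_integral_abs
    _ ≤ ∫ x, (min |F n x - g x| R + (F n x - g x) ^ 2 / R) ∂ν := by
        refine integral_mono hint3.abs (hint1.add hint2) fun x => ?_
        rcases le_total |F n x - g x| R with h | h
        · simp only [min_eq_left h]
          have : 0 ≤ (F n x - g x) ^ 2 / R := by positivity
          linarith
        · simp only [min_eq_right h]
          have : |F n x - g x| ≤ (F n x - g x) ^ 2 / R := by
            rw [le_div_iff₀ hR0, ← sq_abs, sq]
            gcongr
          linarith
    _ = ∫ x, min |F n x - g x| R ∂ν + (∫ x, (F n x - g x) ^ 2 ∂ν) / R := by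
        rw [integral_add hint1 hint2, integral_div]
    _ ≤ |∫ x, min |F n x - g x| R ∂ν| + M' / R := by
        gcongr
        · exact le_abs_self _
        · exact hdiffM n
    _ < ε / 2 + ε / 2 := by
        refine add_lt_add_of_lt_of_le h1 ?_
        rw [hR, div_div_eq_mul_div, div_le_div_iff₀ (by positivity) (by positivity)]
        nlinarith
    _ = ε := by ring

/-- Cauchy–Schwarz applied to the fundamental theorem of calculus. With values in `ENNReal` no
integrability of `g'` is needed: if the right side is infinite there is nothing to prove, and
otherwise `g'` is square integrable. -/
lemma ofReal_sub_sq_le {g g' : ℝ → ℝ} (hg : ∀ s, HasDerivAt g (g' s) s) (hm : Measurable g')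
    {h : ℝ} (hh : 0 < h) :
    ENNReal.ofReal ((g h - g 0) ^ 2) ≤
      ENNReal.ofReal h * ∫⁻ s in Set.Ioc 0 h, ENNReal.ofReal (g' s ^ 2) := by
  by_cases htop : ∫⁻ s in Set.Ioc 0 h, ENNReal.ofReal (g' s ^ 2) = ⊤
  · rw [htop, ENNReal.mul_top (by simpa using hh)]
    exact le_top
  have hsq : Integrable (fun s => g' s ^ 2) (volume.restrict (Set.Ioc 0 h)) := by
    refine ⟨(hm.pow_const 2).aestronglyMeasurable, ?_⟩
    rw [hasFiniteIntegral_iff_ofReal (ae_of_all _ fun _ => sq_nonneg _)]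
    exact lt_top_iff_ne_top.2 htop
  have hmem : MemLp g' 2 (volume.restrict (Set.Ioc 0 h)) :=
    (memLp_two_iff_integrable_sq hm.aestronglyMeasurable).2 hsq
  have hint : Integrable g' (volume.restrict (Set.Ioc 0 h)) := hmem.integrable one_le_two
  have hftc : ∫ s in Set.Ioc 0 h, g' s = g h - g 0 := by
    rw [← intervalIntegral.integral_of_le hh.le]
    exact intervalIntegral.integral_eq_sub_of_hasDerivAt (fun s _ => hg s)
      ((intervalIntegrable_iff_integrableOn_Ioc_of_le hh.le).2 hint)
  rw [← ofReal_integral_eq_lintegral_ofReal hsq (ae_of_all _ fun _ => sq_nonneg _),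
    ← ENNReal.ofReal_mul hh.le]
  apply ENNReal.ofReal_le_ofReal
  -- `a` is the mean of `g'` on the interval, and Cauchy–Schwarz becomes nonnegativity of the
  -- integral of `(g' - a)²`.
  set a : ℝ := (g h - g 0) / h with ha
  have h0 : 0 ≤ ∫ s in Set.Ioc 0 h, (g' s ^ 2 - 2 * a * g' s + a ^ 2) :=
    integral_nonneg fun s => by
      change 0 ≤ g' s ^ 2 - 2 * a * g' s + a ^ 2
      nlinarith [sq_nonneg (g' s - a)]
  rw [integral_add (f := fun s => g' s ^ 2 - 2 * a * g' s) (g := fun _ => a ^ 2)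
      (hsq.sub (hint.const_mul (2 * a))) (integrable_const _),
    integral_sub hsq (hint.const_mul (2 * a)), integral_const_mul, hftc, integral_const] at h0
  simp only [measureReal_restrict_apply_univ, Real.volume_real_Ioc, sub_zero, smul_eq_mul,
    max_eq_left hh.le] at h0
  have hah : a * h = g h - g 0 := div_mul_cancel₀ _ hh.ne'
  rw [← hah] at h0 ⊢
  nlinarith [mul_le_mul_of_nonneg_left h0 hh.le]

/-- Differentiation of an expectation, if the derivatives have locally bounded second moments. -/
lemma integral_deriv_eq [IsProbabilityMeasure ν] {φ φ' : ℝ → X → ℝ}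
    (hφ : ∀ s x, HasDerivAt (fun s => φ s x) (φ' s x) s)
    (hm : Measurable (Function.uncurry φ')) (hφi : ∀ s, Integrable (φ s) ν) {M : ℝ}
    (hL2 : ∀ s, Integrable (fun x => φ' s x ^ 2) ν)
    (hM : ∀ s ∈ Set.Icc (0 : ℝ) 1, ∫ x, φ' s x ^ 2 ∂ν ≤ M) {a : ℝ}
    (ha : HasDerivAt (fun s => ∫ x, φ s x ∂ν) a 0) : ∫ x, φ' 0 x ∂ν = a := by
  have hM0 : 0 ≤ M := (integral_nonneg fun _ => sq_nonneg _).trans (hM 0 (by simp))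
  have hφ'm : ∀ s, Measurable (φ' s) := fun s => hm.comp measurable_prodMk_left
  set h : ℕ → ℝ := fun n => 1 / ((n : ℝ) + 1) with hh
  have hpos : ∀ n, 0 < h n := fun n => by positivity
  have hle : ∀ n, h n ≤ 1 := fun n => by
    rw [hh]; simp only; rw [div_le_one (by positivity)]; linarith [Nat.cast_nonneg (α := ℝ) n]
  have hlim : Tendsto h atTop (𝓝[≠] 0) := by
    rw [tendsto_nhdsWithin_iff]
    exact ⟨tendsto_one_div_add_atTop_nhds_zero_nat, Eventually.of_forall fun n => (hpos n).ne'⟩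
  -- The difference quotients converge pointwise to the derivative. By `ofReal_sub_sq_le` and
  -- Tonelli their second moments are at most the average over `s ∈ (0, h n]` of those of `φ' s`,
  -- hence at most `M`; so their expectations converge as well.
  set F : ℕ → X → ℝ := fun n x => (h n)⁻¹ * (φ (h n) x - φ 0 x) with hF
  have hFm : ∀ n, AEStronglyMeasurable (F n) ν := fun n =>
    (((hφi _).sub (hφi 0)).const_mul _).1
  have hlint : ∀ n, ∫⁻ x, ENNReal.ofReal (F n x ^ 2) ∂ν ≤ ENNReal.ofReal M := by
    intro n
    have hpt : ∀ x, ENNReal.ofReal (F n x ^ 2) ≤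
        ENNReal.ofReal (h n)⁻¹ * ∫⁻ s in Set.Ioc 0 (h n), ENNReal.ofReal (φ' s x ^ 2) := fun x => by
      have h1 := ofReal_sub_sq_le (fun s => hφ s x) (hm.comp measurable_prodMk_right) (hpos n)
      calc ENNReal.ofReal (F n x ^ 2)
          = ENNReal.ofReal ((h n)⁻¹ ^ 2) * ENNReal.ofReal ((φ (h n) x - φ 0 x) ^ 2) := by
            rw [← ENNReal.ofReal_mul (sq_nonneg _), ← mul_pow]
        _ ≤ ENNReal.ofReal ((h n)⁻¹ ^ 2) * (ENNReal.ofReal (h n) *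
              ∫⁻ s in Set.Ioc 0 (h n), ENNReal.ofReal (φ' s x ^ 2)) := by gcongr
        _ = _ := by
            rw [← mul_assoc, ← ENNReal.ofReal_mul (sq_nonneg _)]
            congr 2
            have := (hpos n).ne'
            field_simp
    calc _ ≤ ∫⁻ x, (ENNReal.ofReal (h n)⁻¹ *
          ∫⁻ s in Set.Ioc 0 (h n), ENNReal.ofReal (φ' s x ^ 2)) ∂ν := lintegral_mono hpt
      _ = ENNReal.ofReal (h n)⁻¹ *
          ∫⁻ s in Set.Ioc 0 (h n), ∫⁻ x, ENNReal.ofReal (φ' s x ^ 2) ∂ν := by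
          rw [lintegral_const_mul' _ _ ENNReal.ofReal_ne_top, lintegral_lintegral_swap]
          exact ((hm.comp measurable_swap).pow_const 2).ennreal_ofReal.aemeasurable
      _ ≤ ENNReal.ofReal (h n)⁻¹ * ∫⁻ _s in Set.Ioc 0 (h n), ENNReal.ofReal M := by
          refine mul_le_mul' le_rfl ?_
          refine setLIntegral_mono measurable_const fun s hs => ?_
          rw [← ofReal_integral_eq_lintegral_ofReal (hL2 s) (ae_of_all _ fun _ => sq_nonneg _)]
          exact ENNReal.ofReal_le_ofReal (hM s ⟨hs.1.le, hs.2.trans (hle n)⟩)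
      _ = ENNReal.ofReal M := by
          rw [setLIntegral_const, Real.volume_Ioc, sub_zero, mul_comm (ENNReal.ofReal M), ← mul_assoc,
            ← ENNReal.ofReal_mul (inv_nonneg.2 (hpos n).le), inv_mul_cancel₀ (hpos n).ne',
            ENNReal.ofReal_one, one_mul]
  have hFsq : ∀ n, Integrable (fun x => F n x ^ 2) ν := fun n => by
    refine ⟨(hFm n).pow 2, ?_⟩
    rw [hasFiniteIntegral_iff_ofReal (ae_of_all _ fun _ => sq_nonneg _)]
    exact (hlint n).trans_lt ENNReal.ofReal_lt_top
  have hFM : ∀ n, ∫ x, F n x ^ 2 ∂ν ≤ M := fun n => by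
    have := hlint n
    rwa [← ofReal_integral_eq_lintegral_ofReal (hFsq n) (ae_of_all _ fun _ => sq_nonneg _),
      ENNReal.ofReal_le_ofReal_iff hM0] at this
  have hconv := tendsto_integral_of_integral_sq_le
    (fun n => (memLp_two_iff_integrable_sq (hFm n)).2 (hFsq n))
    ((memLp_two_iff_integrable_sq (hφ'm 0).aestronglyMeasurable).2 (hL2 0)) hFM fun x => by
      have := ((hφ 0 x).tendsto_slope_zero).comp hlim
      simpa [hF, Function.comp_def] using this
  refine tendsto_nhds_unique hconv ?_
  have := (ha.tendsto_slope_zero).comp hlim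
  refine this.congr fun n => ?_
  simp only [Function.comp_apply, zero_add, hF, smul_eq_mul]
  rw [integral_const_mul, integral_sub (hφi _) (hφi _)]

end Unbiased

/-! ### Measurability and unbiasedness of the stochastic gradients -/

section StochasticGradient

open Filter Topology

variable {n d : ℕ} {X : Type*} [MeasurableSpace X] {q : Param d → X → ℝ} {D : Fin n → Measure X}
  {C : Finset (Fin n)} {L σ : ℝ}

/-- A directional derivative is a limit of difference quotients, and these are jointly measurable
because `q` is continuous in the parameter and measurable in the data point. -/
lemma measurable_inner_gradient (hd : ∀ x, Differentiable ℝ fun θ => q θ x)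
    (hm : ∀ θ, Measurable (q θ)) (v : Param d) :
    Measurable fun p : Param d × X => inner ℝ (gradient (fun θ => q θ p.2) p.1) v := by
  have hq : Measurable (Function.uncurry q) :=
    measurable_uncurry_of_continuous_of_measurable (fun x => (hd x).continuous) hm
  have hlim : Tendsto (fun k : ℕ => 1 / ((k : ℝ) + 1)) atTop (𝓝[≠] 0) := by
    rw [tendsto_nhdsWithin_iff]
    exact ⟨tendsto_one_div_add_atTop_nhds_zero_nat, Eventually.of_forall fun n =>
      (by positivity : (0 : ℝ) < 1 / ((n : ℝ) + 1)).ne'⟩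
  refine measurable_of_tendsto_metrizable (f := fun (k : ℕ) (p : Param d × X) =>
    (1 / ((k : ℝ) + 1))⁻¹ * (q (p.1 + (1 / ((k : ℝ) + 1)) • v) p.2 - q p.1 p.2)) (fun k => ?_) ?_
  · refine (Measurable.sub ?_ hq).const_mul _
    exact hq.comp ((measurable_fst.add_const _).prodMk measurable_snd)
  · rw [tendsto_pi_nhds]
    intro p
    have h := (hasDerivAt_line (hd p.2) p.1 v 0).tendsto_slope_zero.comp hlim
    simpa [Function.comp_def] using h

lemma measurable_inner_gradient_line (hd : ∀ x, Differentiable ℝ fun θ => q θ x)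
    (hm : ∀ θ, Measurable (q θ)) (θ v : Param d) :
    Measurable fun p : ℝ × X => inner ℝ (gradient (fun θ => q θ p.2) (θ + p.1 • v)) v := by
  have hline : Measurable fun p : ℝ × X => (θ + p.1 • v, p.2) := by fun_prop
  have h := (measurable_inner_gradient hd hm v).comp hline
  simpa only [Function.comp_def] using h

lemma measurable_gradient (hd : ∀ x, Differentiable ℝ fun θ => q θ x)
    (hm : ∀ θ, Measurable (q θ)) :
    Measurable fun p : Param d × X => gradient (fun θ => q θ p.2) p.1 := by
  have h : (fun p : Param d × X => gradient (fun θ => q θ p.2) p.1) = fun p =>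
      ∑ i, inner ℝ (gradient (fun θ => q θ p.2) p.1) (EuclideanSpace.basisFun (Fin d) ℝ i) •
        EuclideanSpace.basisFun (Fin d) ℝ i := by
    funext p
    conv_lhs => rw [← (EuclideanSpace.basisFun (Fin d) ℝ).sum_repr'
      (gradient (fun θ => q θ p.2) p.1)]
    exact Finset.sum_congr rfl fun i _ => by rw [real_inner_comm]
  rw [h]
  exact Finset.measurable_sum _ fun i _ => (measurable_inner_gradient hd hm _).smul_const _

lemma memLp_gradient_sub {i : Fin n} (hi : i ∈ C) (hwp : IsWellPosed q D C)
    (hvar : HasBoundedVariance q D C σ) (θ : Param d) :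
    MemLp (fun x => gradient (fun θ' => q θ' x) θ - gradient (localLoss q D i) θ) 2 (D i) := by
  refine (memLp_two_iff_integrable_sq_norm ?_).2 (hvar i hi θ).1
  exact (((measurable_gradient hwp.1 hwp.2.1).comp measurable_prodMk_left).sub_const
    _).aestronglyMeasurable

lemma integrable_sq_norm_gradient [∀ i, IsProbabilityMeasure (D i)] {i : Fin n} (hi : i ∈ C)
    (hwp : IsWellPosed q D C) (hvar : HasBoundedVariance q D C σ) (θ : Param d) :
    Integrable (fun x => ‖gradient (fun θ' => q θ' x) θ‖ ^ 2) (D i) ∧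
      ∫ x, ‖gradient (fun θ' => q θ' x) θ‖ ^ 2 ∂(D i) ≤
        2 * σ ^ 2 + 2 * ‖gradient (localLoss q D i) θ‖ ^ 2 := by
  obtain ⟨h1, h2⟩ := hvar i hi θ
  set G : X → Param d := fun x => gradient (fun θ' => q θ' x) θ with hG
  have hGm : Measurable G := (measurable_gradient hwp.1 hwp.2.1).comp measurable_prodMk_left
  set b := gradient (localLoss q D i) θ
  have hle : ∀ x, ‖G x‖ ^ 2 ≤ 2 * ‖G x - b‖ ^ 2 + 2 * ‖b‖ ^ 2 := fun x => by
    have h := norm_add_sq_le_two (G x - b) b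
    rwa [sub_add_cancel] at h
  have hdom : Integrable (fun x => 2 * ‖G x - b‖ ^ 2 + 2 * ‖b‖ ^ 2) (D i) :=
    (h1.const_mul 2).add (integrable_const _)
  have hint : Integrable (fun x => ‖G x‖ ^ 2) (D i) := by
    refine hdom.mono' (hGm.norm.pow_const 2).aestronglyMeasurable (ae_of_all _ fun x => ?_)
    rw [Real.norm_of_nonneg (sq_nonneg _)]
    exact hle x
  refine ⟨hint, (integral_mono hint hdom hle).trans ?_⟩
  rw [integral_add (h1.const_mul 2) (integrable_const _), integral_const_mul, integral_const,
    probReal_univ, one_smul]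
  linarith

/-- Gradient and expectation are interchanged by means of `integral_deriv_eq` on the line `θ + s •
v`. For `s ∈ [0, 1]` the second moment of the directional derivative is uniformly bounded: the
variance is at most `σ²`, and the Lipschitz condition controls the mean gradient. -/
lemma integral_inner_gradient [∀ i, IsProbabilityMeasure (D i)] {i : Fin n} (hi : i ∈ C)
    (hL0 : 0 ≤ L) (hwp : IsWellPosed q D C) (hsm : IsLipschitzSmooth q D C L)
    (hvar : HasBoundedVariance q D C σ) (θ v : Param d) :
    ∫ x, inner ℝ (gradient (fun θ' => q θ' x) θ) v ∂(D i)
      = inner ℝ (gradient (localLoss q D i) θ) v := by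
  let φ' : ℝ → X → ℝ := fun s x => inner ℝ (gradient (fun θ' => q θ' x) (θ + s • v)) v
  let N : ℝ → X → ℝ := fun s x => ‖gradient (fun θ' => q θ' x) (θ + s • v)‖ ^ 2
  have hNint : ∀ s, Integrable (N s) (D i) ∧ ∫ x, N s x ∂(D i) ≤
      2 * σ ^ 2 + 2 * ‖gradient (localLoss q D i) (θ + s • v)‖ ^ 2 := fun s =>
    integrable_sq_norm_gradient hi hwp hvar _
  have hsqle : ∀ s x, φ' s x ^ 2 ≤ ‖v‖ ^ 2 * N s x := fun s x => by
    rw [mul_comm, ← mul_pow]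
    exact sq_le_sq' (neg_le_of_abs_le (abs_real_inner_le_norm _ _)) (real_inner_le_norm _ _)
  have hmeas : Measurable (Function.uncurry φ') :=
    measurable_inner_gradient_line hwp.1 hwp.2.1 θ v
  have hL2 : ∀ s, Integrable (fun x => φ' s x ^ 2) (D i) := fun s => by
    refine ((hNint s).1.const_mul (‖v‖ ^ 2)).mono'
      ((hmeas.comp measurable_prodMk_left).pow_const 2).aestronglyMeasurable
      (ae_of_all _ fun x => ?_)
    rw [Real.norm_of_nonneg (sq_nonneg _)]
    exact hsqle s x
  have hbound : ∀ s ∈ Set.Icc (0 : ℝ) 1, ∫ x, φ' s x ^ 2 ∂(D i) ≤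
      ‖v‖ ^ 2 * (2 * σ ^ 2 + 2 * (‖gradient (localLoss q D i) θ‖ + L * ‖v‖) ^ 2) := by
    intro s hs
    refine (integral_mono (hL2 s) ((hNint s).1.const_mul _) (hsqle s)).trans ?_
    rw [integral_const_mul]
    gcongr
    refine (hNint s).2.trans ?_
    gcongr
    have h1 := norm_le_norm_add_norm_sub' (gradient (localLoss q D i) (θ + s • v))
      (gradient (localLoss q D i) θ)
    have h2 := (hsm i hi).2 (θ + s • v) θ
    rw [add_sub_cancel_left, norm_smul, Real.norm_of_nonneg hs.1] at h2
    have h3 : s * ‖v‖ ≤ 1 * ‖v‖ := by gcongr; exact hs.2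
    have h4 : L * (s * ‖v‖) ≤ L * ‖v‖ := by gcongr; linarith
    linarith
  have hderiv : HasDerivAt (fun s : ℝ => ∫ x, q (θ + s • v) x ∂(D i))
      (inner ℝ (gradient (localLoss q D i) θ) v) 0 := by
    have := hasDerivAt_line (hsm i hi).1 θ v 0
    rw [zero_smul, add_zero] at this
    exact this
  have hφ : ∀ s x, HasDerivAt (fun s : ℝ => q (θ + s • v) x) (φ' s x) s := fun s x =>
    hasDerivAt_line (hwp.1 x) θ v s
  have hφi : ∀ s : ℝ, Integrable (fun x => q (θ + s • v) x) (D i) := fun s => hwp.2.2 i hi _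
  have key := integral_deriv_eq (φ := fun s x => q (θ + s • v) x) hφ hmeas hφi hL2 hbound hderiv
  simpa only [φ', zero_smul, add_zero] using key

/-- The stochastic gradients are unbiased. -/
lemma integral_gradient_sub [∀ i, IsProbabilityMeasure (D i)] {i : Fin n} (hi : i ∈ C)
    (hL0 : 0 ≤ L) (hwp : IsWellPosed q D C) (hsm : IsLipschitzSmooth q D C L)
    (hvar : HasBoundedVariance q D C σ) (θ : Param d) :
    ∫ x, (gradient (fun θ' => q θ' x) θ - gradient (localLoss q D i) θ) ∂(D i) = 0 := by
  have hint := (memLp_gradient_sub hi hwp hvar θ).integrable one_le_two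
  have hgrad : Integrable (fun x => gradient (fun θ' => q θ' x) θ) (D i) := by
    have h := hint.add (integrable_const (gradient (localLoss q D i) θ))
    exact h.congr (ae_of_all _ fun x => by simp)
  rw [integral_sub hgrad (integrable_const _), integral_const, probReal_univ, one_smul, sub_eq_zero]
  refine ext_inner_left ℝ fun v => ?_
  rw [← integral_inner hgrad, real_inner_comm, ← integral_inner_gradient hi hL0 hwp hsm hvar]
  exact integral_congr_ae (ae_of_all _ fun x => real_inner_comm _ _)

end StochasticGradient

/-! ### Square integrability and consequences of independence -/

section SquareIntegrable

variable {Ω E : Type*} [MeasurableSpace Ω] {μ : Measure Ω} [NormedAddCommGroup E]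
  [InnerProductSpace ℝ E]

lemma integrable_inner_of_memLp {u v : Ω → E} (hu : MemLp u 2 μ) (hv : MemLp v 2 μ) :
    Integrable (fun ω => inner ℝ (u ω) (v ω)) μ := by
  refine ((hu.integrable_norm_pow two_ne_zero).add (hv.integrable_norm_pow two_ne_zero)).mono'
    (hu.1.inner hv.1) (ae_of_all _ fun ω => ?_)
  simp only [Pi.add_apply]
  nlinarith [norm_inner_le_norm (𝕜 := ℝ) (u ω) (v ω), sq_nonneg (‖u ω‖ - ‖v ω‖),
    sq_nonneg (‖u ω‖ + ‖v ω‖)]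

end SquareIntegrable

section Independence

variable {Ω X Z E : Type*} [MeasurableSpace Ω] [MeasurableSpace X] [MeasurableSpace Z]
  [NormedAddCommGroup E] [InnerProductSpace ℝ E] [CompleteSpace E] [MeasurableSpace E]
  [BorelSpace E] [SecondCountableTopology E] {μ : Measure Ω} [IsProbabilityMeasure μ]

/-- The hypotheses say that the joint law of `a`, `b`, `y` is a product of three laws; regrouping
the factors gives the claim. It serves to separate the sample of one node from the past together
with the sample of another node. -/
lemma indepFun_prodMk_of_indepFun {A B Y : Type*} [MeasurableSpace A] [MeasurableSpace B]
    [MeasurableSpace Y] {a : Ω → A} {b : Ω → B} {y : Ω → Y} (ha : Measurable a) (hb : Measurable b)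
    (hy : Measurable y) (hab : IndepFun a b μ) (h : IndepFun (fun ω => (a ω, b ω)) y μ) :
    IndepFun (fun ω => (y ω, b ω)) a μ := by
  have := Measure.isProbabilityMeasure_map (μ := μ) ha.aemeasurable
  have := Measure.isProbabilityMeasure_map (μ := μ) hb.aemeasurable
  have := Measure.isProbabilityMeasure_map (μ := μ) hy.aemeasurable
  have hyb : IndepFun y b μ := (h.comp measurable_snd measurable_id).symm
  rw [indepFun_iff_map_prod_eq_prod_map_map (hy.prodMk hb).aemeasurable ha.aemeasurable,
    hyb.map_prod_eq_prod_map_map hy.aemeasurable hb.aemeasurable]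
  have h1 : μ.map (fun ω => ((a ω, b ω), y ω)) = ((μ.map a).prod (μ.map b)).prod (μ.map y) := by
    rw [h.map_prod_eq_prod_map_map (ha.prodMk hb).aemeasurable hy.aemeasurable,
      hab.map_prod_eq_prod_map_map ha.aemeasurable hb.aemeasurable]
  have e1 := measurePreserving_prodAssoc (μ.map a) (μ.map b) (μ.map y)
  have e2 := Measure.measurePreserving_swap (μ := μ.map a) (ν := (μ.map b).prod (μ.map y))
  have e3 := (Measure.measurePreserving_swap (μ := μ.map b) (ν := μ.map y)).prod
    (MeasurePreserving.id (μ.map a))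
  rw [← (e3.comp (e2.comp e1)).map_eq, ← h1, Measure.map_map]
  · rfl
  · exact (e3.comp (e2.comp e1)).measurable
  · exact (ha.prodMk hb).prodMk hy

variable {z : Ω → Z} {s : Ω → X} {ν : Measure X} [IsProbabilityMeasure ν] {G : Z → X → E}

/-- By Fubini, `z` can be frozen, and the bound that holds for every fixed value of `z` is
integrated. The case of interest has the model as `z` and the new data point as `s`. -/
lemma memLp_of_indepFun (hz : Measurable z) (hs : Measurable s) (hν : μ.map s = ν)
    (hind : IndepFun z s μ) (hG : Measurable (Function.uncurry G)) {σ : ℝ}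
    (hσ : ∀ w, Integrable (fun x => ‖G w x‖ ^ 2) ν ∧ ∫ x, ‖G w x‖ ^ 2 ∂ν ≤ σ ^ 2) :
    MemLp (fun ω => G (z ω) (s ω)) 2 μ ∧ ∫ ω, ‖G (z ω) (s ω)‖ ^ 2 ∂μ ≤ σ ^ 2 := by
  have hm : Measurable fun ω => G (z ω) (s ω) := hG.comp (hz.prodMk hs)
  have hmap := hind.map_prod_eq_prod_map_map hz.aemeasurable hs.aemeasurable
  have := Measure.isProbabilityMeasure_map (μ := μ) hz.aemeasurable
  rw [hν] at hmap
  have hGm : Measurable fun p : Z × X => ENNReal.ofReal (‖G p.1 p.2‖ ^ 2) :=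
    (hG.norm.pow_const 2).ennreal_ofReal
  have hlint : ∫⁻ ω, ENNReal.ofReal (‖G (z ω) (s ω)‖ ^ 2) ∂μ ≤ ENNReal.ofReal (σ ^ 2) := by
    calc _ = ∫⁻ p, ENNReal.ofReal (‖G p.1 p.2‖ ^ 2) ∂(μ.map fun ω => (z ω, s ω)) :=
          (lintegral_map hGm (hz.prodMk hs)).symm
      _ = ∫⁻ w, ∫⁻ x, ENNReal.ofReal (‖G w x‖ ^ 2) ∂ν ∂(μ.map z) := by
          rw [hmap, lintegral_prod _ hGm.aemeasurable]
      _ ≤ ∫⁻ _w, ENNReal.ofReal (σ ^ 2) ∂(μ.map z) := by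
          refine lintegral_mono fun w => ?_
          rw [← ofReal_integral_eq_lintegral_ofReal (hσ w).1 (ae_of_all _ fun _ => sq_nonneg _)]
          exact ENNReal.ofReal_le_ofReal (hσ w).2
      _ = _ := by simp
  have hint : Integrable (fun ω => ‖G (z ω) (s ω)‖ ^ 2) μ := by
    refine ⟨(hm.norm.pow_const 2).aestronglyMeasurable, ?_⟩
    rw [hasFiniteIntegral_iff_ofReal (ae_of_all _ fun _ => sq_nonneg _)]
    exact hlint.trans_lt ENNReal.ofReal_lt_top
  refine ⟨(memLp_two_iff_integrable_sq_norm hm.aestronglyMeasurable).2 hint, ?_⟩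
  rwa [← ofReal_integral_eq_lintegral_ofReal hint (ae_of_all _ fun _ => sq_nonneg _),
    ENNReal.ofReal_le_ofReal_iff (sq_nonneg _)] at hlint

/-- With `z` frozen, `u z` is a constant vector and `G z` has mean zero. This replaces conditional
expectations throughout. -/
lemma integral_inner_eq_zero_of_indepFun (hz : Measurable z) (hs : Measurable s)
    (hν : μ.map s = ν) (hind : IndepFun z s μ) (hG : Measurable (Function.uncurry G))
    (hGi : ∀ w, Integrable (G w) ν) (hG0 : ∀ w, ∫ x, G w x ∂ν = 0) {u : Z → E} (hu : Measurable u)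
    (hint : Integrable (fun ω => inner ℝ (u (z ω)) (G (z ω) (s ω))) μ) :
    ∫ ω, inner ℝ (u (z ω)) (G (z ω) (s ω)) ∂μ = 0 := by
  have hmap := hind.map_prod_eq_prod_map_map hz.aemeasurable hs.aemeasurable
  have := Measure.isProbabilityMeasure_map (μ := μ) hz.aemeasurable
  rw [hν] at hmap
  set F : Z × X → ℝ := fun p => inner ℝ (u p.1) (G p.1 p.2) with hF
  have hFm : Measurable F := (hu.comp measurable_fst).inner hG
  have hzs := hz.prodMk hs
  have hFint : Integrable F ((μ.map z).prod ν) := by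
    rw [← hmap, integrable_map_measure hFm.aestronglyMeasurable hzs.aemeasurable]
    exact hint
  calc _ = ∫ p, F p ∂(μ.map fun ω => (z ω, s ω)) :=
        (integral_map hzs.aemeasurable hFm.aestronglyMeasurable).symm
    _ = ∫ w, ∫ x, F (w, x) ∂ν ∂(μ.map z) := by rw [hmap, integral_prod _ hFint]
    _ = ∫ _w, 0 ∂(μ.map z) := by
        refine integral_congr_ae (ae_of_all _ fun w => ?_)
        simp only [hF]
        rw [integral_inner (hGi w), hG0, inner_zero_right]
    _ = 0 := integral_zero _ _

end Independence

/-! ### The noise of an execution: variance and orthogonality -/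

namespace Execution

variable {n d : ℕ} {Ω X : Type*} [mΩ : MeasurableSpace Ω] [MeasurableSpace X] {μ : Measure Ω}
  [IsProbabilityMeasure μ] {q : Param d → X → ℝ} {D : Fin n → Measure X}
  [∀ i, IsProbabilityMeasure (D i)] {C : Finset (Fin n)} {f : ℕ} {θ₀ : Param d} {γ β L σ ζ : ℝ}
  {K T : ℕ} (e : Execution μ q D C f θ₀ γ β K T)

/-- Noise of the stochastic gradient computed by node `i` in iteration `t`. -/
noncomputable def noise (t : ℕ) (i : Fin n) (ω : Ω) : Param d :=
  gradient (fun θ => q θ (e.sample t i ω)) (e.model t i ω)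
    - gradient (localLoss q D i) (e.model t i ω)

include e

lemma measurable_sample {t : ℕ} (ht : t < T) {i : Fin n} (hi : i ∈ C) : Measurable (e.sample t i) :=
  (e.sample_measurable t ht i hi).mono (e.hist.le _) le_rfl

lemma indepFun_samples {t : ℕ} (ht : t < T) {Y : Type*} [MeasurableSpace Y] {y : Ω → Y}
    (hy : Measurable[e.hist t] y) : IndepFun (fun ω (i : C) => e.sample t i ω) y μ := by
  rw [IndepFun_iff_Indep]
  exact indep_of_indep_of_le_right (e.sample_fresh t ht) hy.comap_le

lemma indepFun_sample {t : ℕ} (ht : t < T) {i : Fin n} (hi : i ∈ C) {Y : Type*}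
    [MeasurableSpace Y] {y : Ω → Y} (hy : Measurable[e.hist t] y) :
    IndepFun y (e.sample t i) μ :=
  ((e.indepFun_samples ht hy).comp (measurable_pi_apply (⟨i, hi⟩ : C)) measurable_id).symm

lemma indepFun_sample_pair {t : ℕ} (ht : t < T) {i j : Fin n} (hi : i ∈ C) (hj : j ∈ C)
    (hij : i ≠ j) {Y : Type*} [MeasurableSpace Y] {y : Ω → Y} (hy : Measurable[e.hist t] y) :
    IndepFun (fun ω => (y ω, e.sample t j ω)) (e.sample t i) μ := by
  refine indepFun_prodMk_of_indepFun (e.measurable_sample ht hi) (e.measurable_sample ht hj)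
    (hy.mono (e.hist.le _) le_rfl) ?_ ?_
  · exact (e.sample_indep t ht).indepFun (i := ⟨i, hi⟩) (j := ⟨j, hj⟩) (by simpa using hij)
  · exact (e.indepFun_samples ht hy).comp
      ((measurable_pi_apply (⟨i, hi⟩ : C)).prodMk (measurable_pi_apply (⟨j, hj⟩ : C)))
      measurable_id

end Execution

section Noise

variable {n d : ℕ} {X : Type*} [MeasurableSpace X] {q : Param d → X → ℝ} {D : Fin n → Measure X}
  {C : Finset (Fin n)} {L : ℝ}

lemma continuous_gradient_localLoss (hsm : IsLipschitzSmooth q D C L) (hL0 : 0 ≤ L) {i : Fin n}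
    (hi : i ∈ C) : Continuous (gradient (localLoss q D i)) := by
  refine (LipschitzWith.of_dist_le_mul (K := ⟨L, hL0⟩) fun x y => ?_).continuous
  rw [dist_eq_norm, dist_eq_norm]
  exact (hsm i hi).2 x y

lemma measurable_noise (hwp : IsWellPosed q D C) (hsm : IsLipschitzSmooth q D C L) (hL0 : 0 ≤ L)
    {i : Fin n} (hi : i ∈ C) : Measurable fun p : Param d × X =>
      gradient (fun θ => q θ p.2) p.1 - gradient (localLoss q D i) p.1 := by
  have h := (continuous_gradient_localLoss hsm hL0 hi).measurable.comp
    (measurable_fst : Measurable (Prod.fst : Param d × X → Param d))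
  exact (measurable_gradient hwp.1 hwp.2.1).sub h

end Noise

namespace Execution

variable {n d : ℕ} {Ω X : Type*} [mΩ : MeasurableSpace Ω] [MeasurableSpace X] {μ : Measure Ω}
  [IsProbabilityMeasure μ] {q : Param d → X → ℝ} {D : Fin n → Measure X}
  [∀ i, IsProbabilityMeasure (D i)] {C : Finset (Fin n)} {f : ℕ} {θ₀ : Param d} {γ β L σ ζ : ℝ}
  {K T : ℕ} (e : Execution μ q D C f θ₀ γ β K T)
  (hL0 : 0 ≤ L) (hwp : IsWellPosed q D C) (hsm : IsLipschitzSmooth q D C L)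
  (hvar : HasBoundedVariance q D C σ)

include hL0 hwp hsm

lemma measurable_hist_noise {t : ℕ} (ht : t < T) {i : Fin n} (hi : i ∈ C) :
    Measurable[e.hist (t + 1)] (e.noise t i) := by
  have h1 := (e.model_measurable t ht.le i hi).mono (e.hist.mono (Nat.le_succ t)) le_rfl
  have h := (measurable_noise hwp hsm hL0 hi).comp (h1.prodMk (e.sample_measurable t ht i hi))
  simp only [Function.comp_def] at h
  exact h

include hvar

lemma memLp_noise {t : ℕ} (ht : t < T) {i : Fin n} (hi : i ∈ C) :
    MemLp (e.noise t i) 2 μ ∧ ∫ ω, ‖e.noise t i ω‖ ^ 2 ∂μ ≤ σ ^ 2 :=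
  memLp_of_indepFun (G := fun θ x => gradient (fun θ => q θ x) θ - gradient (localLoss q D i) θ)
    ((e.model_measurable t ht.le i hi).mono (e.hist.le _) le_rfl) (e.measurable_sample ht hi)
    (e.sample_law t ht i hi) (e.indepFun_sample ht hi (e.model_measurable t ht.le i hi))
    (measurable_noise hwp hsm hL0 hi) (hvar i hi)

/-- The noise is orthogonal to the past. -/
lemma integral_inner_noise {t : ℕ} (ht : t < T) {i : Fin n} (hi : i ∈ C) {u : Ω → Param d}
    (hu : Measurable[e.hist t] u) (hu2 : MemLp u 2 μ) :
    ∫ ω, inner ℝ (u ω) (e.noise t i ω) ∂μ = 0 := by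
  have hm := hu.prodMk (e.model_measurable t ht.le i hi)
  refine integral_inner_eq_zero_of_indepFun (Z := Param d × Param d)
    (z := fun ω => (u ω, e.model t i ω)) (s := e.sample t i) (u := Prod.fst)
    (G := fun w x => gradient (fun θ => q θ x) w.2 - gradient (localLoss q D i) w.2)
    (hm.mono (e.hist.le _) le_rfl) (e.measurable_sample ht hi)
    (e.sample_law t ht i hi) (e.indepFun_sample ht hi hm) ?_
    (fun w => (memLp_gradient_sub hi hwp hvar w.2).integrable one_le_two)
    (fun w => integral_gradient_sub hi hL0 hwp hsm hvar w.2) measurable_fst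
    (integrable_inner_of_memLp hu2 (e.memLp_noise hL0 hwp hsm hvar ht hi).1)
  have h1 : Measurable fun p : (Param d × Param d) × X => (p.1.2, p.2) :=
    (measurable_snd.comp measurable_fst).prodMk measurable_snd
  have h := (measurable_noise hwp hsm hL0 hi).comp h1
  simpa only [Function.comp_def, Function.uncurry_def] using h

/-- The noises of different nodes are orthogonal. -/
lemma integral_inner_noise_noise {t : ℕ} (ht : t < T) {i j : Fin n} (hi : i ∈ C) (hj : j ∈ C)
    (hij : i ≠ j) : ∫ ω, inner ℝ (e.noise t j ω) (e.noise t i ω) ∂μ = 0 := by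
  have hm := (e.model_measurable t ht.le i hi).prodMk (e.model_measurable t ht.le j hj)
  -- Everything except the sample of node `i` is frozen: both models and the sample of node `j`,
  -- which together determine the noise of node `j`.
  refine integral_inner_eq_zero_of_indepFun (Z := (Param d × Param d) × X)
    (z := fun ω => ((e.model t i ω, e.model t j ω), e.sample t j ω)) (s := e.sample t i)
    (u := fun w => gradient (fun θ => q θ w.2) w.1.2 - gradient (localLoss q D j) w.1.2)
    (G := fun w x => gradient (fun θ => q θ x) w.1.1 - gradient (localLoss q D i) w.1.1)
    ((hm.mono (e.hist.le _) le_rfl).prodMk (e.measurable_sample ht hj)) (e.measurable_sample ht hi)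
    (e.sample_law t ht i hi) (e.indepFun_sample_pair ht hi hj hij hm) ?_
    (fun w => (memLp_gradient_sub hi hwp hvar w.1.1).integrable one_le_two)
    (fun w => integral_gradient_sub hi hL0 hwp hsm hvar w.1.1) ?_
    (integrable_inner_of_memLp (e.memLp_noise hL0 hwp hsm hvar ht hj).1
      (e.memLp_noise hL0 hwp hsm hvar ht hi).1)
  · have h1 : Measurable fun p : ((Param d × Param d) × X) × X => (p.1.1.1, p.2) :=
      (measurable_fst.comp (measurable_fst.comp measurable_fst)).prodMk measurable_snd
    have h := (measurable_noise hwp hsm hL0 hi).comp h1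
    simpa only [Function.comp_def, Function.uncurry_def] using h
  · have h1 : Measurable fun p : (Param d × Param d) × X => (p.1.2, p.2) :=
      (measurable_snd.comp measurable_fst).prodMk measurable_snd
    have h := (measurable_noise hwp hsm hL0 hj).comp h1
    simpa only [Function.comp_def, Function.uncurry_def] using h

/-- Averaging over the nodes reduces the variance of the noise. -/
lemma integral_norm_avg_noise_sq_le {t : ℕ} (ht : t < T) :
    ∫ ω, ‖avg C (fun i => e.noise t i ω)‖ ^ 2 ∂μ ≤ σ ^ 2 / C.card := by
  classical
  have hmem : ∀ i ∈ C, MemLp (e.noise t i) 2 μ := fun i hi =>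
    (e.memLp_noise hL0 hwp hsm hvar ht hi).1
  have hint : ∀ i ∈ C, ∀ j ∈ C, Integrable (fun ω => inner ℝ (e.noise t i ω) (e.noise t j ω)) μ :=
    fun i hi j hj => integrable_inner_of_memLp (hmem i hi) (hmem j hj)
  have hexp : ∀ ω, ‖avg C (fun i => e.noise t i ω)‖ ^ 2 = ((C.card : ℝ)⁻¹) ^ 2 *
      ∑ i ∈ C, ∑ j ∈ C, inner ℝ (e.noise t i ω) (e.noise t j ω) := fun ω => by
    rw [avg, norm_smul, mul_pow, norm_inv, Real.norm_natCast, ← real_inner_self_eq_norm_sq,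
      sum_inner]
    simp only [inner_sum]
  simp_rw [hexp]
  rw [integral_const_mul, integral_finsetSum _ fun i hi => integrable_finsetSum _ (hint i hi)]
  have hrow : ∀ i ∈ C, ∫ ω, ∑ j ∈ C, inner ℝ (e.noise t i ω) (e.noise t j ω) ∂μ ≤ σ ^ 2 := by
    intro i hi
    rw [integral_finsetSum _ (hint i hi), Finset.sum_eq_single_of_mem i hi]
    · simp only [real_inner_self_eq_norm_sq]
      exact (e.memLp_noise hL0 hwp hsm hvar ht hi).2
    · exact fun j hj hji => e.integral_inner_noise_noise hL0 hwp hsm hvar ht hj hi hji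
  rcases C.eq_empty_or_nonempty with rfl | hC
  · simp
  have hc : (C.card : ℝ) ≠ 0 := by exact_mod_cast hC.card_pos.ne'
  calc _ ≤ ((C.card : ℝ)⁻¹) ^ 2 * ∑ i ∈ C, σ ^ 2 := by gcongr with i hi; exact hrow i hi
    _ = _ := by rw [Finset.sum_const, nsmul_eq_mul]; field_simp

end Execution

/-! ### Integrability of averages, spreads and Lipschitz images -/

section SquareIntegrable

variable {ι Ω E : Type*} {mΩ : MeasurableSpace Ω} {μ : Measure Ω} [NormedAddCommGroup E]
  [InnerProductSpace ℝ E] {C : Finset ι} {v : ι → Ω → E}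

lemma memLp_avg (h : ∀ i ∈ C, MemLp (v i) 2 μ) : MemLp (fun ω => avg C fun i => v i ω) 2 μ :=
  (memLp_finsetSum C h).const_smul _

lemma measurable_avg [MeasurableSpace E] [BorelSpace E] [SecondCountableTopology E]
    (h : ∀ i ∈ C, Measurable (v i)) : Measurable fun ω => avg C fun i => v i ω :=
  (Finset.measurable_fun_sum C h).const_smul _

lemma integrable_norm_sq {u : Ω → E} (h : MemLp u 2 μ) : Integrable (fun ω => ‖u ω‖ ^ 2) μ :=
  h.integrable_norm_pow two_ne_zero

lemma integrable_spread (h : ∀ i ∈ C, MemLp (v i) 2 μ) :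
    Integrable (fun ω => spread C fun i => v i ω) μ :=
  (integrable_finsetSum C fun i hi => integrable_norm_sq ((h i hi).sub (memLp_avg h))).const_mul _

lemma memLp_of_lipschitz [IsFiniteMeasure μ] {g : E → E} {L : ℝ} (hg : Continuous g)
    (hL : ∀ x y, ‖g x - g y‖ ≤ L * ‖x - y‖) {u : Ω → E} (hu : MemLp u 2 μ) :
    MemLp (fun ω => g (u ω)) 2 μ := by
  have h1 : MemLp (fun ω => g (u ω) - g 0) 2 μ := by
    refine hu.of_le_mul (c := L) ((hg.comp_aestronglyMeasurable hu.1).sub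
      aestronglyMeasurable_const) (ae_of_all _ fun ω => ?_)
    simpa using hL (u ω) 0
  have h2 := h1.add (memLp_const (g 0))
  exact (memLp_congr_ae (ae_of_all _ fun x => by simp)).1 h2

end SquareIntegrable

lemma continuous_gradient_avgLoss {n d : ℕ} {X : Type*} [MeasurableSpace X] {q : Param d → X → ℝ}
    {D : Fin n → Measure X} {C : Finset (Fin n)} {L : ℝ} (hsm : IsLipschitzSmooth q D C L)
    (hL0 : 0 ≤ L) (hC : C.Nonempty) : Continuous (gradient (avgLoss q D C)) := by
  refine (LipschitzWith.of_dist_le_mul (K := ⟨L, hL0⟩) fun x y => ?_).continuous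
  rw [dist_eq_norm, dist_eq_norm]
  exact lipschitz_gradient_avgLoss hC hsm x y

/-! ### The state of an execution: moments and one-step effect of the noise -/

namespace Execution

variable {n d : ℕ} {Ω X : Type*} [mΩ : MeasurableSpace Ω] [MeasurableSpace X] {μ : Measure Ω}
  {q : Param d → X → ℝ} {D : Fin n → Measure X}
  {C : Finset (Fin n)} {f : ℕ} {θ₀ : Param d} {γ β δ L σ ζ : ℝ} {K T : ℕ}

/-- Momentum before iteration `t`. -/
noncomputable def prevMomentum (e : Execution μ q D C f θ₀ γ β K T) (t : ℕ) (i : Fin n) (ω : Ω) :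
    Param d := if t = 0 then 0 else e.momentum (t - 1) i ω

/-- Momentum in iteration `t` without the noise of this iteration. -/
noncomputable def meanMomentum (e : Execution μ q D C f θ₀ γ β K T) (t : ℕ) (i : Fin n) (ω : Ω) :
    Param d := β • e.prevMomentum t i ω + (1 - β) • gradient (localLoss q D i) (e.model t i ω)

/-- Average of the local models. -/
noncomputable def avgModel (e : Execution μ q D C f θ₀ γ β K T) (t : ℕ) (ω : Ω) : Param d :=
  avg C fun i => e.model t i ω

/-- Spread of the partially updated models, from which the coordination phase starts. -/
noncomputable def partialSpread (e : Execution μ q D C f θ₀ γ β K T) (t : ℕ) (ω : Ω) : ℝ :=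
  spread C fun i => e.model t i ω - γ • e.momentum t i ω

/-- Gradient of the average loss at the average model. -/
noncomputable def avgGrad (e : Execution μ q D C f θ₀ γ β K T) (t : ℕ) (ω : Ω) : Param d :=
  gradient (avgLoss q D C) (e.avgModel t ω)

/-- Deviation of the average momentum from the gradient of the average loss. -/
noncomputable def deviation (e : Execution μ q D C f θ₀ γ β K T) (t : ℕ) (ω : Ω) : Param d :=
  avg C (fun i => e.momentum t i ω) - e.avgGrad t ω

/-- The first summand is determined by the history before iteration `t`, the second is fresh noise;
all cross terms below vanish because of this splitting. -/
lemma momentum_eq_add_noise (e : Execution μ q D C f θ₀ γ β K T) {t : ℕ} (ht : t < T) {i : Fin n}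
    (hi : i ∈ C) (ω : Ω) :
    e.momentum t i ω = e.meanMomentum t i ω + (1 - β) • e.noise t i ω := by
  rw [e.momentum_eq t ht i hi, meanMomentum, prevMomentum, noise, smul_sub]
  abel

section Reduction

variable (e : Execution μ q D C f θ₀ γ β (rounds δ n f) T)

lemma norm_model_sub_sq_le (hδ : 0 < δ) (hn : (5 + δ) * f ≤ n) (h1 : 1 ≤ n)
    (hcard : C.card = n - f) {t : ℕ} (ht : t < T) (ω : Ω) {i j : Fin n} (hi : i ∈ C) (hj : j ∈ C) :
    ‖e.model (t + 1) i ω - e.model (t + 1) j ω‖ ^ 2 ≤ alpha n f ^ 2 * e.partialSpread t ω :=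
  ((e.coordination t ht ω).reduction hδ hn h1 hcard).1 i hi j hj

lemma norm_avgModel_sub_sq_le (hδ : 0 < δ) (hn : (5 + δ) * f ≤ n) (h1 : 1 ≤ n)
    (hcard : C.card = n - f) {t : ℕ} (ht : t < T) (ω : Ω) :
    ‖e.avgModel (t + 1) ω - avg C (fun i => e.model t i ω - γ • e.momentum t i ω)‖ ^ 2 ≤
      lam δ n f * e.partialSpread t ω :=
  ((e.coordination t ht ω).reduction hδ hn h1 hcard).2

lemma norm_model_sub_avgModel_sq_le (hδ : 0 < δ) (hn : (5 + δ) * f ≤ n) (h1 : 1 ≤ n)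
    (hcard : C.card = n - f) {t : ℕ} (ht : t < T) (ω : Ω) {i : Fin n} (hi : i ∈ C) :
    ‖e.model (t + 1) i ω - e.avgModel (t + 1) ω‖ ^ 2 ≤ alpha n f ^ 2 * e.partialSpread t ω := by
  have hS : 0 ≤ alpha n f ^ 2 * e.partialSpread t ω := mul_nonneg (sq_nonneg _) (spread_nonneg _ _)
  rw [← Real.sq_sqrt hS]
  have h : ‖e.model (t + 1) i ω - e.avgModel (t + 1) ω‖ ≤ √(alpha n f ^ 2 * e.partialSpread t ω) :=
    norm_sub_avg_le ⟨i, hi⟩ fun j hj =>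
      Real.le_sqrt_of_sq_le (e.norm_model_sub_sq_le hδ hn h1 hcard ht ω hi hj)
  gcongr

lemma spread_model_succ_le (hδ : 0 < δ) (hn : (5 + δ) * f ≤ n) (h1 : 1 ≤ n)
    (hcard : C.card = n - f) (hC : C.Nonempty) {t : ℕ} (ht : t < T) (ω : Ω) :
    spread C (fun i => e.model (t + 1) i ω) ≤ alpha n f ^ 2 * e.partialSpread t ω :=
  spread_le_of_norm_sub_le hC fun _ hi _ hj => e.norm_model_sub_sq_le hδ hn h1 hcard ht ω hi hj

end Reduction

lemma spread_model_zero (e : Execution μ q D C f θ₀ γ β K T) (hC : C.Nonempty) (ω : Ω) :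
    spread C (fun i => e.model 0 i ω) = 0 := by
  rw [spread_congr (w := fun _ => θ₀) fun i hi => e.model_zero i hi ω, spread, avg_const hC]
  simp

lemma avgModel_zero (e : Execution μ q D C f θ₀ γ β K T) (hC : C.Nonempty) (ω : Ω) :
    e.avgModel 0 ω = θ₀ := by
  rw [avgModel, avg_congr (w := fun _ => θ₀) fun i hi => e.model_zero i hi ω, avg_const hC]

section Moments

variable [IsProbabilityMeasure μ] [∀ i, IsProbabilityMeasure (D i)]
  (e : Execution μ q D C f θ₀ γ β (rounds δ n f) T)
  (hδ : 0 < δ) (hn : (5 + δ) * f ≤ n) (h1 : 1 ≤ n) (hcard : C.card = n - f)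
  (hL0 : 0 ≤ L) (hwp : IsWellPosed q D C) (hsm : IsLipschitzSmooth q D C L)
  (hvar : HasBoundedVariance q D C σ)

include e hL0 hwp hsm hvar

lemma memLp_meanMomentum {t : ℕ} {i : Fin n} (hi : i ∈ C) (h : MemLp (e.model t i) 2 μ)
    (h' : MemLp (e.prevMomentum t i) 2 μ) : MemLp (e.meanMomentum t i) 2 μ :=
  (h'.const_smul β).add ((memLp_of_lipschitz (continuous_gradient_localLoss hsm hL0 hi)
    (hsm i hi).2 h).const_smul (1 - β))

lemma measurable_meanMomentum {t : ℕ} (ht : t < T) {i : Fin n} (hi : i ∈ C)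
    (h' : Measurable[e.hist t] (e.prevMomentum t i)) :
    Measurable[e.hist t] (e.meanMomentum t i) :=
  (h'.const_smul β).add (((continuous_gradient_localLoss hsm hL0 hi).measurable.comp
    (e.model_measurable t ht.le i hi)).const_smul (1 - β))

lemma memLp_momentum_of {t : ℕ} (ht : t < T) {i : Fin n} (hi : i ∈ C)
    (h : MemLp (e.model t i) 2 μ) (h' : MemLp (e.prevMomentum t i) 2 μ) :
    MemLp (e.momentum t i) 2 μ := by
  have h2 : e.momentum t i = fun ω => e.meanMomentum t i ω + (1 - β) • e.noise t i ω :=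
    funext fun ω => e.momentum_eq_add_noise ht hi ω
  rw [h2]
  exact (e.memLp_meanMomentum hL0 hwp hsm hvar hi h h').add
    ((e.memLp_noise hL0 hwp hsm hvar ht hi).1.const_smul (1 - β))

include hδ hn h1 hcard

/-- Square integrability of the models is not evident, since faulty messages are arbitrary. It
propagates because the coordination phase keeps each new model within a multiple of the partial
spread of the average it started from. Measurability of the momenta with respect to the history must
be carried along too. -/
lemma memLp_state {t : ℕ} (ht : t ≤ T) : ∀ i ∈ C, MemLp (e.model t i) 2 μ ∧
    Measurable[e.hist t] (e.prevMomentum t i) ∧ MemLp (e.prevMomentum t i) 2 μ := by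
  induction t with
  | zero =>
    intro i hi
    have h0 : e.prevMomentum 0 i = fun _ => 0 := by funext ω; simp [prevMomentum]
    have h0' : e.model 0 i = fun _ => θ₀ := funext fun ω => e.model_zero i hi ω
    rw [h0, h0']
    exact ⟨memLp_const _, measurable_const, memLp_const _⟩
  | succ t ih =>
    have ht' : t < T := ht
    have ih := ih ht'.le
    have hm : ∀ i ∈ C, MemLp (e.momentum t i) 2 μ := fun i hi =>
      e.memLp_momentum_of hL0 hwp hsm hvar ht' hi (ih i hi).1 (ih i hi).2.2
    have hz : ∀ i ∈ C, MemLp (fun ω => e.model t i ω - γ • e.momentum t i ω) 2 μ := fun i hi =>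
      (ih i hi).1.sub ((hm i hi).const_smul γ)
    intro i hi
    have hprev : e.prevMomentum (t + 1) i = e.momentum t i := by funext ω; simp [prevMomentum]
    rw [hprev]
    refine ⟨?_, ?_, hm i hi⟩
    · have hmeas : AEStronglyMeasurable (e.model (t + 1) i) μ :=
        ((e.model_measurable (t + 1) ht i hi).mono (e.hist.le _) le_rfl).aestronglyMeasurable
      refine (memLp_two_iff_integrable_sq_norm hmeas).2 ?_
      have hS : Integrable (e.partialSpread t) μ := integrable_spread hz
      -- The new model is the sum of its distance to the new average, the drift of the average, and
      -- the old average `z`. Two applications of `norm_add_sq_le_two` give the factors 4, 4 and 2.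
      refine ((hS.const_mul (4 * alpha n f ^ 2 + 4 * lam δ n f)).add
        ((integrable_norm_sq (memLp_avg hz)).const_mul 2)).mono' (hmeas.norm.pow 2)
        (ae_of_all _ fun ω => ?_)
      rw [Real.norm_of_nonneg (sq_nonneg _)]
      simp only [Pi.add_apply]
      have a1 := e.norm_model_sub_avgModel_sq_le hδ hn h1 hcard ht' ω hi
      have a2 := e.norm_avgModel_sub_sq_le hδ hn h1 hcard ht' ω
      set z := avg C (fun i => e.model t i ω - γ • e.momentum t i ω)
      have a3 := norm_add_sq_le_two (e.model (t + 1) i ω - e.avgModel (t + 1) ω)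
        (e.avgModel (t + 1) ω - z)
      have a4 := norm_add_sq_le_two (e.model (t + 1) i ω - e.avgModel (t + 1) ω
        + (e.avgModel (t + 1) ω - z)) z
      rw [show e.model (t + 1) i ω - e.avgModel (t + 1) ω + (e.avgModel (t + 1) ω - z) + z
        = e.model (t + 1) i ω by abel] at a4
      linarith
    · have h2 : e.momentum t i = fun ω => e.meanMomentum t i ω + (1 - β) • e.noise t i ω :=
        funext fun ω => e.momentum_eq_add_noise ht' hi ω
      rw [h2]
      exact ((e.measurable_meanMomentum hL0 hwp hsm hvar ht' hi (ih i hi).2.1).mono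
        (e.hist.mono (Nat.le_succ t)) le_rfl).add
        ((e.measurable_hist_noise hL0 hwp hsm ht' hi).const_smul (1 - β))

lemma memLp_model {t : ℕ} (ht : t ≤ T) {i : Fin n} (hi : i ∈ C) : MemLp (e.model t i) 2 μ :=
  (e.memLp_state hδ hn h1 hcard hL0 hwp hsm hvar ht i hi).1

lemma memLp_momentum {t : ℕ} (ht : t < T) {i : Fin n} (hi : i ∈ C) :
    MemLp (e.momentum t i) 2 μ :=
  e.memLp_momentum_of hL0 hwp hsm hvar ht hi
    (e.memLp_state hδ hn h1 hcard hL0 hwp hsm hvar ht.le i hi).1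
    (e.memLp_state hδ hn h1 hcard hL0 hwp hsm hvar ht.le i hi).2.2

lemma meanMomentum_state {t : ℕ} (ht : t < T) {i : Fin n} (hi : i ∈ C) :
    Measurable[e.hist t] (e.meanMomentum t i) ∧ MemLp (e.meanMomentum t i) 2 μ :=
  ⟨e.measurable_meanMomentum hL0 hwp hsm hvar ht hi
      (e.memLp_state hδ hn h1 hcard hL0 hwp hsm hvar ht.le i hi).2.1,
    e.memLp_meanMomentum hL0 hwp hsm hvar hi
      (e.memLp_state hδ hn h1 hcard hL0 hwp hsm hvar ht.le i hi).1
      (e.memLp_state hδ hn h1 hcard hL0 hwp hsm hvar ht.le i hi).2.2⟩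

lemma integrable_partialSpread {t : ℕ} (ht : t < T) : Integrable (e.partialSpread t) μ :=
  integrable_spread fun _ hi => (e.memLp_model hδ hn h1 hcard hL0 hwp hsm hvar ht.le hi).sub
    ((e.memLp_momentum hδ hn h1 hcard hL0 hwp hsm hvar ht hi).const_smul γ)

lemma memLp_avgModel {t : ℕ} (ht : t ≤ T) : MemLp (e.avgModel t) 2 μ :=
  memLp_avg fun _ hi => e.memLp_model hδ hn h1 hcard hL0 hwp hsm hvar ht hi

lemma memLp_avgGrad (hC : C.Nonempty) {t : ℕ} (ht : t ≤ T) : MemLp (e.avgGrad t) 2 μ :=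
  memLp_of_lipschitz (continuous_gradient_avgLoss hsm hL0 hC)
    (lipschitz_gradient_avgLoss hC hsm) (e.memLp_avgModel hδ hn h1 hcard hL0 hwp hsm hvar ht)

lemma memLp_deviation (hC : C.Nonempty) {t : ℕ} (ht : t < T) : MemLp (e.deviation t) 2 μ :=
  (memLp_avg fun _ hi => e.memLp_momentum hδ hn h1 hcard hL0 hwp hsm hvar ht hi).sub
    (e.memLp_avgGrad hδ hn h1 hcard hL0 hwp hsm hvar hC ht.le)

omit hδ hn h1 hcard hL0 hwp hsm hvar in
lemma measurable_avgModel {t : ℕ} (ht : t ≤ T) : Measurable[e.hist t] (e.avgModel t) :=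
  measurable_avg fun i hi => e.model_measurable t ht i hi

/-- Effect of the noise on the spread of the momenta. -/
lemma integral_spread_momentum_le (hC : C.Nonempty) {t : ℕ} (ht : t < T) :
    ∫ ω, spread C (fun i => e.momentum t i ω) ∂μ ≤
      ∫ ω, spread C (fun i => e.meanMomentum t i ω) ∂μ + (1 - β) ^ 2 * σ ^ 2 := by
  have hc : (C.card : ℝ) ≠ 0 := by exact_mod_cast hC.card_pos.ne'
  have hmean := fun i (hi : i ∈ C) => e.meanMomentum_state hδ hn h1 hcard hL0 hwp hsm hvar ht hi
  have hnoise := fun i (hi : i ∈ C) => e.memLp_noise hL0 hwp hsm hvar ht hi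
  have hu : ∀ i ∈ C,
      MemLp (fun ω => e.meanMomentum t i ω - avg C fun i => e.meanMomentum t i ω) 2 μ :=
    fun i hi => (hmean i hi).2.sub (memLp_avg fun i hi => (hmean i hi).2)
  have hum : ∀ i ∈ C, Measurable[e.hist t]
      (fun ω => e.meanMomentum t i ω - avg C fun i => e.meanMomentum t i ω) :=
    fun i hi => (hmean i hi).1.sub (measurable_avg fun i hi => (hmean i hi).1)
  -- Centering at the average of the mean momenta, instead of the momenta themselves, keeps the left
  -- factors of the inner products independent of the new samples.
  have hpt : ∀ ω, spread C (fun i => e.momentum t i ω) ≤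
      spread C (fun i => e.meanMomentum t i ω)
      + 2 * (1 - β) * (C.card : ℝ)⁻¹ * ∑ i ∈ C, inner ℝ (e.meanMomentum t i ω
          - avg C fun i => e.meanMomentum t i ω) (e.noise t i ω)
      + (1 - β) ^ 2 * (C.card : ℝ)⁻¹ * ∑ i ∈ C, ‖e.noise t i ω‖ ^ 2 := fun ω => by
    rw [spread_congr fun i hi => e.momentum_eq_add_noise ht hi ω]
    refine (spread_add_le _ _).trans_eq ?_
    simp only [inner_smul_right, norm_smul, mul_pow, ← Finset.mul_sum, Real.norm_eq_abs, sq_abs]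
    ring
  have i1 : Integrable (fun ω => spread C (fun i => e.meanMomentum t i ω)) μ :=
    integrable_spread fun i hi => (hmean i hi).2
  have i2 : ∀ i ∈ C, Integrable (fun ω => inner ℝ (e.meanMomentum t i ω
      - avg C fun i => e.meanMomentum t i ω) (e.noise t i ω)) μ := fun i hi =>
    integrable_inner_of_memLp (hu i hi) (hnoise i hi).1
  have i3 : ∀ i ∈ C, Integrable (fun ω => ‖e.noise t i ω‖ ^ 2) μ := fun i hi =>
    integrable_norm_sq (hnoise i hi).1
  have i2' := (integrable_finsetSum C i2).const_mul (2 * (1 - β) * (C.card : ℝ)⁻¹)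
  have i3' := (integrable_finsetSum C i3).const_mul ((1 - β) ^ 2 * (C.card : ℝ)⁻¹)
  have i0 : Integrable (fun ω => spread C (fun i => e.momentum t i ω)) μ :=
    integrable_spread fun i hi => e.memLp_momentum hδ hn h1 hcard hL0 hwp hsm hvar ht hi
  refine (integral_mono i0 ((i1.add i2').add i3') hpt).trans ?_
  rw [integral_add' (i1.add i2') i3', integral_add' i1 i2', integral_const_mul, integral_const_mul,
    integral_finsetSum _ i2, integral_finsetSum _ i3,
    Finset.sum_eq_zero fun i hi => e.integral_inner_noise hL0 hwp hsm hvar ht hi (hum i hi) (hu i hi),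
    mul_zero, add_zero]
  refine add_le_add le_rfl ?_
  calc _ ≤ (1 - β) ^ 2 * (C.card : ℝ)⁻¹ * ∑ _i ∈ C, σ ^ 2 := by
        gcongr with i hi; exact (hnoise i hi).2
    _ = _ := by rw [Finset.sum_const, nsmul_eq_mul]; field_simp

/-- Effect of the noise on the deviation of the average momentum. -/
lemma integral_norm_deviation_le (hC : C.Nonempty) {t : ℕ} (ht : t < T) :
    ∫ ω, ‖e.deviation t ω‖ ^ 2 ∂μ ≤
      ∫ ω, ‖avg C (fun i => e.meanMomentum t i ω) - e.avgGrad t ω‖ ^ 2 ∂μ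
        + (1 - β) ^ 2 * (σ ^ 2 / C.card) := by
  have hc : (C.card : ℝ) ≠ 0 := by exact_mod_cast hC.card_pos.ne'
  have hmean := fun i (hi : i ∈ C) => e.meanMomentum_state hδ hn h1 hcard hL0 hwp hsm hvar ht hi
  have hnoise := fun i (hi : i ∈ C) => e.memLp_noise hL0 hwp hsm hvar ht hi
  set u : Ω → Param d := fun ω => avg C (fun i => e.meanMomentum t i ω) - e.avgGrad t ω with hu_def
  have hu : MemLp u 2 μ := (memLp_avg fun i hi => (hmean i hi).2).sub
    (e.memLp_avgGrad hδ hn h1 hcard hL0 hwp hsm hvar hC ht.le)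
  have hum : Measurable[e.hist t] u := (measurable_avg fun i hi => (hmean i hi).1).sub
    ((continuous_gradient_avgLoss hsm hL0 hC).measurable.comp (e.measurable_avgModel ht.le))
  have hpt : ∀ ω, ‖e.deviation t ω‖ ^ 2 = ‖u ω‖ ^ 2
      + 2 * (1 - β) * (C.card : ℝ)⁻¹ * ∑ i ∈ C, inner ℝ (u ω) (e.noise t i ω)
      + (1 - β) ^ 2 * ‖avg C fun i => e.noise t i ω‖ ^ 2 := fun ω => by
    have : e.deviation t ω = u ω + (1 - β) • avg C fun i => e.noise t i ω := by
      rw [deviation, avg_congr fun i hi => e.momentum_eq_add_noise ht hi ω, avg_add, avg_smul,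
        hu_def]
      exact add_sub_right_comm _ _ _
    rw [this, norm_add_sq_real, inner_smul_right, norm_smul, mul_pow, Real.norm_eq_abs, sq_abs]
    congr 2
    rw [avg, inner_smul_right, inner_sum]
    ring
  have i2 : ∀ i ∈ C, Integrable (fun ω => inner ℝ (u ω) (e.noise t i ω)) μ := fun i hi =>
    integrable_inner_of_memLp hu (hnoise i hi).1
  have i1 := integrable_norm_sq hu
  have i2' := (integrable_finsetSum C i2).const_mul (2 * (1 - β) * (C.card : ℝ)⁻¹)
  have i3 := (integrable_norm_sq (memLp_avg fun i hi => (hnoise i hi).1)).const_mul ((1 - β) ^ 2)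
  refine (integral_congr_ae (ae_of_all _ hpt)).trans_le ?_
  rw [integral_add (f := fun ω => ‖u ω‖ ^ 2
      + 2 * (1 - β) * (C.card : ℝ)⁻¹ * ∑ i ∈ C, inner ℝ (u ω) (e.noise t i ω)) (i1.add i2') i3,
    integral_add i1 i2', integral_const_mul, integral_const_mul,
    integral_finsetSum _ i2,
    Finset.sum_eq_zero fun i hi => e.integral_inner_noise hL0 hwp hsm hvar ht hi hum hu,
    mul_zero, add_zero]
  gcongr
  exact e.integral_norm_avg_noise_sq_le hL0 hwp hsm hvar ht

end Moments

end Execution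

/-! ### Summed recursions, parameter bounds and the inexact gradient step -/

lemma sum_le_of_recursion {β k c g : ℝ} {a p : ℕ → ℝ} (hβ : 0 ≤ β) {N : ℕ} (ha : ∀ t, 0 ≤ a t)
    (h0 : a 0 ≤ β * g + c) (hs : ∀ t, t + 1 < N → a (t + 1) ≤ β * a t + k * p t + c)
    (hp : ∀ t, 0 ≤ k * p t) (hN : 1 ≤ N) :
    (1 - β) * ∑ t ∈ Finset.range N, a t ≤ β * g + k * ∑ t ∈ Finset.range N, p t + N * c := by
  -- The extra `β * a m` on the left closes the induction: it is what the recursion for `a (m + 1)`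
  -- consumes. The sum of `p` lags by one index.
  have key : ∀ m, m < N → (1 - β) * ∑ t ∈ Finset.range (m + 1), a t + β * a m ≤
      β * g + k * ∑ t ∈ Finset.range m, p t + (m + 1 : ℕ) * c := by
    intro m
    induction m with
    | zero => 
      intro _
      rw [zero_add, Finset.sum_range_one, Finset.sum_range_zero]
      push_cast
      linarith
    | succ m ih =>
      intro hm
      have h1 := ih (by omega)
      have h2 := hs m hm
      rw [Finset.sum_range_succ, Finset.sum_range_succ (fun t => p t)]
      push_cast at h1 ⊢
      linarith
  obtain ⟨m, rfl⟩ : ∃ m, N = m + 1 := ⟨N - 1, by omega⟩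
  have h1 := key m (by omega)
  have h2 := hp m
  have h3 := mul_nonneg hβ (ha m)
  rw [Finset.sum_range_succ (fun t => p t)]
  linarith

lemma alpha_nonneg {n f : ℕ} (hf : f ≤ n) : 0 ≤ alpha n f := by
  have : (0 : ℝ) ≤ (n : ℝ) - f := by simpa using (Nat.cast_le (α := ℝ)).2 hf
  rw [alpha]; positivity

lemma alpha_le_half {δ : ℝ} (hδ : 0 < δ) {n f : ℕ} (hn : (5 + δ) * f ≤ n) (h1 : 1 ≤ n) :
    alpha n f ≤ 1 / 2 := by
  have h2 := two_mul_lt_of_le hδ hn h1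
  have h3 : (0 : ℝ) < (n : ℝ) - f := by
    have : (f : ℝ) < n := by exact_mod_cast (by omega : f < n)
    linarith
  rw [alpha, div_le_div_iff₀ h3 two_pos]
  nlinarith [mul_nonneg hδ.le (Nat.cast_nonneg (α := ℝ) f)]

lemma lam_nonneg (δ : ℝ) {n f : ℕ} (hf : f ≤ n) : 0 ≤ lam δ n f := by
  have : (0 : ℝ) ≤ (n : ℝ) - f := by simpa using (Nat.cast_le (α := ℝ)).2 hf
  rw [lam]; positivity

section Descent

variable {E : Type*} [NormedAddCommGroup E] [InnerProductSpace ℝ E]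

/-- One inexact gradient step `p = -γ (A + a) + b`. -/
lemma descent_step {Q₀ Q₁ γ L : ℝ} (hγ : 0 < γ) (hγL : γ * L ≤ 1 / 12) {A a b p : E}
    (hp : p = -(γ • (A + a)) + b) (h : Q₁ ≤ Q₀ + inner ℝ A p + L / 2 * ‖p‖ ^ 2) :
    γ / 2 * ‖A‖ ^ 2 + 11 / (24 * γ) * ‖p‖ ^ 2 ≤
      Q₀ - Q₁ + γ * ‖a‖ ^ 2 + γ⁻¹ * ‖b‖ ^ 2 := by
  -- Both errors are merged into one perturbation of the gradient.
  set w : E := a - γ⁻¹ • b with hw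
  have hpw : p = -(γ • (A + w)) := by
    rw [hp, hw, ← add_sub_assoc, smul_sub γ, smul_smul, mul_inv_cancel₀ hγ.ne', one_smul]
    abel
  have hp2 : ‖p‖ ^ 2 = γ ^ 2 * (‖A‖ ^ 2 + 2 * inner ℝ A w + ‖w‖ ^ 2) := by
    rw [hpw, norm_neg, norm_smul, mul_pow, Real.norm_eq_abs, sq_abs, norm_add_sq_real]
  have hAp : inner ℝ A p = -(γ * (‖A‖ ^ 2 + inner ℝ A w)) := by
    rw [hpw, inner_neg_right, inner_smul_right, inner_add_right, real_inner_self_eq_norm_sq]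
  have hw2 : ‖w‖ ^ 2 ≤ 2 * ‖a‖ ^ 2 + 2 * (γ⁻¹ ^ 2 * ‖b‖ ^ 2) := by
    have := norm_sub_sq_le_two a (γ⁻¹ • b)
    rwa [norm_smul, mul_pow, Real.norm_eq_abs, sq_abs] at this
  -- Polarization: the inner product yields a full negative multiple of `‖p‖²` besides that of
  -- `‖A‖²`. The quadratic term of the descent lemma uses up `γ⁻¹ / 24` of the coefficient `γ⁻¹ /
  -- 2`, leaving `11 / (24 γ)`.
  have hAp' : inner ℝ A p = -(γ / 2 * ‖A‖ ^ 2) - γ⁻¹ / 2 * ‖p‖ ^ 2 + γ / 2 * ‖w‖ ^ 2 := by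
    rw [hAp, hp2]; field_simp; ring
  have h1 : γ / 2 * ‖w‖ ^ 2 ≤ γ * ‖a‖ ^ 2 + γ⁻¹ * ‖b‖ ^ 2 := by
    calc _ ≤ γ / 2 * (2 * ‖a‖ ^ 2 + 2 * (γ⁻¹ ^ 2 * ‖b‖ ^ 2)) := by gcongr
      _ = _ := by field_simp
  have h2 : L / 2 * ‖p‖ ^ 2 ≤ γ⁻¹ / 24 * ‖p‖ ^ 2 := by
    have hL : L = γ⁻¹ * (γ * L) := by rw [← mul_assoc, inv_mul_cancel₀ hγ.ne', one_mul]
    have hL' : γ⁻¹ * (γ * L) ≤ γ⁻¹ * (1 / 12) := by gcongr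
    have hL2 : L / 2 ≤ γ⁻¹ / 24 := by rw [hL]; linarith
    gcongr
  have h3 : 11 / (24 * γ) * ‖p‖ ^ 2 = γ⁻¹ / 2 * ‖p‖ ^ 2 - γ⁻¹ / 24 * ‖p‖ ^ 2 := by
    field_simp; ring
  rw [h3]
  linarith

end Descent

/-! ### Recursions for spread, momentum deviation and average loss -/

namespace Execution

variable {n d : ℕ} {Ω X : Type*} [mΩ : MeasurableSpace Ω] [MeasurableSpace X] {μ : Measure Ω}
  {q : Param d → X → ℝ} {D : Fin n → Measure X}
  {C : Finset (Fin n)} {f : ℕ} {θ₀ : Param d} {γ β δ L σ ζ : ℝ} {T : ℕ}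
  [IsProbabilityMeasure μ] [∀ i, IsProbabilityMeasure (D i)]
  (e : Execution μ q D C f θ₀ γ β (rounds δ n f) T)
  (hδ : 0 < δ) (hn : (5 + δ) * f ≤ n) (h1 : 1 ≤ n) (hcard : C.card = n - f) (hC : C.Nonempty)
  (hL0 : 0 ≤ L) (hwp : IsWellPosed q D C) (hsm : IsLipschitzSmooth q D C L)
  (hvar : HasBoundedVariance q D C σ) (hhet : IsHeterogeneous q D C ζ)
  (hβ0 : 0 ≤ β) (hβ1 : β ≤ 1) (hγ0 : 0 ≤ γ) (hγL : γ * L ≤ 1 / 12)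

/-- Bound on the expected spread of the partially updated models. -/
noncomputable def spreadBound (γ β σ ζ : ℝ) : ℝ := 5 * γ ^ 2 * ((1 - β) * σ ^ 2 + 2 * ζ ^ 2)

include hδ hn h1 hcard hC hL0 hwp hsm hvar hhet hβ0 hβ1 hγ0 hγL

omit [IsProbabilityMeasure μ] [∀ i, IsProbabilityMeasure (D i)] hδ hn h1 hcard hC hL0 hwp hsm hvar
  hhet hβ0 hγ0 hγL in
lemma spreadBound_nonneg : 0 ≤ spreadBound γ β σ ζ := by
  have : 0 ≤ 1 - β := by linarith
  rw [spreadBound]; positivity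

omit [IsProbabilityMeasure μ] [∀ i, IsProbabilityMeasure (D i)] hcard hC hwp hsm hvar
  hhet hβ0 in
-- This is why `spreadBound` has the factor 5: the source term accounts for `2/5` of it, the model
-- spread for at most `1/2` because `α² ≤ 1/4`, and the feedback through the gradients for at most
-- `1/144`.
lemma spreadBound_step :
    2 * (alpha n f ^ 2 * spreadBound γ β σ ζ) + 2 * γ ^ 2 * ((1 - β) * σ ^ 2 + 2 * ζ ^ 2
      + 2 * L ^ 2 * (alpha n f ^ 2 * spreadBound γ β σ ζ)) ≤ spreadBound γ β σ ζ := by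
  have hx : 0 ≤ spreadBound γ β σ ζ := spreadBound_nonneg hβ1
  have hα0 := alpha_nonneg (n := n) (f := f) (by have := two_mul_lt_of_le hδ hn h1; omega)
  have hα : alpha n f ^ 2 ≤ 1 / 4 := by nlinarith [alpha_le_half hδ hn h1]
  have hγL2 : (γ * L) ^ 2 ≤ 1 / 144 := by nlinarith [mul_nonneg hγ0 hL0]
  have e1 : 2 * γ ^ 2 * ((1 - β) * σ ^ 2 + 2 * ζ ^ 2) = 2 / 5 * spreadBound γ β σ ζ := by
    rw [spreadBound]; ring
  have e2 : alpha n f ^ 2 * spreadBound γ β σ ζ ≤ 1 / 4 * spreadBound γ β σ ζ := by gcongr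
  have e3 : (γ * L) ^ 2 * (alpha n f ^ 2 * spreadBound γ β σ ζ) ≤
      1 / 144 * (1 / 4 * spreadBound γ β σ ζ) := by gcongr
  nlinarith

/-- The model and momentum bounds are an invariant pair. The momentum bound reproduces itself
exactly: averaging it with the gradient spread `2 L² x + 2 ζ²` and adding the noise `(1 - β)² σ²`
gives it back. `spreadBound_step` then closes the loop. -/
lemma integral_spread_step {t : ℕ} (ht : t < T)
    (hΓ : ∫ ω, spread C (fun i => e.model t i ω) ∂μ ≤ alpha n f ^ 2 * spreadBound γ β σ ζ)
    (hm : ∫ ω, spread C (fun i => e.prevMomentum t i ω) ∂μ ≤ (1 - β) * σ ^ 2 + 2 * ζ ^ 2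
      + 2 * L ^ 2 * (alpha n f ^ 2 * spreadBound γ β σ ζ)) :
    ∫ ω, spread C (fun i => e.momentum t i ω) ∂μ ≤ (1 - β) * σ ^ 2 + 2 * ζ ^ 2
      + 2 * L ^ 2 * (alpha n f ^ 2 * spreadBound γ β σ ζ) ∧
    ∫ ω, e.partialSpread t ω ∂μ ≤ spreadBound γ β σ ζ := by
  have hst := e.memLp_state hδ hn h1 hcard hL0 hwp hsm hvar ht.le
  have iΓ : Integrable (fun ω => spread C (fun i => e.model t i ω)) μ :=
    integrable_spread fun i hi => (hst i hi).1
  have ip : Integrable (fun ω => spread C (fun i => e.prevMomentum t i ω)) μ :=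
    integrable_spread fun i hi => (hst i hi).2.2
  have imean : Integrable (fun ω => spread C (fun i => e.meanMomentum t i ω)) μ :=
    integrable_spread fun i hi =>
      (e.meanMomentum_state hδ hn h1 hcard hL0 hwp hsm hvar ht hi).2
  have imom : Integrable (fun ω => spread C (fun i => e.momentum t i ω)) μ :=
    integrable_spread fun i hi => e.memLp_momentum hδ hn h1 hcard hL0 hwp hsm hvar ht hi
  have hβ' : 0 ≤ 1 - β := by linarith
  set x := alpha n f ^ 2 * spreadBound γ β σ ζ with hx
  have hmom : ∫ ω, spread C (fun i => e.momentum t i ω) ∂μ ≤ (1 - β) * σ ^ 2 + 2 * ζ ^ 2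
      + 2 * L ^ 2 * x := by
    refine (e.integral_spread_momentum_le hδ hn h1 hcard hL0 hwp hsm hvar hC ht).trans ?_
    have hpt : ∀ ω, spread C (fun i => e.meanMomentum t i ω) ≤
        β * spread C (fun i => e.prevMomentum t i ω)
        + (1 - β) * (2 * L ^ 2 * spread C (fun i => e.model t i ω) + 2 * ζ ^ 2) := fun ω => by
      refine (spread_convex_le hβ0 hβ1 _ _).trans ?_
      gcongr
      exact spread_gradient_le hsm hhet _
    have ig : Integrable (fun ω => 2 * L ^ 2 * spread C (fun i => e.model t i ω) + 2 * ζ ^ 2) μ :=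
      (iΓ.const_mul (2 * L ^ 2)).add (integrable_const _)
    have hle := integral_mono imean ((ip.const_mul β).add (ig.const_mul (1 - β))) hpt
    rw [integral_add' (ip.const_mul β) (ig.const_mul (1 - β)), integral_const_mul,
      integral_const_mul, integral_add (iΓ.const_mul (2 * L ^ 2)) (integrable_const _),
      integral_const_mul, integral_const, probReal_univ, one_smul] at hle
    have a1 := mul_le_mul_of_nonneg_left hm hβ0
    have a2 : (1 - β) * (2 * L ^ 2 * ∫ ω, spread C (fun i => e.model t i ω) ∂μ + 2 * ζ ^ 2) ≤
        (1 - β) * (2 * L ^ 2 * x + 2 * ζ ^ 2) := by gcongr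
    calc _ ≤ β * ((1 - β) * σ ^ 2 + 2 * ζ ^ 2 + 2 * L ^ 2 * x)
          + (1 - β) * (2 * L ^ 2 * x + 2 * ζ ^ 2) + (1 - β) ^ 2 * σ ^ 2 := by linarith
      _ = _ := by ring
  refine ⟨hmom, ?_⟩
  have hpt : ∀ ω, e.partialSpread t ω ≤ 2 * spread C (fun i => e.model t i ω)
      + 2 * γ ^ 2 * spread C (fun i => e.momentum t i ω) := fun ω => spread_sub_smul_le _ _ _
  have hle := integral_mono (e.integrable_partialSpread hδ hn h1 hcard hL0 hwp hsm hvar ht)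
    ((iΓ.const_mul 2).add (imom.const_mul (2 * γ ^ 2))) hpt
  rw [integral_add' (iΓ.const_mul 2) (imom.const_mul (2 * γ ^ 2)), integral_const_mul,
    integral_const_mul] at hle
  refine hle.trans (le_trans ?_
    (spreadBound_step (σ := σ) (ζ := ζ) hδ hn h1 hL0 hβ1 hγ0 hγL))
  rw [← hx]
  gcongr

lemma integral_spread_le {t : ℕ} (ht : t ≤ T) :
    ∫ ω, spread C (fun i => e.model t i ω) ∂μ ≤ alpha n f ^ 2 * spreadBound γ β σ ζ ∧
    ∫ ω, spread C (fun i => e.prevMomentum t i ω) ∂μ ≤ (1 - β) * σ ^ 2 + 2 * ζ ^ 2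
      + 2 * L ^ 2 * (alpha n f ^ 2 * spreadBound γ β σ ζ) := by
  have hx : 0 ≤ spreadBound γ β σ ζ := spreadBound_nonneg hβ1
  have hβ' : 0 ≤ 1 - β := by linarith
  induction t with
  | zero =>
    have h0 : ∀ ω, spread C (fun i => e.prevMomentum 0 i ω) = 0 := fun ω => by
      simp [prevMomentum, spread, avg]
    simp only [e.spread_model_zero hC, h0, integral_zero]
    exact ⟨by positivity, by positivity⟩
  | succ t ih =>
    have ht' : t < T := ht
    obtain ⟨ih1, ih2⟩ := ih ht'.le
    obtain ⟨s1, s2⟩ := e.integral_spread_step hδ hn h1 hcard hC hL0 hwp hsm hvar hhet hβ0 hβ1 hγ0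
      hγL ht' ih1 ih2
    refine ⟨?_, ?_⟩
    · have hle := integral_mono
        (integrable_spread fun i hi => (e.memLp_model hδ hn h1 hcard hL0 hwp hsm hvar ht hi))
        ((e.integrable_partialSpread hδ hn h1 hcard hL0 hwp hsm hvar ht').const_mul (alpha n f ^ 2))
        fun ω => e.spread_model_succ_le hδ hn h1 hcard hC ht' ω
      rw [integral_const_mul] at hle
      exact hle.trans (by gcongr)
    · simpa [prevMomentum] using s1

lemma integral_partialSpread_le {t : ℕ} (ht : t < T) :
    ∫ ω, e.partialSpread t ω ∂μ ≤ spreadBound γ β σ ζ := by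
  obtain ⟨h2, h3⟩ := e.integral_spread_le hδ hn h1 hcard hC hL0 hwp hsm hvar hhet hβ0 hβ1 hγ0 hγL
    ht.le
  exact (e.integral_spread_step hδ hn h1 hcard hC hL0 hwp hsm hvar hhet hβ0 hβ1 hγ0 hγL ht h2 h3).2

/-- Each local model is close to the average model. -/
lemma integral_norm_model_sub_sq_le {t : ℕ} (ht : t < T) {i : Fin n} (hi : i ∈ C) :
    ∫ ω, ‖e.model t i ω - e.avgModel t ω‖ ^ 2 ∂μ ≤ alpha n f ^ 2 * spreadBound γ β σ ζ := by
  have hx : 0 ≤ spreadBound γ β σ ζ := spreadBound_nonneg hβ1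
  obtain _ | t := t
  · simp only [e.avgModel_zero hC, e.model_zero i hi, sub_self, norm_zero, zero_pow two_ne_zero,
      integral_zero]
    positivity
  · have ht' : t < T := by omega
    have hle := integral_mono (integrable_norm_sq
      ((e.memLp_model hδ hn h1 hcard hL0 hwp hsm hvar ht.le hi).sub
        (e.memLp_avgModel hδ hn h1 hcard hL0 hwp hsm hvar ht.le)))
      ((e.integrable_partialSpread hδ hn h1 hcard hL0 hwp hsm hvar ht').const_mul (alpha n f ^ 2))
      fun ω => e.norm_model_sub_avgModel_sq_le hδ hn h1 hcard ht' ω hi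
    rw [integral_const_mul] at hle
    refine hle.trans ?_
    gcongr
    exact e.integral_partialSpread_le hδ hn h1 hcard hC hL0 hwp hsm hvar hhet hβ0 hβ1 hγ0 hγL ht'

omit [IsProbabilityMeasure μ] [∀ i, IsProbabilityMeasure (D i)] hδ hn h1 hcard hwp hvar hhet
  hγ0 hγL in
-- The momentum starts at zero, so before the first iteration it misses the whole initial gradient.
-- This is the source of the term in `‖∇Q(θ₀)‖²`, later bounded by the optimality gap.
lemma norm_avg_meanMomentum_sub_sq_le_zero (ω : Ω) :
    ‖avg C (fun i => e.meanMomentum 0 i ω) - e.avgGrad 0 ω‖ ^ 2 ≤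
      β * ‖gradient (avgLoss q D C) θ₀‖ ^ 2
        + (1 - β) * (L ^ 2 * spread C (fun i => e.model 0 i ω)) := by
  have hβ' : 0 ≤ 1 - β := by linarith
  have h : avg C (fun i => e.meanMomentum 0 i ω) - e.avgGrad 0 ω = β • (-e.avgGrad 0 ω)
      + (1 - β) • (avg C (fun i => gradient (localLoss q D i) (e.model 0 i ω))
        - e.avgGrad 0 ω) := by
    have h0 : ∀ i, e.prevMomentum 0 i ω = 0 := fun i => by simp [prevMomentum]
    simp only [meanMomentum, h0, smul_zero, zero_add]
    rw [avg_smul]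
    module
  rw [h]
  refine (norm_convex_sq_le hβ0 hβ1 _ _).trans ?_
  rw [norm_neg]
  gcongr
  · rw [avgGrad, e.avgModel_zero hC]
  · exact norm_avg_gradient_sub_sq_le hsm _

omit [IsProbabilityMeasure μ] [∀ i, IsProbabilityMeasure (D i)] hδ hn h1 hcard hwp hvar hhet hβ1
  hγ0 hγL in
-- The gradient change `a` is put inside the part of weight `1 - β`, with coefficient `β / (1 - β)`.
-- Convexity then retains the contraction factor `β` exactly, and the price is `1 / (1 - β)` in
-- front of the squared step.
lemma norm_avg_meanMomentum_sub_sq_le_succ (hβ : β < 1) (t : ℕ) (ω : Ω) :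
    ‖avg C (fun i => e.meanMomentum (t + 1) i ω) - e.avgGrad (t + 1) ω‖ ^ 2 ≤
      β * ‖e.deviation t ω‖ ^ 2
        + 2 * L ^ 2 / (1 - β) * ‖e.avgModel (t + 1) ω - e.avgModel t ω‖ ^ 2
        + 2 * (1 - β) * (L ^ 2 * spread C (fun i => e.model (t + 1) i ω)) := by
  have hβ' : 0 < 1 - β := by linarith
  set r := avg C (fun i => gradient (localLoss q D i) (e.model (t + 1) i ω)) - e.avgGrad (t + 1) ω
    with hr
  set a := e.avgGrad t ω - e.avgGrad (t + 1) ω with ha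
  have h : avg C (fun i => e.meanMomentum (t + 1) i ω) - e.avgGrad (t + 1) ω =
      β • e.deviation t ω + (1 - β) • ((β / (1 - β)) • a + r) := by
    have h0 : ∀ i, e.prevMomentum (t + 1) i ω = e.momentum t i ω := fun i => by
      simp [prevMomentum]
    simp only [meanMomentum, h0]
    rw [avg_add, avg_smul, avg_smul, smul_add, smul_smul, mul_div_cancel₀ _ hβ'.ne', hr, ha,
      deviation]
    module
  have hr2 : ‖r‖ ^ 2 ≤ L ^ 2 * spread C (fun i => e.model (t + 1) i ω) :=
    norm_avg_gradient_sub_sq_le hsm _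
  have ha2 : ‖a‖ ^ 2 ≤ L ^ 2 * ‖e.avgModel (t + 1) ω - e.avgModel t ω‖ ^ 2 := by
    rw [← mul_pow, norm_sub_rev (e.avgModel (t + 1) ω)]
    gcongr
    exact lipschitz_gradient_avgLoss hC hsm _ _
  have h2 := norm_add_sq_le_two ((β / (1 - β)) • a) r
  rw [norm_smul, mul_pow, Real.norm_eq_abs, sq_abs] at h2
  rw [h]
  refine (norm_convex_sq_le hβ0 hβ.le _ _).trans ?_
  have h3 : (β / (1 - β)) ^ 2 * ‖a‖ ^ 2 ≤ (1 / (1 - β)) ^ 2 * (L ^ 2 * ‖e.avgModel (t + 1) ω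
      - e.avgModel t ω‖ ^ 2) := by gcongr
  calc _ ≤ β * ‖e.deviation t ω‖ ^ 2 + (1 - β) * (2 * ((1 / (1 - β)) ^ 2 * (L ^ 2 *
        ‖e.avgModel (t + 1) ω - e.avgModel t ω‖ ^ 2))
        + 2 * (L ^ 2 * spread C (fun i => e.model (t + 1) i ω))) := by gcongr; linarith
    _ = _ := by field_simp; ring

/-- Recursion for the expected squared deviation of the average momentum. -/
lemma integral_norm_deviation_zero_le (hT : 0 < T) :
    ∫ ω, ‖e.deviation 0 ω‖ ^ 2 ∂μ ≤ β * ‖gradient (avgLoss q D C) θ₀‖ ^ 2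
      + (2 * (1 - β) * (L ^ 2 * (alpha n f ^ 2 * spreadBound γ β σ ζ))
        + (1 - β) ^ 2 * (σ ^ 2 / C.card)) := by
  have hβ' : 0 ≤ 1 - β := by linarith
  have hx : 0 ≤ spreadBound γ β σ ζ := spreadBound_nonneg hβ1
  refine (e.integral_norm_deviation_le hδ hn h1 hcard hL0 hwp hsm hvar hC hT).trans ?_
  rw [← add_assoc]
  gcongr
  have himean := integrable_norm_sq ((memLp_avg fun i hi =>
    (e.meanMomentum_state hδ hn h1 hcard hL0 hwp hsm hvar hT hi).2).sub
    (e.memLp_avgGrad hδ hn h1 hcard hL0 hwp hsm hvar hC hT.le))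
  refine (integral_mono himean (integrable_const (β * ‖gradient (avgLoss q D C) θ₀‖ ^ 2))
    fun ω => ?_).trans ?_
  · have := e.norm_avg_meanMomentum_sub_sq_le_zero hC hL0 hsm hβ0 hβ1 ω
    rwa [e.spread_model_zero hC, mul_zero, mul_zero, add_zero] at this
  · rw [integral_const, probReal_univ, one_smul]
    -- The initial spread is zero; this term is added only so that the additive constant is the same
    -- in all iterations, as `sum_le_of_recursion` requires.
    have : 0 ≤ 2 * (1 - β) * (L ^ 2 * (alpha n f ^ 2 * spreadBound γ β σ ζ)) := by positivity
    linarith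

lemma integral_norm_deviation_succ_le (hβ : β < 1) {t : ℕ} (ht : t + 1 < T) :
    ∫ ω, ‖e.deviation (t + 1) ω‖ ^ 2 ∂μ ≤ β * ∫ ω, ‖e.deviation t ω‖ ^ 2 ∂μ
      + 2 * L ^ 2 / (1 - β) * ∫ ω, ‖e.avgModel (t + 1) ω - e.avgModel t ω‖ ^ 2 ∂μ
      + (2 * (1 - β) * (L ^ 2 * (alpha n f ^ 2 * spreadBound γ β σ ζ))
        + (1 - β) ^ 2 * (σ ^ 2 / C.card)) := by
  have hβ' : 0 ≤ 1 - β := by linarith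
  refine (e.integral_norm_deviation_le hδ hn h1 hcard hL0 hwp hsm hvar hC ht).trans ?_
  rw [← add_assoc]
  gcongr
  have himean := integrable_norm_sq ((memLp_avg fun i hi =>
    (e.meanMomentum_state hδ hn h1 hcard hL0 hwp hsm hvar ht hi).2).sub
    (e.memLp_avgGrad hδ hn h1 hcard hL0 hwp hsm hvar hC ht.le))
  have i1 := (integrable_norm_sq (e.memLp_deviation hδ hn h1 hcard hL0 hwp hsm hvar hC
    (t.lt_succ_self.trans ht))).const_mul β
  have i2 : Integrable (fun ω => 2 * L ^ 2 / (1 - β) *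
      ‖e.avgModel (t + 1) ω - e.avgModel t ω‖ ^ 2) μ :=
    (integrable_norm_sq ((e.memLp_avgModel hδ hn h1 hcard hL0 hwp hsm hvar ht.le).sub
    (e.memLp_avgModel hδ hn h1 hcard hL0 hwp hsm hvar (t.lt_succ_self.trans ht).le))).const_mul
    (2 * L ^ 2 / (1 - β))
  have i3 := ((integrable_spread fun i hi =>
    (e.memLp_model hδ hn h1 hcard hL0 hwp hsm hvar ht.le hi)).const_mul (L ^ 2)).const_mul
    (2 * (1 - β))
  refine (integral_mono himean ((i1.add i2).add i3) fun ω =>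
    e.norm_avg_meanMomentum_sub_sq_le_succ hC hL0 hsm hβ0 hβ t ω).trans ?_
  rw [integral_add' (i1.add i2) i3, integral_add' i1 i2, integral_const_mul, integral_const_mul,
    integral_const_mul, integral_const_mul]
  gcongr
  exact (e.integral_spread_le hδ hn h1 hcard hC hL0 hwp hsm hvar hhet hβ0 hβ1 hγ0 hγL ht.le).1

/-- The expected squared deviations of the average momentum, summed over the iterations. -/
lemma sum_integral_norm_deviation_le (hβ : β < 1) (hT : 1 ≤ T) :
    (1 - β) * ∑ t ∈ Finset.range T, ∫ ω, ‖e.deviation t ω‖ ^ 2 ∂μ ≤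
      β * ‖gradient (avgLoss q D C) θ₀‖ ^ 2
      + 2 * L ^ 2 / (1 - β) *
        ∑ t ∈ Finset.range T, ∫ ω, ‖e.avgModel (t + 1) ω - e.avgModel t ω‖ ^ 2 ∂μ
      + T * (2 * (1 - β) * (L ^ 2 * (alpha n f ^ 2 * spreadBound γ β σ ζ))
        + (1 - β) ^ 2 * (σ ^ 2 / C.card)) := by
  have hβ' : 0 < 1 - β := by linarith
  exact sum_le_of_recursion (a := fun t => ∫ ω, ‖e.deviation t ω‖ ^ 2 ∂μ)
    (p := fun t => ∫ ω, ‖e.avgModel (t + 1) ω - e.avgModel t ω‖ ^ 2 ∂μ) hβ0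
    (fun t => integral_nonneg fun _ => sq_nonneg _)
    (e.integral_norm_deviation_zero_le hδ hn h1 hcard hC hL0 hwp hsm hvar hhet hβ0 hβ1 hγ0 hγL hT)
    (fun t ht => e.integral_norm_deviation_succ_le hδ hn h1 hcard hC hL0 hwp hsm hvar hhet hβ0 hβ1
      hγ0 hγL hβ ht)
    (fun t => mul_nonneg (by positivity) (integral_nonneg fun _ => sq_nonneg _)) hT

omit [IsProbabilityMeasure μ] [∀ i, IsProbabilityMeasure (D i)] hwp hvar hhet hβ0 hβ1 hγ0 hL0 in
/-- Descent of the average loss in one iteration. -/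
lemma avgLoss_step (hγ : 0 < γ) {t : ℕ} (ht : t < T) (ω : Ω) :
    γ / 2 * ‖e.avgGrad t ω‖ ^ 2
      + 11 / (24 * γ) * ‖e.avgModel (t + 1) ω - e.avgModel t ω‖ ^ 2 ≤
      avgLoss q D C (e.avgModel t ω) - avgLoss q D C (e.avgModel (t + 1) ω)
      + γ * ‖e.deviation t ω‖ ^ 2 + γ⁻¹ * (lam δ n f * e.partialSpread t ω) := by
  set b := e.avgModel (t + 1) ω - avg C (fun i => e.model t i ω - γ • e.momentum t i ω) with hb
  have hp : e.avgModel (t + 1) ω - e.avgModel t ω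
      = -(γ • (e.avgGrad t ω + e.deviation t ω)) + b := by
    rw [hb, avg_sub, avg_smul, deviation, avgModel, avgModel]
    module
  have hdesc := descent (differentiable_avgLoss hsm) (lipschitz_gradient_avgLoss hC hsm)
    (e.avgModel t ω) (e.avgModel (t + 1) ω - e.avgModel t ω)
  rw [add_sub_cancel] at hdesc
  refine (descent_step hγ hγL hp hdesc).trans ?_
  gcongr
  exact e.norm_avgModel_sub_sq_le hδ hn h1 hcard ht ω

/-- Expected squared gradients at the average models, summed over the iterations. -/
lemma sum_integral_norm_avgGrad_le (hγ : 0 < γ) {m : ℝ} (hm : ∀ θ, m ≤ avgLoss q D C θ) :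
    γ / 2 * ∑ t ∈ Finset.range T, ∫ ω, ‖e.avgGrad t ω‖ ^ 2 ∂μ
      + 11 / (24 * γ) *
        ∑ t ∈ Finset.range T, ∫ ω, ‖e.avgModel (t + 1) ω - e.avgModel t ω‖ ^ 2 ∂μ ≤
      avgLoss q D C θ₀ - m + γ * ∑ t ∈ Finset.range T, ∫ ω, ‖e.deviation t ω‖ ^ 2 ∂μ
      + T * (γ⁻¹ * (lam δ n f * spreadBound γ β σ ζ)) := by
  have i1 : ∀ t ∈ Finset.range T, Integrable (fun ω => ‖e.avgGrad t ω‖ ^ 2) μ := fun t ht =>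
    integrable_norm_sq (e.memLp_avgGrad hδ hn h1 hcard hL0 hwp hsm hvar hC
      (Finset.mem_range.1 ht).le)
  have i2 : ∀ t ∈ Finset.range T,
      Integrable (fun ω => ‖e.avgModel (t + 1) ω - e.avgModel t ω‖ ^ 2) μ := fun t ht =>
    integrable_norm_sq ((e.memLp_avgModel hδ hn h1 hcard hL0 hwp hsm hvar
      (Finset.mem_range.1 ht)).sub
      (e.memLp_avgModel hδ hn h1 hcard hL0 hwp hsm hvar (Finset.mem_range.1 ht).le))
  have i3 : ∀ t ∈ Finset.range T, Integrable (fun ω => ‖e.deviation t ω‖ ^ 2) μ := fun t ht =>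
    integrable_norm_sq (e.memLp_deviation hδ hn h1 hcard hL0 hwp hsm hvar hC
      (Finset.mem_range.1 ht))
  have i4 : ∀ t ∈ Finset.range T, Integrable (e.partialSpread t) μ := fun t ht =>
    e.integrable_partialSpread hδ hn h1 hcard hL0 hwp hsm hvar (Finset.mem_range.1 ht)
  have I1 := (integrable_finsetSum _ i1).const_mul (γ / 2)
  have I2 := (integrable_finsetSum _ i2).const_mul (11 / (24 * γ))
  have I3 := (integrable_finsetSum _ i3).const_mul γ
  have I4 := (integrable_finsetSum _ i4).const_mul (γ⁻¹ * lam δ n f)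
  have I0 : Integrable (fun _ : Ω => avgLoss q D C θ₀ - m) μ := integrable_const _
  have hpt : ∀ ω, γ / 2 * ∑ t ∈ Finset.range T, ‖e.avgGrad t ω‖ ^ 2
      + 11 / (24 * γ) * ∑ t ∈ Finset.range T, ‖e.avgModel (t + 1) ω - e.avgModel t ω‖ ^ 2 ≤
      avgLoss q D C θ₀ - m + γ * ∑ t ∈ Finset.range T, ‖e.deviation t ω‖ ^ 2
      + γ⁻¹ * lam δ n f * ∑ t ∈ Finset.range T, e.partialSpread t ω := fun ω => by
    have hsum := Finset.sum_le_sum fun t ht => e.avgLoss_step hδ hn h1 hcard hC hsm hγL hγ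
      (Finset.mem_range.1 ht) ω
    simp only [Finset.sum_add_distrib, ← Finset.mul_sum,
      Finset.sum_range_sub' (fun t => avgLoss q D C (e.avgModel t ω)), e.avgModel_zero hC] at hsum
    linarith [hm (e.avgModel T ω)]
  have hle := integral_mono (I1.add I2) ((I0.add I3).add I4) hpt
  rw [integral_add' I1 I2, integral_add' (I0.add I3) I4, integral_add' I0 I3, integral_const_mul,
    integral_const_mul, integral_const_mul, integral_const_mul, integral_const, probReal_univ,
    one_smul, integral_finsetSum _ i1, integral_finsetSum _ i2, integral_finsetSum _ i3,
    integral_finsetSum _ i4] at hle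
  refine hle.trans (add_le_add le_rfl ?_)
  have hlam : 0 ≤ lam δ n f := lam_nonneg δ (by have := two_mul_lt_of_le hδ hn h1; omega)
  calc _ ≤ γ⁻¹ * lam δ n f * ∑ _t ∈ Finset.range T, spreadBound γ β σ ζ := by
        gcongr with t ht
        exact e.integral_partialSpread_le hδ hn h1 hcard hC hL0 hwp hsm hvar hhet hβ0 hβ1 hγ0 hγL
          (Finset.mem_range.1 ht)
    _ = _ := by rw [Finset.sum_const, Finset.card_range, nsmul_eq_mul]; ring

end Execution

/-! ### Choice of learning rate and momentum, and the resulting constants -/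

section Constants

variable {δ : ℝ} {n f : ℕ}

lemma card_pos_of_le (hδ : 0 < δ) (hn : (5 + δ) * f ≤ n) (h1 : 1 ≤ n) : 0 < (n : ℝ) - f := by
  have h2 := two_mul_lt_of_le hδ hn h1
  have : (f : ℝ) < n := by exact_mod_cast (by omega : f < n)
  linarith

lemma c1_nonneg (hf : f ≤ n) : 0 ≤ c1 n f := by
  have := alpha_nonneg hf
  rw [c1]; positivity

lemma alpha_sq_le_c1 (hδ : 0 < δ) (hn : (5 + δ) * f ≤ n) (h1 : 1 ≤ n) :
    alpha n f ^ 2 ≤ c1 n f := by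
  have h0 := alpha_nonneg (n := n) (f := f) (by have := two_mul_lt_of_le hδ hn h1; omega)
  have h2 := alpha_le_half hδ hn h1
  rw [c1, le_div_iff₀ (by nlinarith)]
  have h3 : (1 - alpha n f) ^ 2 ≤ 1 := by nlinarith
  calc alpha n f ^ 2 * (1 - alpha n f) ^ 2 ≤ alpha n f ^ 2 * 1 := by gcongr
    _ ≤ _ := by nlinarith

lemma c2_pos (hδ : 0 < δ) (hn : (5 + δ) * f ≤ n) (h1 : 1 ≤ n) : 0 < c2 δ n f := by
  have hf : f ≤ n := by have := two_mul_lt_of_le hδ hn h1; omega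
  have h2 := c1_nonneg hf
  have h3 := lam_nonneg δ hf
  have h4 := card_pos_of_le hδ hn h1
  rw [c2]; positivity

lemma c3_nonneg (hf : f ≤ n) : 0 ≤ c3 δ n f := by
  have h2 := c1_nonneg hf
  have h3 := lam_nonneg δ hf
  rw [c3]; positivity

lemma errorBound_nonneg (hδ : 0 < δ) (hn : (5 + δ) * f ≤ n) (h1 : 1 ≤ n) {L σ ζ c0 : ℝ}
    (hL : 0 < L) (hc0 : 0 ≤ c0) (T : ℕ) : 0 ≤ errorBound δ n f L σ ζ c0 T := by
  have hf : f ≤ n := by have := two_mul_lt_of_le hδ hn h1; omega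
  have h2 := c1_nonneg hf
  have h3 := c3_nonneg (δ := δ) hf
  have h4 := card_pos_of_le hδ hn h1
  rw [errorBound]; positivity

lemma learningRate_le (δ : ℝ) (n f : ℕ) (L σ c0 : ℝ) (T : ℕ) :
    learningRate δ n f L σ c0 T ≤ 1 / (12 * L) := min_le_left _ _

lemma learningRate_pos (hδ : 0 < δ) (hn : (5 + δ) * f ≤ n) (h1 : 1 ≤ n) {L σ c0 : ℝ}
    (hL : 0 < L) {T : ℕ} (hT : 1 ≤ T) (h : σ = 0 ∨ 0 < c0) : 0 < learningRate δ n f L σ c0 T := by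
  have hf : f ≤ n := by have := two_mul_lt_of_le hδ hn h1; omega
  have hc1 := c1_nonneg hf
  have hc2 := c2_pos hδ hn h1
  have hT' : (0 : ℝ) < T := by exact_mod_cast hT
  rw [learningRate]
  refine lt_min (by positivity) (lt_min ?_ ?_)
  · split_ifs with hc
    · positivity
    · have : 0 < c1 n f := lt_of_le_of_ne hc1 (Ne.symm hc)
      positivity
  · split_ifs with hc
    · positivity
    · have := h.resolve_left hc
      have : 0 < σ ^ 2 := by positivity
      positivity

/-- The degenerate case of a noisy run that starts at a minimizer, where division by the learning
rate is not available. -/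
lemma learningRate_eq_zero {L σ c0 : ℝ} (hL : 0 < L) (T : ℕ) (hσ : σ ≠ 0) (hc0 : c0 = 0) :
    learningRate δ n f L σ c0 T = 0 := by
  rw [learningRate, if_neg hσ, hc0, zero_div, Real.sqrt_zero,
    min_eq_right (a := if c1 n f = 0 then _ else _), min_eq_right (by positivity)]
  split_ifs <;> positivity

/-- Effect of the learning rate on the two terms of the error that it balances. -/
lemma learningRate_tradeoff (hδ : 0 < δ) (hn : (5 + δ) * f ≤ n) (h1 : 1 ≤ n) {L σ c0 : ℝ}
    (hL : 0 < L) (hc0 : 0 ≤ c0) {T : ℕ} (hT : 1 ≤ T) (h : σ = 0 ∨ 0 < c0) :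
    c0 / (learningRate δ n f L σ c0 T * T)
      + c2 δ n f * (learningRate δ n f L σ c0 T * L * σ ^ 2) ≤
      2 * √(c0 * c2 δ n f * L * σ ^ 2 / T) + 12 * L * c0 / T
        + L * c0 / T * √(3 * c1 n f / 2) := by
  have hf : f ≤ n := by have := two_mul_lt_of_le hδ hn h1; omega
  have hc1 := c1_nonneg hf
  have hc2 := c2_pos hδ hn h1
  have hT' : (0 : ℝ) < T := by exact_mod_cast hT
  have hγ := learningRate_pos hδ hn h1 hL hT h
  set γ := learningRate δ n f L σ c0 T with hγdef
  have p1 : 0 ≤ √(c0 * c2 δ n f * L * σ ^ 2 / T) := Real.sqrt_nonneg _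
  have p2 : 0 ≤ 12 * L * c0 / T := by positivity
  have p3 : 0 ≤ L * c0 / T * √(3 * c1 n f / 2) := by positivity
  -- Only the third term of the minimum matters here; it balances this contribution against `c0 / (γ
  -- T)`.
  have hnoise : c2 δ n f * (γ * L * σ ^ 2) ≤ √(c0 * c2 δ n f * L * σ ^ 2 / T) := by
    by_cases hσ : σ = 0
    · rw [hσ]; simp
    have hσ2 : 0 < σ ^ 2 := by positivity
    have hle : γ ≤ √(c0 / (c2 δ n f * L * T * σ ^ 2)) := by
      rw [hγdef, learningRate, if_neg hσ]
      exact (min_le_right _ _).trans (min_le_right _ _)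
    refine Real.le_sqrt_of_sq_le ?_
    have hsq : γ ^ 2 ≤ c0 / (c2 δ n f * L * T * σ ^ 2) := by
      rw [← Real.sq_sqrt (by positivity : 0 ≤ c0 / (c2 δ n f * L * T * σ ^ 2))]
      gcongr
    calc (c2 δ n f * (γ * L * σ ^ 2)) ^ 2 = (c2 δ n f * L * σ ^ 2) ^ 2 * γ ^ 2 := by ring
      _ ≤ (c2 δ n f * L * σ ^ 2) ^ 2 * (c0 / (c2 δ n f * L * T * σ ^ 2)) := by gcongr
      _ = _ := by field_simp
  -- The minimum equals one of its three terms, and each yields one summand on the right. An absent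
  -- term has the default value `1 / (12 L)` and falls under the first case.
  have hmain : c0 / (γ * T) ≤ √(c0 * c2 δ n f * L * σ ^ 2 / T) + 12 * L * c0 / T
      + L * c0 / T * √(3 * c1 n f / 2) := by
    have hcase : γ = 1 / (12 * L) ∨ (c1 n f ≠ 0 ∧ γ = 1 / L * √(2 / (3 * c1 n f))) ∨
        (σ ≠ 0 ∧ γ = √(c0 / (c2 δ n f * L * T * σ ^ 2))) := by
      rw [hγdef, learningRate]
      rcases min_choice (1 / (12 * L)) (min (if c1 n f = 0 then 1 / (12 * L) else
        1 / L * √(2 / (3 * c1 n f))) (if σ = 0 then 1 / (12 * L) else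
        √(c0 / (c2 δ n f * L * T * σ ^ 2)))) with h | h
      · exact Or.inl h
      rw [h]
      rcases min_choice (if c1 n f = 0 then 1 / (12 * L) else 1 / L * √(2 / (3 * c1 n f)))
        (if σ = 0 then 1 / (12 * L) else √(c0 / (c2 δ n f * L * T * σ ^ 2))) with h | h
      · rw [h]
        split_ifs with hc
        · exact Or.inl rfl
        · exact Or.inr (Or.inl ⟨hc, rfl⟩)
      · rw [h]
        split_ifs with hc
        · exact Or.inl rfl
        · exact Or.inr (Or.inr ⟨hc, rfl⟩)
    rcases hcase with hc | ⟨hc, hc'⟩ | ⟨hσ, hc⟩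
    · have : c0 / (γ * T) = 12 * L * c0 / T := by rw [hc]; field_simp
      linarith
    · have hc1' : 0 < c1 n f := lt_of_le_of_ne hc1 (Ne.symm hc)
      have hinv : √(3 * c1 n f / 2) = (√(2 / (3 * c1 n f)))⁻¹ := by
        rw [← Real.sqrt_inv, inv_div]
      have hs : 0 < √(2 / (3 * c1 n f)) := by positivity
      have : c0 / (γ * T) = L * c0 / T * √(3 * c1 n f / 2) := by
        rw [hc', hinv]; field_simp
      linarith
    · have hc0' := h.resolve_left hσ
      have hσ2 : 0 < σ ^ 2 := by positivity
      have hγ2 : γ ^ 2 = c0 / (c2 δ n f * L * T * σ ^ 2) := by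
        rw [hc, Real.sq_sqrt (by positivity)]
      have : c0 / (γ * T) ≤ √(c0 * c2 δ n f * L * σ ^ 2 / T) := by
        refine Real.le_sqrt_of_sq_le (le_of_eq ?_)
        rw [div_pow, mul_pow, hγ2]
        field_simp
      linarith
  linarith

/-- From `(1 - β) (1 + β) = 12 γ L` and `1 ≤ 1 + β ≤ 2`. -/
lemma momentumCoeff_bounds {γ L : ℝ} (hγL0 : 0 ≤ γ * L) (hγL : γ * L ≤ 1 / 12) :
    0 ≤ momentumCoeff γ L ∧ momentumCoeff γ L ≤ 1 ∧ 6 * (γ * L) ≤ 1 - momentumCoeff γ L ∧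
      1 - momentumCoeff γ L ≤ 12 * (γ * L) := by
  have h0 : 0 ≤ momentumCoeff γ L := Real.sqrt_nonneg _
  have hsq : momentumCoeff γ L ^ 2 = 1 - 12 * γ * L := Real.sq_sqrt (by linarith)
  have h1 : momentumCoeff γ L ≤ 1 := by nlinarith
  exact ⟨h0, h1, by nlinarith, by nlinarith⟩

/-- Elimination of the deviation of the momentum. -/
lemma combine_bounds {A P V γ L u β G q₀ R E s N : ℝ} (hγ : 0 < γ) (hL : 0 < L)
    (hu : 6 * (γ * L) ≤ u) (hu' : u ≤ 12 * (γ * L)) (hβ : β ≤ 1) (hG0 : 0 ≤ G)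
    (hG : G ≤ 2 * L * q₀) (hP : 0 ≤ P) (hN : 0 ≤ N) (hs : 0 ≤ s)
    (h1 : u * V ≤ β * G + 2 * L ^ 2 / u * P + N * (2 * u * R + u ^ 2 * s))
    (h2 : γ / 2 * A + 11 / (24 * γ) * P ≤ q₀ + γ * V + N * (γ⁻¹ * E)) :
    2 * A ≤ 16 / 3 * (q₀ / γ) + N * (4 * (E / γ ^ 2) + 8 * R + 48 * (γ * L) * s) := by
  have hγL : 0 < γ * L := by positivity
  have hu0 : 0 < u := by linarith
  have e1 : β * G ≤ 2 * L * q₀ := by nlinarith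
  have hq : 0 ≤ 2 * L * q₀ := hG0.trans hG
  -- The deviation inequality is multiplied by `γ / u`, and `u ≥ 6 γ L` bounds each term.
  have b1 : 2 * L * q₀ * (γ / u) ≤ q₀ / 3 := by
    have : γ / u ≤ 1 / (6 * L) := by
      rw [div_le_div_iff₀ hu0 (by positivity)]; linarith
    calc _ ≤ 2 * L * q₀ * (1 / (6 * L)) := by gcongr
      _ = _ := by field_simp; ring
  -- The choice of `β` pays off here: the squared steps enter with coefficient at most `1 / (18 γ)`,
  -- less than the `11 / (24 γ)` that descent makes available.
  have b2 : 2 * L ^ 2 / u * P * (γ / u) ≤ 1 / (18 * γ) * P := by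
    have h3 : (L / u) ^ 2 ≤ (1 / (6 * γ)) ^ 2 := by
      have : L / u ≤ 1 / (6 * γ) := by
        rw [div_le_div_iff₀ hu0 (by positivity)]; linarith
      gcongr
    calc _ = 2 * γ * P * (L / u) ^ 2 := by field_simp
      _ ≤ 2 * γ * P * (1 / (6 * γ)) ^ 2 := by gcongr
      _ = _ := by field_simp; ring
  have b3 : N * (2 * u * R + u ^ 2 * s) * (γ / u) ≤ N * (γ * (2 * R + 12 * (γ * L) * s)) := by
    calc _ = N * (γ * (2 * R + u * s)) := by field_simp
      _ ≤ _ := by gcongr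
  have hV : γ * V ≤ q₀ / 3 + 1 / (18 * γ) * P + N * (γ * (2 * R + 12 * (γ * L) * s)) := by
    have h3 : u * V * (γ / u) ≤
        (2 * L * q₀ + 2 * L ^ 2 / u * P + N * (2 * u * R + u ^ 2 * s)) * (γ / u) := by
      gcongr; linarith
    have h4 : u * V * (γ / u) = γ * V := by field_simp
    rw [h4] at h3
    linarith
  have hP2 : 1 / (18 * γ) * P ≤ 11 / (24 * γ) * P := by
    gcongr ?_ * _
    rw [div_le_div_iff₀ (by positivity) (by positivity)]
    linarith
  have hA : γ / 2 * A ≤ 4 / 3 * q₀ + N * (γ⁻¹ * E) + N * (γ * (2 * R + 12 * (γ * L) * s)) := by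
    linarith
  calc 2 * A = 4 / γ * (γ / 2 * A) := by field_simp; ring
    _ ≤ 4 / γ * (4 / 3 * q₀ + N * (γ⁻¹ * E) + N * (γ * (2 * R + 12 * (γ * L) * s))) := by gcongr
    _ = _ := by field_simp; ring

/-- The error terms are covered by the constants of the bound. -/
lemma error_terms_le (hδ : 0 < δ) (hn : (5 + δ) * f ≤ n) (h1 : 1 ≤ n) {γ L β σ ζ : ℝ}
    (hγ : 0 < γ) (hL : 0 < L) (hγL : γ * L ≤ 1 / 12) (hβ : β ≤ 1) (hu : 1 - β ≤ 12 * (γ * L)) :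
    4 * (lam δ n f * Execution.spreadBound γ β σ ζ / γ ^ 2)
      + 10 * (L ^ 2 * (alpha n f ^ 2 * Execution.spreadBound γ β σ ζ))
      + 48 * (γ * L) * (σ ^ 2 / ((n : ℝ) - f)) ≤
      c2 δ n f * (γ * L * σ ^ 2) + c3 δ n f * ζ ^ 2 := by
  have hf : f ≤ n := by have := two_mul_lt_of_le hδ hn h1; omega
  have hc1 := c1_nonneg hf
  have hlam := lam_nonneg δ hf
  have hh := card_pos_of_le hδ hn h1
  have hα := alpha_sq_le_c1 hδ hn h1
  have hu0 : 0 ≤ 1 - β := by linarith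
  have hW : (1 - β) * σ ^ 2 + 2 * ζ ^ 2 ≤ 12 * (γ * L * σ ^ 2) + 2 * ζ ^ 2 := by
    have := mul_le_mul_of_nonneg_right hu (sq_nonneg σ)
    linarith
  have hW0 : 0 ≤ (1 - β) * σ ^ 2 + 2 * ζ ^ 2 := by positivity
  set W := (1 - β) * σ ^ 2 + 2 * ζ ^ 2
  set y := γ * L * σ ^ 2 with hy
  have hy0 : 0 ≤ y := by positivity
  have t1 : 4 * (lam δ n f * Execution.spreadBound γ β σ ζ / γ ^ 2) ≤
      20 * (lam δ n f * (12 * y + 2 * ζ ^ 2)) := by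
    calc _ = 20 * (lam δ n f * W) := by rw [Execution.spreadBound]; field_simp; ring
      _ ≤ _ := by gcongr
  have t2 : 10 * (L ^ 2 * (alpha n f ^ 2 * Execution.spreadBound γ β σ ζ)) ≤
      c1 n f * (12 * y + 2 * ζ ^ 2) := by
    have hsq : (γ * L) ^ 2 ≤ 1 / 144 := by nlinarith [mul_pos hγ hL]
    calc _ = 50 * (γ * L) ^ 2 * (alpha n f ^ 2 * W) := by rw [Execution.spreadBound]; ring
      _ ≤ 50 * (1 / 144) * (c1 n f * (12 * y + 2 * ζ ^ 2)) := by gcongr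
      _ ≤ _ := by
        have : 0 ≤ c1 n f * (12 * y + 2 * ζ ^ 2) := by positivity
        linarith
  have t3 : 48 * (γ * L) * (σ ^ 2 / ((n : ℝ) - f)) = 16 * (3 / ((n : ℝ) - f)) * y := by
    rw [hy]; field_simp; ring
  have p1 : 0 ≤ 3 / ((n : ℝ) - f) * y := by positivity
  have p2 : 0 ≤ c1 n f * y := by positivity
  have p3 : 0 ≤ lam δ n f * y := by positivity
  have p4 : 0 ≤ lam δ n f * c1 n f * y := by positivity
  have p5 : 0 ≤ c1 n f * ζ ^ 2 := by positivity
  have p6 : 0 ≤ lam δ n f * ζ ^ 2 := by positivity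
  have p7 : 0 ≤ lam δ n f * c1 n f * ζ ^ 2 := by positivity
  rw [t3, c2, c3]
  nlinarith

end Constants

/-! ### From the average model to the returned model -/

namespace Execution

variable {n d : ℕ} {Ω X : Type*} [mΩ : MeasurableSpace Ω] [MeasurableSpace X] {μ : Measure Ω}
  {q : Param d → X → ℝ} {D : Fin n → Measure X}
  {C : Finset (Fin n)} {f : ℕ} {θ₀ : Param d} {γ β δ L σ ζ : ℝ} {T : ℕ}
  [IsProbabilityMeasure μ] [∀ i, IsProbabilityMeasure (D i)]

/-- A local gradient is compared with the gradient at the average model. This costs a factor 2 and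
twice `L²` times the squared distance of the models; with the 8 from `combine_bounds` it makes the
10 in `error_terms_le`. -/
lemma sum_integral_norm_gradient_le (e : Execution μ q D C f θ₀ γ β (rounds δ n f) T)
    (hδ : 0 < δ) (hn : (5 + δ) * f ≤ n) (h1 : 1 ≤ n) (hcard : C.card = n - f)
    (hL : 0 < L) (hwp : IsWellPosed q D C) (hsm : IsLipschitzSmooth q D C L)
    (hvar : HasBoundedVariance q D C σ) (hhet : IsHeterogeneous q D C ζ)
    (hγ : 0 < γ) (hγL : γ * L ≤ 1 / 12) (hβ : β = momentumCoeff γ L) (hT : 1 ≤ T)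
    {m : ℝ} (hm : ∀ θ, m ≤ avgLoss q D C θ) {i : Fin n} (hi : i ∈ C) :
    ∑ t ∈ Finset.range T, ∫ ω, ‖gradient (avgLoss q D C) (e.model t i ω)‖ ^ 2 ∂μ ≤
      T * (12 * (avgLoss q D C θ₀ - m) / (γ * T) + c2 δ n f * (γ * L * σ ^ 2)
        + c3 δ n f * ζ ^ 2) := by
  have hC : C.Nonempty := ⟨i, hi⟩
  have hγL0 : 0 < γ * L := by positivity
  have hT' : (0 : ℝ) < T := by exact_mod_cast hT
  obtain ⟨hβ0, hβ1, hu, hu'⟩ := momentumCoeff_bounds hγL0.le hγL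
  rw [← hβ] at hβ0 hβ1 hu hu'
  have hcc : (C.card : ℝ) = (n : ℝ) - f := by
    rw [hcard, Nat.cast_sub (by have := two_mul_lt_of_le hδ hn h1; omega)]
  have hh := card_pos_of_le hδ hn h1
  have hlip := lipschitz_gradient_avgLoss hC hsm
  have hterm : ∀ t ∈ Finset.range T,
      ∫ ω, ‖gradient (avgLoss q D C) (e.model t i ω)‖ ^ 2 ∂μ ≤
      2 * ∫ ω, ‖e.avgGrad t ω‖ ^ 2 ∂μ
        + 2 * (L ^ 2 * (alpha n f ^ 2 * spreadBound γ β σ ζ)) := by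
    intro t ht
    have ht := Finset.mem_range.1 ht
    have i0 := integrable_norm_sq (memLp_of_lipschitz (continuous_gradient_avgLoss hsm hL.le hC) hlip
      (e.memLp_model hδ hn h1 hcard hL.le hwp hsm hvar ht.le hi))
    have i1 := (integrable_norm_sq
      (e.memLp_avgGrad hδ hn h1 hcard hL.le hwp hsm hvar hC ht.le)).const_mul 2
    have i2 : Integrable (fun ω => 2 * L ^ 2 * ‖e.model t i ω - e.avgModel t ω‖ ^ 2) μ :=
      (integrable_norm_sq ((e.memLp_model hδ hn h1 hcard hL.le hwp hsm hvar ht.le hi).sub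
        (e.memLp_avgModel hδ hn h1 hcard hL.le hwp hsm hvar ht.le))).const_mul _
    have hpt : ∀ ω, ‖gradient (avgLoss q D C) (e.model t i ω)‖ ^ 2 ≤ 2 * ‖e.avgGrad t ω‖ ^ 2
        + 2 * L ^ 2 * ‖e.model t i ω - e.avgModel t ω‖ ^ 2 := fun ω => by
      have h2 := norm_add_sq_le_two (e.avgGrad t ω)
        (gradient (avgLoss q D C) (e.model t i ω) - e.avgGrad t ω)
      rw [add_sub_cancel] at h2
      have h3 : ‖gradient (avgLoss q D C) (e.model t i ω) - e.avgGrad t ω‖ ^ 2 ≤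
          (L * ‖e.model t i ω - e.avgModel t ω‖) ^ 2 := by
        gcongr
        exact hlip _ _
      rw [mul_pow] at h3
      linarith
    have hle := integral_mono i0 (i1.add i2) hpt
    rw [integral_add' i1 i2, integral_const_mul, integral_const_mul] at hle
    refine hle.trans ?_
    rw [← mul_assoc 2 (L ^ 2)]
    gcongr
    exact e.integral_norm_model_sub_sq_le hδ hn h1 hcard hC hL.le hwp hsm hvar hhet hβ0 hβ1 hγ.le
      hγL ht hi
  have hsum := Finset.sum_le_sum hterm
  rw [Finset.sum_add_distrib, ← Finset.mul_sum, Finset.sum_const, Finset.card_range,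
    nsmul_eq_mul] at hsum
  have hcomb := combine_bounds hγ hL hu hu' hβ1 (sq_nonneg _)
    (norm_gradient_sq_le (differentiable_avgLoss hsm) hL hlip hm θ₀)
    (Finset.sum_nonneg fun t _ => integral_nonneg fun _ => sq_nonneg _) hT'.le
    (by positivity : 0 ≤ σ ^ 2 / (C.card : ℝ))
    (e.sum_integral_norm_deviation_le hδ hn h1 hcard hC hL.le hwp hsm hvar hhet hβ0 hβ1 hγ.le hγL
      (by linarith) hT)
    (e.sum_integral_norm_avgGrad_le hδ hn h1 hcard hC hL.le hwp hsm hvar hhet hβ0 hβ1 hγ.le hγL hγ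
      hm)
  have herr := error_terms_le hδ hn h1 (σ := σ) (ζ := ζ) hγ hL hγL hβ1 hu'
  rw [← hcc] at herr
  have hq : 0 ≤ avgLoss q D C θ₀ - m := by linarith [hm θ₀]
  have hq' : 16 / 3 * ((avgLoss q D C θ₀ - m) / γ) ≤
      T * (12 * (avgLoss q D C θ₀ - m) / (γ * T)) := by
    have e1 : T * (12 * (avgLoss q D C θ₀ - m) / (γ * T)) = 12 * ((avgLoss q D C θ₀ - m) / γ) := by
      field_simp
    rw [e1]
    gcongr
    norm_num
  have herr' := mul_le_mul_of_nonneg_left herr hT'.le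
  linarith

/-- Without learning, all models stay at the initial model. -/
lemma model_eq_of_learningRate_eq_zero {K : ℕ} (hK : K = rounds δ n f)
    (e : Execution μ q D C f θ₀ γ β K T)
    (hδ : 0 < δ) (hn : (5 + δ) * f ≤ n) (h1 : 1 ≤ n) (hcard : C.card = n - f) (hγ : γ = 0)
    {t : ℕ} (ht : t ≤ T) (ω : Ω) : ∀ i ∈ C, e.model t i ω = θ₀ := by
  subst hK
  induction t with
  | zero => exact fun i hi => e.model_zero i hi ω
  | succ t ih =>
    intro i hi
    have hC : C.Nonempty := ⟨i, hi⟩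
    have ht' : t < T := ht
    have hz : ∀ j ∈ C, e.model t j ω - γ • e.momentum t j ω = θ₀ := fun j hj => by
      rw [smul_eq_zero.mpr (Or.inl hγ), sub_zero, ih ht'.le j hj]
    have havg : avg C (fun j => e.model t j ω - γ • e.momentum t j ω) = θ₀ := by
      rw [avg_congr hz, avg_const hC]
    have hS : e.partialSpread t ω = 0 := by
      rw [partialSpread, spread_congr hz, spread, avg_const hC]
      simp
    have a1 := e.norm_model_sub_avgModel_sq_le hδ hn h1 hcard ht' ω hi
    have a2 := e.norm_avgModel_sub_sq_le hδ hn h1 hcard ht' ω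
    rw [hS, mul_zero] at a1 a2
    rw [havg] at a2
    have b1 := pow_eq_zero_iff two_ne_zero |>.1 (le_antisymm a1 (sq_nonneg _))
    have b2 := pow_eq_zero_iff two_ne_zero |>.1 (le_antisymm a2 (sq_nonneg _))
    rw [norm_eq_zero, sub_eq_zero] at b1 b2
    rw [b1, b2]

/-- Expectation of a function of the returned model. -/
lemma integral_output {K : ℕ} (e : Execution μ q D C f θ₀ γ β K T) {i : Fin n} (hi : i ∈ C)
    {F : Param d → ℝ} (hF : Measurable F)
    (hint : ∀ t < T, Integrable (fun ω => F (e.model t i ω)) μ) :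
    Integrable (fun ω => F (e.output i ω)) μ ∧
      ∫ ω, F (e.output i ω) ∂μ =
        1 / T * ∑ t ∈ Finset.range T, ∫ ω, F (e.model t i ω) ∂μ := by
  classical
  -- The output is decomposed by indicators of the returned index. Each factors out of the
  -- expectation, since all models up to iteration `T` are determined by `hist T`, of which the
  -- index is independent.
  set g : Fin T → Fin T → ℝ := fun s r => if r = s then 1 else 0 with hg
  have hgm : ∀ s, Measurable (g s) := fun s => measurable_of_finite _
  have hexp : ∀ ω, F (e.output i ω) = ∑ s : Fin T, g s (e.idx i ω) * F (e.model s i ω) :=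
    fun ω => by simp [hg, output]
  have hind : ∀ s : Fin T, IndepFun (fun ω => g s (e.idx i ω)) (fun ω => F (e.model s i ω)) μ := by
    intro s
    have h1 : Measurable[e.hist T] (fun ω => F (e.model s i ω)) :=
      hF.comp ((e.model_measurable s s.2.le i hi).mono (e.hist.mono s.2.le) le_rfl)
    have h2 : IndepFun (e.idx i) (fun ω => F (e.model s i ω)) μ := by
      rw [IndepFun_iff_Indep]
      exact indep_of_indep_of_le_right (e.idx_indep i hi) h1.comap_le
    exact h2.comp (hgm s) measurable_id
  have hgi : ∀ s : Fin T, Integrable (fun ω => g s (e.idx i ω)) μ := fun s => by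
    refine Integrable.of_bound ((hgm s).comp (e.idx_measurable i hi)).aestronglyMeasurable 1
      (ae_of_all _ fun ω => ?_)
    simp only [hg]
    split_ifs <;> simp
  have hgint : ∀ s : Fin T, ∫ ω, g s (e.idx i ω) ∂μ = 1 / T := fun s => by
    rw [← e.idx_uniform i hi s]
    have hms : MeasurableSet {ω | e.idx i ω = s} :=
      e.idx_measurable i hi (measurableSet_singleton s)
    rw [← integral_indicator_one hms]
    refine integral_congr_ae (ae_of_all _ fun ω => ?_)
    simp [hg, Set.indicator_apply]
  have hprod : ∀ s ∈ (Finset.univ : Finset (Fin T)),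
      Integrable (fun ω => g s (e.idx i ω) * F (e.model s i ω)) μ :=
    fun s _ => (hind s).integrable_mul (hgi s) (hint s s.2)
  simp_rw [hexp]
  refine ⟨integrable_finsetSum _ hprod, ?_⟩
  rw [integral_finsetSum _ hprod, Finset.mul_sum,
    ← Fin.sum_univ_eq_sum_range (fun t => 1 / (T : ℝ) * ∫ ω, F (e.model t i ω) ∂μ)]
  refine Finset.sum_congr rfl fun s _ => ?_
  rw [← hgint s]
  exact (hind s).integral_fun_mul_eq_mul_integral (hgi s).1 (hint s s.2).1

/-- The convergence bound. -/
lemma integral_norm_gradient_output_le {c0 : ℝ}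
    (e : Execution μ q D C f θ₀ γ β (rounds δ n f) T)
    (hδ : 0 < δ) (hn : (5 + δ) * f ≤ n) (hcard : C.card = n - f) (hT : 1 ≤ T)
    (hL : 0 < L) (hwp : IsWellPosed q D C) (hsm : IsLipschitzSmooth q D C L)
    (hvar : HasBoundedVariance q D C σ) (hhet : IsHeterogeneous q D C ζ)
    (hbdd : BddBelow (Set.range (avgLoss q D C)))
    (hc0 : c0 = 12 * (avgLoss q D C θ₀ - optValue q D C))
    (hγ : γ = learningRate δ n f L σ c0 T) (hβ : β = momentumCoeff γ L) {i : Fin n} (hi : i ∈ C) :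
    Integrable (fun ω => ‖gradient (avgLoss q D C) (e.output i ω)‖ ^ 2) μ ∧
      ∫ ω, ‖gradient (avgLoss q D C) (e.output i ω)‖ ^ 2 ∂μ ≤ errorBound δ n f L σ ζ c0 T := by
  have hC : C.Nonempty := ⟨i, hi⟩
  have h1 : 1 ≤ n := by have := i.2; omega
  have hT' : (0 : ℝ) < T := by exact_mod_cast hT
  have hh := card_pos_of_le hδ hn h1
  have hm : ∀ θ, optValue q D C ≤ avgLoss q D C θ := fun θ => ciInf_le hbdd θ
  have hc0' : 0 ≤ c0 := by rw [hc0]; linarith [hm θ₀]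
  have hcont := continuous_gradient_avgLoss hsm hL.le hC
  have hlip := lipschitz_gradient_avgLoss hC hsm
  obtain ⟨hint, heq⟩ := e.integral_output hi (F := fun θ => ‖gradient (avgLoss q D C) θ‖ ^ 2)
    (hcont.norm.pow 2).measurable fun t ht => integrable_norm_sq (memLp_of_lipschitz hcont hlip
      (e.memLp_model hδ hn h1 hcard hL.le hwp hsm hvar ht.le hi))
  refine ⟨hint, ?_⟩
  rw [heq]
  by_cases hcase : σ = 0 ∨ 0 < c0
  · have hγpos : 0 < γ := hγ ▸ learningRate_pos hδ hn h1 hL hT hcase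
    have hγL : γ * L ≤ 1 / 12 := by
      have h2 := learningRate_le δ n f L σ c0 T
      rw [← hγ, le_div_iff₀ (by positivity)] at h2
      linarith
    have hsum := e.sum_integral_norm_gradient_le hδ hn h1 hcard hL hwp hsm hvar hhet hγpos hγL hβ hT
      hm hi
    rw [← hc0] at hsum
    have htr := learningRate_tradeoff hδ hn h1 hL hc0' hT hcase
    rw [← hγ] at htr
    -- This term of the bound is slack: `learningRate_tradeoff` and the `ζ` term already suffice.
    have hpos : 0 ≤ 36 / T * (σ ^ 2 / ((n : ℝ) - f)) := by positivity
    rw [one_div, inv_mul_le_iff₀ hT']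
    refine hsum.trans ?_
    gcongr
    rw [errorBound]
    linarith
  · push Not at hcase
    obtain ⟨hσ, hle⟩ := hcase
    have hz : c0 = 0 := le_antisymm hle hc0'
    have hγ0 : γ = 0 := hγ.trans (learningRate_eq_zero hL T hσ hz)
    -- The initial model attains the infimum, hence is stationary.
    have hgrad : ‖gradient (avgLoss q D C) θ₀‖ ^ 2 = 0 := by
      have h2 := norm_gradient_sq_le (differentiable_avgLoss hsm) hL hlip hm θ₀
      have h3 : avgLoss q D C θ₀ - optValue q D C = 0 := by linarith
      rw [h3, mul_zero] at h2
      exact le_antisymm h2 (sq_nonneg _)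
    have hzero : ∑ t ∈ Finset.range T,
        ∫ ω, ‖gradient (avgLoss q D C) (e.model t i ω)‖ ^ 2 ∂μ = 0 := by
      refine Finset.sum_eq_zero fun t ht => ?_
      refine integral_eq_zero_of_ae (ae_of_all _ fun ω => ?_)
      simp only [Pi.zero_apply]
      rw [e.model_eq_of_learningRate_eq_zero rfl hδ hn h1 hcard hγ0 (Finset.mem_range.1 ht).le ω i
        hi, hgrad]
    rw [hzero, mul_zero]
    exact errorBound_nonneg hδ hn h1 hL hc0' T

end Execution

/-! ### Orders of magnitude of the constants -/

section Asymptotics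

variable {δ : ℝ} {n f : ℕ}

/-- The number of coordination rounds is logarithmic in the number of nodes. -/
lemma rounds_le (hδ : 0 < δ) (h2 : 2 ≤ n) (hn : (5 + δ) * f ≤ n) :
    (rounds δ n f : ℝ) ≤
      (4 / (2 * Real.log ((3 + δ) / 3)) + 2 / Real.log 2) * Real.log n := by
  have hlog : 0 < Real.log ((3 + δ) / 3) := Real.log_pos (by rw [lt_div_iff₀] <;> linarith)
  have hf := two_mul_lt_of_le hδ hn (by omega)
  have h1 : (1 : ℝ) ≤ (n : ℝ) - f := by
    have : ((f + 1 : ℕ) : ℝ) ≤ n := by exact_mod_cast (by omega : f + 1 ≤ n)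
    push_cast at this
    linarith
  have hn2 : (2 : ℝ) ≤ n := by exact_mod_cast h2
  have hlog2 : 0 < Real.log 2 := Real.log_pos one_lt_two
  have hlogn : Real.log 2 ≤ Real.log n := Real.log_le_log two_pos hn2
  have hnum : Real.log (8 * ((n : ℝ) - f)) ≤ 4 * Real.log n := by
    have h3 : 8 * ((n : ℝ) - f) ≤ (n : ℝ) ^ 4 := by
      have h8 : (2 : ℝ) ^ 3 ≤ (n : ℝ) ^ 3 := by gcongr
      have hf0 : (0 : ℝ) ≤ f := Nat.cast_nonneg f
      calc 8 * ((n : ℝ) - f) ≤ 2 ^ 3 * n := by linarith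
        _ ≤ (n : ℝ) ^ 3 * n := by gcongr
        _ = _ := by ring
    calc _ ≤ Real.log ((n : ℝ) ^ 4) := Real.log_le_log (by linarith) h3
      _ = _ := by rw [Real.log_pow]; norm_num
  have hnum0 : 0 ≤ Real.log (8 * ((n : ℝ) - f)) := Real.log_nonneg (by linarith)
  have hceil := Nat.ceil_lt_add_one
    (a := Real.log (8 * ((n : ℝ) - f)) / (2 * Real.log ((3 + δ) / 3))) (by positivity)
  have hdiv : Real.log (8 * ((n : ℝ) - f)) / (2 * Real.log ((3 + δ) / 3)) ≤
      4 * Real.log n / (2 * Real.log ((3 + δ) / 3)) := by gcongr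
  -- The rounding up and the additional round contribute at most 2, which is absorbed into a
  -- multiple of `log n` because `n ≥ 2`.
  have htwo : 2 ≤ 2 / Real.log 2 * Real.log n := by
    rw [div_mul_eq_mul_div, le_div_iff₀ hlog2]; linarith
  rw [rounds]
  push_cast
  calc _ ≤ 4 * Real.log n / (2 * Real.log ((3 + δ) / 3)) + 2 := by linarith
    _ ≤ 4 * Real.log n / (2 * Real.log ((3 + δ) / 3)) + 2 / Real.log 2 * Real.log n := by linarith
    _ = _ := by ring

lemma inv_card_le (hδ : 0 < δ) (hn : (5 + δ) * f ≤ n) (h1 : 1 ≤ n) :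
    1 / ((n : ℝ) - f) ≤ 5 / 4 * (1 / n) := by
  have hn0 : (0 : ℝ) < n := by exact_mod_cast h1
  have hf : 5 * (f : ℝ) ≤ n := by nlinarith [mul_nonneg hδ.le (Nat.cast_nonneg (α := ℝ) f)]
  have hh : 0 < (n : ℝ) - f := by linarith
  rw [div_le_iff₀ hh]
  have : 5 / 4 * (1 / (n : ℝ)) * (n - f) = 5 / 4 * ((n - f) / n) := by ring
  rw [this]
  have h2 : 4 / 5 ≤ ((n : ℝ) - f) / n := by rw [le_div_iff₀ hn0]; linarith
  linarith

/-- Since `α ≤ 1/2`, the quotient is at most `18 * 3/2 * 4 = 108` times `α`, and `n - f ≥ 4n/5`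
bounds `α` by a multiple of `f / n`. -/
lemma c1_le (hδ : 0 < δ) (hn : (5 + δ) * f ≤ n) (h1 : 1 ≤ n) :
    c1 n f ≤ 270 * (f / n) ∧ c1 n f ≤ 54 := by
  have h0 := alpha_nonneg (n := n) (f := f) (by have := two_mul_lt_of_le hδ hn h1; omega)
  have h2 := alpha_le_half hδ hn h1
  have h3 : c1 n f ≤ 108 * alpha n f := by
    rw [c1, div_le_iff₀ (by nlinarith)]
    have h4 : 1 / 4 ≤ (1 - alpha n f) ^ 2 := by nlinarith
    calc 18 * alpha n f * (1 + alpha n f) ≤ 18 * alpha n f * (3 / 2) := by gcongr; linarith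
      _ = 108 * alpha n f * (1 / 4) := by ring
      _ ≤ _ := by gcongr
  refine ⟨h3.trans ?_, by linarith⟩
  have h5 : alpha n f = 2 * f * (1 / ((n : ℝ) - f)) := by rw [alpha]; ring
  have h6 : alpha n f ≤ 2 * f * (5 / 4 * (1 / n)) := by
    rw [h5]; gcongr; exact inv_card_le hδ hn h1
  calc _ ≤ 108 * (2 * f * (5 / 4 * (1 / (n : ℝ)))) := by gcongr
    _ = _ := by ring

lemma lam_le (hδ : 0 < δ) (hn : (5 + δ) * f ≤ n) (h1 : 1 ≤ n) :
    lam δ n f ≤ 80 * ((3 + δ) / δ) ^ 2 * ((f : ℝ) ^ 2 / n) := by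
  calc lam δ n f = ((3 + δ) / δ) ^ 2 * (64 * (f : ℝ) ^ 2) * (1 / ((n : ℝ) - f)) := by
        rw [lam]; ring
    _ ≤ ((3 + δ) / δ) ^ 2 * (64 * (f : ℝ) ^ 2) * (5 / 4 * (1 / n)) := by
        gcongr; exact inv_card_le hδ hn h1
    _ = _ := by ring

lemma c2_le (hδ : 0 < δ) (hn : (5 + δ) * f ≤ n) (h1 : 1 ≤ n) :
    c2 δ n f ≤ 72 * (810 + 39960 * ((3 + δ) / δ) ^ 2) * ((1 + f) ^ 2 / n) := by
  have hn0 : (0 : ℝ) < n := by exact_mod_cast h1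
  have hf0 : (0 : ℝ) ≤ f := Nat.cast_nonneg f
  have hfn : f ≤ n := by have := two_mul_lt_of_le hδ hn h1; omega
  obtain ⟨ha, hb⟩ := c1_le hδ hn h1
  have hl := lam_le hδ hn h1
  have hl0 := lam_nonneg δ hfn
  have hc1 := c1_nonneg hfn
  have hi := inv_card_le hδ hn h1
  have e1 : 3 / ((n : ℝ) - f) = 3 * (1 / ((n : ℝ) - f)) := by ring
  set c := ((3 + δ) / δ) ^ 2 with hc
  have hc0 : 0 ≤ c := sq_nonneg _
  have e2 : 9 * lam δ n f / 2 * (2 * c1 n f + 3) ≤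
      9 * (80 * c * ((f : ℝ) ^ 2 / n)) / 2 * 111 := by gcongr; linarith
  calc c2 δ n f ≤ 72 * (3 * (5 / 4 * (1 / (n : ℝ))) + 3 * (270 * (f / n))
        + 9 * (80 * c * ((f : ℝ) ^ 2 / n)) / 2 * 111) := by
        rw [c2, e1]; gcongr
    _ = 72 * ((15 / 4 + 810 * f + 39960 * c * f ^ 2) / n) := by field_simp; ring
    _ ≤ 72 * ((810 + 39960 * c) * (1 + f) ^ 2 / n) := by
        gcongr
        nlinarith [mul_nonneg hc0 hf0]
    _ = _ := by ring

lemma c3_le (hδ : 0 < δ) (hn : (5 + δ) * f ≤ n) (h1 : 1 ≤ n) :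
    c3 δ n f ≤ 7 * (1620 + 81000 * ((3 + δ) / δ) ^ 2) * ((f : ℝ) ^ 2 / n) := by
  have hn0 : (0 : ℝ) < n := by exact_mod_cast h1
  have hfn : f ≤ n := by have := two_mul_lt_of_le hδ hn h1; omega
  obtain ⟨ha, hb⟩ := c1_le hδ hn h1
  have hl := lam_le hδ hn h1
  have hl0 := lam_nonneg δ hfn
  have hc1 := c1_nonneg hfn
  -- As `f` is a natural number, the linear contribution of `c1` is quadratic too, and it vanishes
  -- for `f = 0`.
  have hff : (f : ℝ) ≤ (f : ℝ) ^ 2 := by exact_mod_cast Nat.le_self_pow two_ne_zero f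
  set c := ((3 + δ) / δ) ^ 2 with hc
  have e2 : 9 * lam δ n f / 2 * (4 * c1 n f + 9) ≤
      9 * (80 * c * ((f : ℝ) ^ 2 / n)) / 2 * 225 := by gcongr; linarith
  calc c3 δ n f ≤ 7 * (6 * (270 * ((f : ℝ) ^ 2 / n))
        + 9 * (80 * c * ((f : ℝ) ^ 2 / n)) / 2 * 225) := by
        rw [c3]
        have : 270 * ((f : ℝ) / n) ≤ 270 * ((f : ℝ) ^ 2 / n) := by gcongr
        gcongr
        linarith
    _ = _ := by ring

/-- The error of the bound is quadratic in the number of faulty nodes. -/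
lemma errorBound_le (hδ : 0 < δ) : ∃ B : ℝ, ∀ (n f T : ℕ) (L σ ζ c0 : ℝ), 1 ≤ n →
    (5 + δ) * f ≤ n → 1 ≤ T → 0 < L → 0 ≤ c0 →
      errorBound δ n f L σ ζ c0 T
        ≤ B * (√(L * c0 * σ ^ 2 * (1 + f) ^ 2 / (n * T)) + (f : ℝ) ^ 2 / n * ζ ^ 2
            + (L * c0 + σ ^ 2 / n) / T) := by
  set B₂ := 72 * (810 + 39960 * ((3 + δ) / δ) ^ 2) with hB₂
  set B₃ := 7 * (1620 + 81000 * ((3 + δ) / δ) ^ 2) with hB₃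
  -- The 45 is `36 * 5/4` from the last `σ²` term and also covers `12 + 9` from the two terms in `L
  -- c0 / T`, where `c1 ≤ 54` gives `√81 = 9`.
  refine ⟨2 * √B₂ + B₃ + 45, fun n f T L σ ζ c0 h1 hn hT hL hc0 => ?_⟩
  have hn0 : (0 : ℝ) < n := by exact_mod_cast h1
  have hT0 : (0 : ℝ) < T := by exact_mod_cast hT
  have hB₂0 : 0 ≤ B₂ := by positivity
  have hB₃0 : 0 ≤ B₃ := by positivity
  set S := √(L * c0 * σ ^ 2 * (1 + f) ^ 2 / (n * T)) with hS
  have t1 : √(c0 * c2 δ n f * L * σ ^ 2 / T) ≤ √B₂ * S := by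
    rw [hS, ← Real.sqrt_mul hB₂0]
    apply Real.sqrt_le_sqrt
    calc _ ≤ c0 * (B₂ * ((1 + f) ^ 2 / n)) * L * σ ^ 2 / T := by
          gcongr; exact c2_le hδ hn h1
      _ = _ := by field_simp
  have t2 : √(3 * c1 n f / 2) ≤ 9 := by
    rw [Real.sqrt_le_left (by norm_num)]
    linarith [(c1_le hδ hn h1).2]
  have t2' : L * c0 / T * √(3 * c1 n f / 2) ≤ L * c0 / T * 9 := by gcongr
  have t3 : 36 / T * (σ ^ 2 / ((n : ℝ) - f)) ≤ 45 * (σ ^ 2 / n / T) := by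
    calc _ = 36 * (σ ^ 2 / T) * (1 / ((n : ℝ) - f)) := by ring
      _ ≤ 36 * (σ ^ 2 / T) * (5 / 4 * (1 / n)) := by gcongr; exact inv_card_le hδ hn h1
      _ = _ := by ring
  have t4 : c3 δ n f * ζ ^ 2 ≤ B₃ * ((f : ℝ) ^ 2 / n * ζ ^ 2) := by
    rw [← mul_assoc]; gcongr; exact c3_le hδ hn h1
  have p1 : 0 ≤ S := Real.sqrt_nonneg _
  have p2 : 0 ≤ (f : ℝ) ^ 2 / n * ζ ^ 2 := by positivity
  have p3 : 0 ≤ L * c0 / T := by positivity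
  have p4 : 0 ≤ σ ^ 2 / n / T := by positivity
  have p5 : 0 ≤ √B₂ := Real.sqrt_nonneg _
  have e1 : (L * c0 + σ ^ 2 / n) / T = L * c0 / T + σ ^ 2 / n / T := add_div _ _ _
  have e2 : 12 * L * c0 / T = 12 * (L * c0 / T) := by ring
  rw [errorBound, e1, e2]
  set Z := (f : ℝ) ^ 2 / n * ζ ^ 2
  set U := L * c0 / T
  set V := σ ^ 2 / n / T
  have m1 := mul_nonneg p5 p2
  have m2 := mul_nonneg p5 p3
  have m3 := mul_nonneg p5 p4
  have m4 := mul_nonneg hB₃0 p1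
  have m5 := mul_nonneg hB₃0 p3
  have m6 := mul_nonneg hB₃0 p4
  calc _ ≤ 2 * (√B₂ * S) + 12 * U + U * 9 + 45 * V + B₃ * Z := by linarith
    _ ≤ _ := by linarith

end Asymptotics

end MoNNA

theorem mainTheorem5 (δ : ℝ) (hδ : 0 < δ) :
    -- the number of coordination rounds is `O(log n)`
    (∃ M : ℝ, ∀ n f : ℕ, 2 ≤ n → (5 + δ) * f ≤ n →
      (MoNNA.rounds δ n f : ℝ) ≤ M * Real.log n) ∧
    -- the convergence bound
    (∀ (n f d T : ℕ) (X Ω : Type*) [MeasurableSpace X] [MeasurableSpace Ω]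
      (μ : Measure Ω) [IsProbabilityMeasure μ]
      (q : MoNNA.Param d → X → ℝ) (D : Fin n → Measure X) [∀ i, IsProbabilityMeasure (D i)]
      (C : Finset (Fin n)) (L σ ζ c0 γ β : ℝ) (θ₀ : MoNNA.Param d),
      (5 + δ) * f ≤ n → C.card = n - f → 1 ≤ T → 0 < L →
      MoNNA.IsWellPosed q D C →
      MoNNA.IsLipschitzSmooth q D C L →
      MoNNA.HasBoundedVariance q D C σ →
      MoNNA.IsHeterogeneous q D C ζ →
      BddBelow (Set.range (MoNNA.avgLoss q D C)) →
      c0 = 12 * (MoNNA.avgLoss q D C θ₀ - MoNNA.optValue q D C) →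
      γ = MoNNA.learningRate δ n f L σ c0 T →
      β = MoNNA.momentumCoeff γ L →
      ∀ (e : MoNNA.Execution μ q D C f θ₀ γ β (MoNNA.rounds δ n f) T), ∀ i ∈ C,
        Integrable (fun ω => ‖gradient (MoNNA.avgLoss q D C) (e.output i ω)‖ ^ 2) μ ∧
        ∫ ω, ‖gradient (MoNNA.avgLoss q D C) (e.output i ω)‖ ^ 2 ∂μ
          ≤ MoNNA.errorBound δ n f L σ ζ c0 T) ∧
    -- the overhead is quadratic in `f`
    (∃ B : ℝ, ∀ (n f T : ℕ) (L σ ζ c0 : ℝ), 1 ≤ n → (5 + δ) * f ≤ n → 1 ≤ T → 0 < L → 0 ≤ c0 →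
      MoNNA.errorBound δ n f L σ ζ c0 T
        ≤ B * (√(L * c0 * σ ^ 2 * (1 + f) ^ 2 / (n * T)) + (f : ℝ) ^ 2 / n * ζ ^ 2
            + (L * c0 + σ ^ 2 / n) / T)) := by
  refine ⟨⟨_, fun n f h2 hn => MoNNA.rounds_le hδ h2 hn⟩, ?_, MoNNA.errorBound_le hδ⟩
  intro n f d T X Ω _ _ μ _ q D _ C L σ ζ c0 γ β θ₀ hn hcard hT hL hwp hsm hvar hhet hbdd hc0 hγ hβ
    e i hi
  exact e.integral_norm_gradient_output_le hδ hn hcard hT hL hwp hsm hvar hhet hbdd hc0 hγ hβ hi
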